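/- Consider oriented site percolation on the triangular lattice (the OTSP model) with parameter $p\in[0,1]$: let $(U_x)_{x\in\mathbb Z^2}$ be i.i.d. uniform on $[0,1]$; a site $x$ is open if $U_x<p$ and closed otherwise. From an open site $x$ there are directed edges to $x+(-1,0)$, $x+(0,1)$ and $x+(-1,1)$; from a closed site there are none. Let $\mathbf C_o=\mathbf C_o(p)$ be the set of sites reachable from the origin along directed edges (including the origin itself), and let $p_c=\inf\{p\in[0,1]:\mathbb P(|\mathbf C_o(p)|=\infty)>0\}$. For $n\ge 0$ let $w_n=\sup\{y:(-n,y)\in\mathbf C_o\}$ and $v_n=\inf\{y:(-n,y)\in\mathbf C_o\}$. Then $p_c<1$, and for each $p\in(p_c,1)$ there is exactly one real number $\rho_p$ (the boundary slope) such that, almost surely on the event $\{|\mathbf C_o(p)|=\infty\}$, $\frac{w_n}{-n}\to\rho_p$ and $\frac{v_n}{-n}\to 1/\rho_p$ as $n\to\infty$. The function $p\mapsto\rho_p$ is continuous and strictly decreasing on $(p_c,1)$, and $\rho_p\uparrow-1$ as $p\downarrow p_c$. -/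

import Mathlib

open MeasureTheory Filter Topology Set

namespace OTSP

/-- An environment on `ℤ²`: every site `x` carries the set `G x` of steps allowed from `x`. -/
abbrev Env : Type := ℤ × ℤ → Set (ℤ × ℤ)

/-- `x → y`: there are `n ≥ 0` and `x = x₀, …, xₙ = y` with `xᵢ₊₁ - xᵢ ∈ G xᵢ` for `i < n`. -/
def Connects (G : Env) : ℤ × ℤ → ℤ × ℤ → Prop :=
  Relation.ReflTransGen fun a b => b - a ∈ G a

/-- The forward cluster of `x`. -/
def cluster (G : Env) (x : ℤ × ℤ) : Set (ℤ × ℤ) := {y | Connects G x y}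

/-- The three steps of an open site: left, up, and diagonally up-left. -/
def steps : Set (ℤ × ℤ) := {(-1, 0), (0, 1), (-1, 1)}

/-- A realisation of the uniform random variables `U x`, one for each site. -/
abbrev Sample : Type := ℤ × ℤ → unitInterval

/-- The joint law of i.i.d. uniform random variables on `[0, 1]` indexed by the sites. -/
noncomputable def law : Measure Sample :=
  Measure.infinitePi fun _ : ℤ × ℤ => (volume : Measure unitInterval)

/-- The environment with parameter `p` (coupled for all `p`): a site is open iff `U x < p`. -/
def env (p : ℝ) (U : Sample) : Env := fun x => {e | (U x : ℝ) < p ∧ e ∈ steps}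

/-- The forward cluster of the origin at parameter `p`. -/
def originCluster (p : ℝ) (U : Sample) : Set (ℤ × ℤ) := cluster (env p U) (0, 0)

/-- The probability that the forward cluster of the origin is infinite. -/
noncomputable def theta (p : ℝ) : ENNReal := law {U | (originCluster p U).Infinite}

/-- The critical value. -/
noncomputable def pc : ℝ := sInf {p : ℝ | p ∈ Icc (0 : ℝ) 1 ∧ 0 < theta p}

/-- `w n = sup {y | (-n, y) ∈ C}`, in the extended reals. -/
noncomputable def upper (C : Set (ℤ × ℤ)) (n : ℕ) : EReal :=
  ⨆ y ∈ {y : ℤ | (-(n : ℤ), y) ∈ C}, ((y : ℝ) : EReal)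

/-- `v n = inf {y | (-n, y) ∈ C}`, in the extended reals. -/
noncomputable def lower (C : Set (ℤ × ℤ)) (n : ℕ) : EReal :=
  ⨅ y ∈ {y : ℤ | (-(n : ℤ), y) ∈ C}, ((y : ℝ) : EReal)

/-- `r` is the boundary slope at parameter `p`: almost surely on the event that the cluster of the
origin is infinite, its upper and lower boundaries have asymptotic slopes `r` and `1 / r`. -/
def IsBoundarySlope (p r : ℝ) : Prop :=
  ∀ᵐ U ∂law, (originCluster p U).Infinite →
    Tendsto (fun n : ℕ => upper (originCluster p U) n / ((-(n : ℝ) : ℝ) : EReal))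
      atTop (𝓝 (r : EReal)) ∧
    Tendsto (fun n : ℕ => lower (originCluster p U) n / ((-(n : ℝ) : ℝ) : EReal))
      atTop (𝓝 ((1 / r : ℝ) : EReal))

end OTSP

namespace OTSP

open ProbabilityTheory

/-! ### Directed paths in a set of open sites -/

/-! After a reflection the steps go right, up and diagonally, and the model is symmetric under the
swap of the coordinates. The central object is `top`, the upper edge of everything reached from a
half-line of heights in one column. Restarting from the full half-line under the current edge only
adds paths, so the edge is subadditive, and its mean speed is `speed p`, the infimum of `meanTop p n
/ n`. The boundary slope is `-speed p`; the lower boundary is the upper edge of the swapped picture,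
hence the reciprocal slope.

Upper bounds are soft. The edge restarted every `m` columns has independent increments, so the
strong law bounds the true edge by any slope above `speed p` (`ae_top_le`). If the speed were below
1, this bound and its mirror image would confine the cluster to a finite region; hence percolation
forces speed at least 1 (`le_meanTop_of_theta_pos`).

Lower bounds use renormalisation. When every `meanTop p n` is at least `s * n` with `s > 1`, the
highest path stays with high probability in a thin tube of slope `speed p` (`exists_failProb_le`).
Tubes of slope `s` and their reflections, of slope `1 / s`, are linked into longer tubes because
planar directed paths that cross share a site (`Reach.cross`, `Admissible.link`). A larger tube
contains two disjoint chains, so its failure probability is squared (`Admissible.failProb_le`), and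
the iteration with Borel–Cantelli gives a linear lower bound (`ScaleInv.ae_le_top`). The only input
is one crossing estimate at one scale, which survives a small decrease of `p`
(`exists_lt_failProb_lt`). An edge faster than slope 1, together with its reflection, forces an
infinite cluster (`Good.exists_infinite_reachSet`).

The rest follows. At `p = 1` tubes are crossed surely, so `pc < 1`. Opening extra sites at the edge
raises the mean by at least `p' - p` per column (`meanTop_add_le`), which gives strict monotonicity
and, with the bound 1, speed above 1 for every `p > pc`. Right-continuity holds because each mean is
right-continuous and the speed is an infimum; left-continuity is the stability of the crossing
estimate. The same stability at `pc` excludes a uniform mean slope above 1 there, since percolation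
would then occur below `pc`; so the speed tends to 1. Finally, an infinite cluster meets the path to
the edge, so its boundary is the edge. -/

/-- A step right, up or diagonally out of a site of `O`. -/
def Step (O : Set (ℤ × ℤ)) (x y : ℤ × ℤ) : Prop :=
  x ∈ O ∧ (y = (x.1 + 1, x.2) ∨ y = (x.1, x.2 + 1) ∨ y = (x.1 + 1, x.2 + 1))

/-- Existence of a directed path all of whose sites but the last lie in `O`. -/
def Reach (O : Set (ℤ × ℤ)) : ℤ × ℤ → ℤ × ℤ → Prop := Relation.ReflTransGen (Step O)

section
variable {O O' R : Set (ℤ × ℤ)} {x y u v q : ℤ × ℤ}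

theorem Step.mono (h : O ⊆ O') (hs : Step O x y) : Step O' x y := ⟨h hs.1, hs.2⟩

theorem Reach.mono (h : O ⊆ O') (hr : Reach O x y) : Reach O' x y :=
  Relation.ReflTransGen.mono (fun _ _ => Step.mono h) _ _ hr

theorem Reach.trans (h : Reach O x y) (h' : Reach O y u) : Reach O x u :=
  Relation.ReflTransGen.trans h h'

theorem Reach.refl (x : ℤ × ℤ) : Reach O x x := Relation.ReflTransGen.refl

theorem Step.reach (h : Step O x y) : Reach O x y := Relation.ReflTransGen.single h

theorem Step.le (h : Step O x y) : x.1 ≤ y.1 ∧ x.2 ≤ y.2 ∧ y.1 ≤ x.1 + 1 := by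
  rcases h.2 with h | h | h <;> subst h <;> simp

theorem Reach.le (h : Reach O x y) : x.1 ≤ y.1 ∧ x.2 ≤ y.2 := by
  induction h with
  | refl => simp
  | tail _ h ih => have := h.le; omega

theorem Reach.eq_or_mem (h : Reach O x y) : x = y ∨ x ∈ O := by
  rcases Relation.ReflTransGen.cases_head h with h | ⟨c, h, -⟩
  · exact .inl h
  · exact .inr h.1

theorem Reach.exists_column (h : Reach O x y) {c : ℤ} (h1 : x.1 ≤ c) (h2 : c ≤ y.1) :
    ∃ q : ℤ × ℤ, q.1 = c ∧ Reach O x q ∧ Reach O q y := by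
  induction h with
  | refl => exact ⟨x, by omega, .refl _, .refl _⟩
  | @tail y y' hr hs ih =>
    by_cases hc : c ≤ y.1
    · obtain ⟨q, hq, h3, h4⟩ := ih hc
      exact ⟨q, hq, h3, h4.trans hs.reach⟩
    · have := hs.le
      exact ⟨y', by omega, hr.trans hs.reach, .refl _⟩

theorem Reach.inter (h : Reach O x y) (hR : ∀ q, Reach O x q → Reach O q y → q ∈ R) :
    Reach (O ∩ R) x y := by
  induction h with
  | refl => exact .refl _
  | @tail y y' hr hs ih =>
    refine (ih fun q h1 h2 => hR q h1 (h2.trans hs.reach)).trans (Step.reach ⟨⟨hs.1, ?_⟩, hs.2⟩)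
    exact hR y hr hs.reach

/-- Two directed paths that cross have a common site. -/
theorem Reach.cross (hxy : Reach O x y) (huv : Reach O u v) (h1 : x.1 = u.1) (h2 : y.1 = v.1)
    (h3 : x.2 ≤ u.2) (h4 : v.2 ≤ y.2) :
    ∃ q, Reach O x q ∧ Reach O q y ∧ Reach O u q ∧ Reach O q v := by
  induction hxy using Relation.ReflTransGen.head_induction_on generalizing u with
  | refl =>
    have := huv.le
    have e1 : u = y := Prod.ext (by omega) (by omega)
    subst e1
    exact ⟨u, .refl _, .refl _, .refl _, huv⟩
  | @head x x' hs hr ih =>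
    by_cases hxu : x = u
    · subst hxu
      exact ⟨x, .refl _, hs.reach.trans hr, .refl _, huv⟩
    have hlt : x.2 < u.2 := lt_of_le_of_ne h3 fun h => hxu (Prod.ext h1 h)
    have hle := Reach.le hr
    -- When the first path changes column, the second is advanced to the same column. The first
    -- rises by at most one per step and was strictly below, so it is still not above.
    have key : ∃ u', Reach O u u' ∧ Reach O u' v ∧ x'.1 = u'.1 ∧ x'.2 ≤ u'.2 := by
      have : ((x.1 + 1 = x'.1) ∧ x'.2 ≤ x.2 + 1) ∨ (x'.1 = x.1 ∧ x'.2 = x.2 + 1) := by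
        rcases hs.2 with h | h | h <;> subst h <;> simp
      rcases this with ⟨h5, h6⟩ | ⟨h5, h6⟩
      · obtain ⟨w, hw, h7, h8⟩ := huv.exists_column (c := x'.1) (by omega) (by omega)
        have := h7.le
        exact ⟨w, h7, h8, hw.symm, by omega⟩
      · exact ⟨u, .refl _, huv, by omega, by omega⟩
    obtain ⟨u', h5, h6, h7, h8⟩ := key
    obtain ⟨q, k1, k2, k3, k4⟩ := ih h6 h7 h8
    exact ⟨q, hs.reach.trans k1, k2, h5.trans k3, k4⟩

theorem Reach.cross_left (hxy : Reach O x y) (huv : Reach O u v) (h1 : x.1 = u.1)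
    (h2 : y.1 = v.1) (h3 : x.2 ≤ u.2) (h4 : v.2 ≤ y.2) : Reach O x v := by
  obtain ⟨q, k1, -, -, k4⟩ := hxy.cross huv h1 h2 h3 h4
  exact k1.trans k4

theorem Reach.cross_right (hxy : Reach O x y) (huv : Reach O u v) (h1 : x.1 = u.1)
    (h2 : y.1 = v.1) (h3 : x.2 ≤ u.2) (h4 : v.2 ≤ y.2) : Reach O u y := by
  obtain ⟨q, -, k2, k3, -⟩ := hxy.cross huv h1 h2 h3 h4
  exact k3.trans k2

/-- The reflection of a set of sites in the diagonal. -/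
def flip (O : Set (ℤ × ℤ)) : Set (ℤ × ℤ) := Prod.swap ⁻¹' O

theorem mem_flip : x ∈ flip O ↔ x.swap ∈ O := Iff.rfl

theorem Reach.flip (h : Reach O x y) : Reach (flip O) x.swap y.swap := by
  refine Relation.ReflTransGen.lift Prod.swap ?_ _ _ h
  rintro a b ⟨h1, h2⟩
  refine ⟨h1, ?_⟩
  rcases h2 with h | h | h <;> subst h <;> simp [Prod.swap]

theorem reach_flip : Reach (OTSP.flip O) x y ↔ Reach O x.swap y.swap :=
  ⟨fun h => h.flip, fun h => h.flip⟩

theorem Reach.translate (z : ℤ × ℤ) (h : Reach ((fun w => w + z) ⁻¹' O) x y) :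
    Reach O (x + z) (y + z) := by
  refine Relation.ReflTransGen.lift (· + z) ?_ _ _ h
  rintro a b ⟨h1, h2⟩
  refine ⟨h1, ?_⟩
  rcases h2 with h | h | h <;> subst h <;> simp [Prod.ext_iff] <;> omega

theorem reach_translate (z : ℤ × ℤ) :
    Reach ((fun w => w + z) ⁻¹' O) x y ↔ Reach O (x + z) (y + z) := by
  refine ⟨Reach.translate z, fun h => ?_⟩
  have : O = (fun w => w + (-z)) ⁻¹' ((fun w => w + z) ⁻¹' O) := by
    ext w; simp
  rw [this] at h
  simpa using h.translate (-z)

/-! ### Entry heights, column by column -/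

/-- The heights at which paths entering column `a` at heights in `E` enter column `a + 1`. -/
def colStep (O : Set (ℤ × ℤ)) (a : ℤ) (E : Set ℤ) : Set ℤ :=
  {y | ∃ e ∈ E, ∃ j, e ≤ j ∧ (∀ i, e ≤ i → i ≤ j → (a, i) ∈ O) ∧ (y = j ∨ y = j + 1)}

/-- The heights at which paths entering column `a` at heights in `E` enter column `a + n`. -/
def ent (O : Set (ℤ × ℤ)) (a : ℤ) (E : Set ℤ) : ℕ → Set ℤ
  | 0 => E
  | n + 1 => colStep O (a + n) (ent O a E n)

variable {a b : ℤ} {E E' : Set ℤ} {n m : ℕ}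

theorem colStep_mono (hO : ∀ i, (a, i) ∈ O → (a, i) ∈ O') (hE : E ⊆ E') :
    colStep O a E ⊆ colStep O' a E' := by
  rintro y ⟨e, he, j, hj, hr, hy⟩
  exact ⟨e, hE he, j, hj, fun i h1 h2 => hO _ (hr i h1 h2), hy⟩

theorem ent_mono_of_col (hE : E ⊆ E')
    (hO : ∀ x : ℤ × ℤ, a ≤ x.1 → x.1 < a + n → x ∈ O → x ∈ O') : ent O a E n ⊆ ent O' a E' n := by
  induction n with
  | zero => exact hE
  | succ n ih =>
    refine colStep_mono (fun i => hO _ (by simp) (by push_cast; simp)) (ih fun x h1 h2 => ?_)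
    exact hO x h1 (by push_cast; omega)

theorem ent_mono (hO : O ⊆ O') (hE : E ⊆ E') : ent O a E n ⊆ ent O' a E' n :=
  ent_mono_of_col hE fun _ _ _ h => hO h

theorem ent_add : ent O a E (m + n) = ent O (a + m) (ent O a E m) n := by
  induction n with
  | zero => rfl
  | succ n ih =>
    rw [← add_assoc]
    simp only [ent]
    rw [ih]; push_cast; rw [add_assoc]

theorem ent_union : ent O a (E ∪ E') n = ent O a E n ∪ ent O a E' n := by
  induction n with
  | zero => rfl
  | succ n ih =>
    simp only [ent, ih]
    ext y
    constructor
    · rintro ⟨e, he | he, h⟩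
      · exact .inl ⟨e, he, h⟩
      · exact .inr ⟨e, he, h⟩
    · rintro (⟨e, he, h⟩ | ⟨e, he, h⟩)
      · exact ⟨e, .inl he, h⟩
      · exact ⟨e, .inr he, h⟩

theorem reach_run {c e j : ℤ} (hj : e ≤ j) (hr : ∀ i, e ≤ i → i < j → (c, i) ∈ O) :
    Reach O (c, e) (c, j) := by
  induction j, hj using Int.leInduction with
  | base => exact .refl _
  | succ j hj ih =>
    refine (ih fun i h1 h2 => hr i h1 (by omega)).trans (Step.reach ⟨hr j hj (by omega), ?_⟩)
    simp

theorem exists_last_of_mem_ent_succ {z : ℤ} (h : z ∈ ent O a E (n + 1)) :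
    ∃ e ∈ E, ∃ j, Reach O (a, e) (a + n, j) ∧ (a + n, j) ∈ O ∧ (z = j ∨ z = j + 1) := by
  induction n generalizing z with
  | zero =>
    obtain ⟨e, he, j, hj, hr, hy⟩ := h
    refine ⟨e, he, j, ?_, ?_, hy⟩
    · simp only [Nat.cast_zero, add_zero] at hr ⊢
      exact reach_run hj fun i h1 h2 => hr i h1 h2.le
    · exact hr j hj le_rfl
  | succ n ih =>
    obtain ⟨e, he, j, hj, hr, hy⟩ := h
    obtain ⟨e0, he0, i, h1, h2, h3⟩ := ih he
    refine ⟨e0, he0, j, ?_, hr j hj le_rfl, hy⟩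
    have hs : Reach O (a, e0) (a + (n + 1 : ℕ), e) := by
      refine h1.trans (Step.reach ⟨h2, ?_⟩)
      rcases h3 with h3 | h3 <;> subst h3 <;> simp [add_assoc]
    exact hs.trans (reach_run hj fun i h1 h2 => hr i h1 h2.le)

theorem exists_reach_of_mem_ent {z : ℤ} (h : z ∈ ent O a E n) :
    ∃ e ∈ E, Reach O (a, e) (a + n, z) := by
  cases n with
  | zero => exact ⟨z, h, by simpa using Reach.refl _⟩
  | succ n =>
    obtain ⟨e, he, j, h1, h2, h3⟩ := exists_last_of_mem_ent_succ h
    refine ⟨e, he, h1.trans (Step.reach ⟨h2, ?_⟩)⟩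
    rcases h3 with h3 | h3 <;> subst h3 <;> simp [add_assoc]

/-- The end of the path is a vertical climb inside the final column. Its last site need not be open,
so the run stops below `z`. -/
theorem Reach.exists_ent {e z c : ℤ} (he : e ∈ E) (h : Reach O (a, e) (c, z)) (hc : c = a + n) :
    ∃ z' ∈ ent O a E n, z' ≤ z ∧ ∀ i, z' ≤ i → i < z → (c, i) ∈ O := by
  suffices ∀ w, Reach O (a, e) w → ∀ n : ℕ, w.1 = a + n →
      ∃ z' ∈ ent O a E n, z' ≤ w.2 ∧ ∀ i, z' ≤ i → i < w.2 → (w.1, i) ∈ O from this _ h n hc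
  intro w hw
  induction hw with
  | refl =>
    intro n hn
    have : n = 0 := by simpa using hn
    subst this
    exact ⟨e, he, le_rfl, fun i h1 h2 => by simp at h2; omega⟩
  | @tail w w' hr hs ih =>
    intro n hn
    have hle := Reach.le hr
    obtain ⟨k, hk⟩ : ∃ k : ℕ, w.1 = a + k := ⟨(w.1 - a).toNat, by simp at hle; omega⟩
    obtain ⟨z', h1, h2, h3⟩ := ih k hk
    have hrun : ∀ i, z' ≤ i → i ≤ w.2 → (a + k, i) ∈ O := by
      intro i h4 h5
      rcases h5.lt_or_eq with h5 | h5
      · rw [← hk]; exact h3 i h4 h5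
      · subst h5; rw [← hk]; exact hs.1
    rcases hs.2 with h | h | h
    · subst h
      have : n = k + 1 := by simp at hn; omega
      subst this
      exact ⟨w.2, ⟨z', h1, w.2, h2, hrun, .inl rfl⟩, le_rfl, fun i h4 h5 => by simp at h5; omega⟩
    · subst h
      have : n = k := by simp at hn; omega
      subst this
      refine ⟨z', h1, by simp; omega, fun i h4 h5 => ?_⟩
      simp only at h5 ⊢
      rw [hk]; exact hrun i h4 (by omega)
    · subst h
      have : n = k + 1 := by simp at hn; omega
      subst this
      exact ⟨w.2 + 1, ⟨z', h1, w.2, h2, hrun, .inr rfl⟩, le_rfl,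
        fun i h4 h5 => by simp at h5; omega⟩

/-- A site reached in column `a + n` is entered there, or its height is entered one column later. -/
theorem Reach.mem_ent_or {e z c : ℤ} (he : e ∈ E) (h : Reach O (a, e) (c, z)) (hc : c = a + n) :
    z ∈ ent O a E n ∨ z ∈ ent O a E (n + 1) := by
  obtain ⟨z', h1, h2, h3⟩ := h.exists_ent he hc
  rcases h2.eq_or_lt with h2 | h2
  · exact .inl (h2 ▸ h1)
  · refine .inr ⟨z', h1, z - 1, by omega, fun i h4 h5 => ?_, .inr (by omega)⟩
    rw [← hc]; exact h3 i h4 (by omega)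

theorem ent_translate (z : ℤ × ℤ) :
    ent ((fun w => w + z) ⁻¹' O) a E n = (fun i => i + z.2) ⁻¹' ent O (a + z.1) ((fun i => i - z.2) ⁻¹' E) n := by
  induction n with
  | zero => ext i; simp [ent]
  | succ n ih =>
    simp only [ent, ih]
    ext y
    constructor
    · rintro ⟨e, he, j, hj, hr, hy⟩
      refine ⟨e + z.2, he, j + z.2, by omega, fun i h1 h2 => ?_, by simp; omega⟩
      have := hr (i - z.2) (by omega) (by omega)
      rw [mem_preimage] at this
      have e : ((a + n, i - z.2) : ℤ × ℤ) + z = (a + z.1 + n, i) := by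
        ext <;> simp; ring
      rwa [e] at this
    · rintro ⟨e, he, j, hj, hr, hy⟩
      simp only at hy
      refine ⟨e - z.2, by simpa using he, j - z.2, by omega, fun i h1 h2 => ?_, by omega⟩
      have := hr (i + z.2) (by omega) (by omega)
      have e : ((a + n, i) : ℤ × ℤ) + z = (a + z.1 + n, i + z.2) := by
        ext <;> simp; ring
      rw [mem_preimage, e]; exact this

/-! ### The upper edge -/

/-- Every column has closed sites arbitrarily high, and every strip of columns has completely open
rows arbitrarily low. -/
structure Good (O : Set (ℤ × ℤ)) : Prop where
  closed : ∀ a b : ℤ, ∃ i, b ≤ i ∧ (a, i) ∉ O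
  row : ∀ (a b : ℤ) (n : ℕ), ∃ i ≤ b, ∀ k : ℕ, k < n → (a + k, i) ∈ O

/-- The height of the highest entry into column `a + n` from the half-line of heights at most `b`
in column `a`. -/
noncomputable def top (O : Set (ℤ × ℤ)) (a b : ℤ) (n : ℕ) : ℤ := sSup (ent O a (Iic b) n)

theorem Good.bddAbove_ent (hO : Good O) (hE : BddAbove E) (n : ℕ) : BddAbove (ent O a E n) := by
  induction n with
  | zero => exact hE
  | succ n ih =>
    obtain ⟨B, hB⟩ := ih
    obtain ⟨i, hi, hc⟩ := hO.closed (a + n) B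
    refine ⟨i, ?_⟩
    rintro y ⟨e, he, j, hj, hr, hy⟩
    have := hB he
    by_contra hlt
    exact hc (hr i (by omega) (by omega))

theorem mem_ent_of_row {i : ℤ} (hi : i ∈ E) (hr : ∀ k : ℕ, k < n → (a + k, i) ∈ O) :
    i ∈ ent O a E n := by
  induction n with
  | zero => exact hi
  | succ n ih =>
    refine ⟨i, ih fun k hk => hr k (by omega), i, le_rfl, fun j h1 h2 => ?_, .inl rfl⟩
    obtain rfl : j = i := by omega
    exact hr n (by omega)

theorem Good.ent_nonempty (hO : Good O) (a b : ℤ) (n : ℕ) : (ent O a (Iic b) n).Nonempty := by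
  obtain ⟨i, hi, h⟩ := hO.row a b n
  exact ⟨i, mem_ent_of_row hi h⟩

theorem Good.isGreatest_top (hO : Good O) (a b : ℤ) (n : ℕ) :
    IsGreatest (ent O a (Iic b) n) (top O a b n) :=
  ⟨Int.csSup_mem (hO.ent_nonempty a b n) (hO.bddAbove_ent bddAbove_Iic n),
    fun _ h => le_csSup (hO.bddAbove_ent bddAbove_Iic n) h⟩

theorem Good.le_top (hO : Good O) {z : ℤ} (h : z ∈ ent O a (Iic b) n) : z ≤ top O a b n :=
  (hO.isGreatest_top a b n).2 h

theorem Good.top_mem (hO : Good O) : top O a b n ∈ ent O a (Iic b) n :=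
  (hO.isGreatest_top a b n).1

theorem Good.top_mono (hO : Good O) (hO' : Good O') (h : O ⊆ O') {b' : ℤ} (hb : b ≤ b') :
    top O a b n ≤ top O' a b' n :=
  hO'.le_top (ent_mono h (Iic_subset_Iic.2 hb) hO.top_mem)

@[simp] theorem top_zero : top O a b 0 = b := csSup_Iic

/-- Subadditivity: all entries into column `a + m` lie in the half-line below the topmost one, and a
larger starting set gives a higher edge. -/
theorem Good.top_add_le (hO : Good O) : top O a b (m + n) ≤ top O (a + m) (top O a b m) n := by
  refine hO.le_top ?_
  have := hO.top_mem (a := a) (b := b) (n := m + n)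
  rw [ent_add] at this
  exact ent_mono subset_rfl (fun z hz => hO.le_top hz) this

/-- `top` ignores the climb inside the last column; such a climb is seen one column later, whence
the maximum. -/
theorem Good.reach_le (hO : Good O) {e z c : ℤ} (he : e ≤ b) (h : Reach O (a, e) (c, z))
    (hc : c = a + n) : z ≤ max (top O a b n) (top O a b (n + 1)) := by
  rcases h.mem_ent_or (E := Iic b) he hc with h | h
  · exact le_max_of_le_left (hO.le_top h)
  · exact le_max_of_le_right (hO.le_top h)

theorem Good.translate (hO : Good O) (z : ℤ × ℤ) : Good ((fun w => w + z) ⁻¹' O) where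
  closed a b := by
    obtain ⟨i, h1, h2⟩ := hO.closed (a + z.1) (b + z.2)
    refine ⟨i - z.2, by omega, fun h => h2 ?_⟩
    have e : ((a, i - z.2) : ℤ × ℤ) + z = (a + z.1, i) := by ext <;> simp
    rwa [mem_preimage, e] at h
  row a b n := by
    obtain ⟨i, h1, h2⟩ := hO.row (a + z.1) (b + z.2) n
    refine ⟨i - z.2, by omega, fun k hk => ?_⟩
    have e : ((a + k, i - z.2) : ℤ × ℤ) + z = (a + z.1 + k, i) := by ext <;> simp; ring
    rw [mem_preimage, e]
    exact h2 k hk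

theorem Good.top_translate (hO : Good O) (z : ℤ × ℤ) :
    top ((fun w => w + z) ⁻¹' O) a b n = top O (a + z.1) (b + z.2) n - z.2 := by
  have e : (fun i => i - z.2) ⁻¹' Iic b = Iic (b + z.2) := by
    ext i; simp
  refine (hO.translate z).isGreatest_top a b n |>.unique ⟨?_, fun y hy => ?_⟩
  · rw [ent_translate, e]
    simpa using hO.top_mem
  · rw [ent_translate, e] at hy
    have : y + z.2 ≤ _ := hO.le_top hy
    omega

end


/-! ### The product measure -/

instance : IsProbabilityMeasure law := by unfold law; infer_instance

/-- The set of open sites at parameter `p`. -/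
def opn (p : ℝ) (U : Sample) : Set (ℤ × ℤ) := {x | (U x : ℝ) < p}

theorem opn_mono {p p' : ℝ} (h : p ≤ p') (U : Sample) : opn p U ⊆ opn p' U :=
  fun _ hx => lt_of_lt_of_le hx h

/-- Reindexing of the sites. -/
def reindex (e : ℤ × ℤ ≃ ℤ × ℤ) : Sample ≃ᵐ Sample :=
  MeasurableEquiv.piCongrLeft (fun _ => unitInterval) e.symm

theorem reindex_apply (e : ℤ × ℤ ≃ ℤ × ℤ) (U : Sample) (x : ℤ × ℤ) :
    reindex e U x = U (e x) := by
  have := Equiv.piCongrLeft_apply_apply (fun _ : ℤ × ℤ => unitInterval) e.symm U (e x)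
  rw [e.symm_apply_apply] at this
  exact this

theorem opn_reindex (e : ℤ × ℤ ≃ ℤ × ℤ) (p : ℝ) (U : Sample) :
    opn p (reindex e U) = e ⁻¹' opn p U := by
  ext x; simp [opn, reindex_apply]

theorem measurePreserving_reindex (e : ℤ × ℤ ≃ ℤ × ℤ) : MeasurePreserving (reindex e) law law := by
  refine ⟨(reindex e).measurable, ?_⟩
  have := Measure.infinitePi_map_piCongrLeft (μ := fun _ : ℤ × ℤ => (volume : Measure unitInterval))
    e.symm
  simpa [reindex, law] using this

theorem ae_reindex (e : ℤ × ℤ ≃ ℤ × ℤ) {P : Sample → Prop} (h : ∀ᵐ U ∂law, P U) :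
    ∀ᵐ U ∂law, P (reindex e U) :=
  (measurePreserving_reindex e).quasiMeasurePreserving.ae h

theorem law_reindex (e : ℤ × ℤ ≃ ℤ × ℤ) (S : Set Sample) : law (reindex e ⁻¹' S) = law S :=
  (measurePreserving_reindex e).measure_preimage_equiv S

/-- The events that depend only on the sites of `S`. -/
abbrev sites (S : Set (ℤ × ℤ)) : MeasurableSpace Sample :=
  ⨆ x ∈ S, MeasurableSpace.comap (fun U : Sample => U x) inferInstance

theorem sites_le (S : Set (ℤ × ℤ)) : sites S ≤ (inferInstance : MeasurableSpace Sample) :=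
  iSup₂_le fun x _ => (measurable_pi_apply x).comap_le

theorem sites_mono {S T : Set (ℤ × ℤ)} (h : S ⊆ T) : sites S ≤ sites T :=
  biSup_mono h

theorem indep_sites {S T : Set (ℤ × ℤ)} (h : Disjoint S T) : Indep (sites S) (sites T) law := by
  refine indep_iSup_of_disjoint (fun x => (measurable_pi_apply x).comap_le) ?_ h
  have := iIndepFun_infinitePi (P := fun _ : ℤ × ℤ => (volume : Measure unitInterval))
    (X := fun _ => id) (fun _ => measurable_id)
  exact this

theorem measurable_mem_opn {S : Set (ℤ × ℤ)} {x : ℤ × ℤ} (hx : x ∈ S) (p : ℝ) :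
    Measurable[sites S] (fun U => x ∈ opn p U) := by
  have h1 : Measurable[sites S] (fun U : Sample => U x) := by
    refine Measurable.mono (comap_measurable _) ?_ le_rfl
    exact le_iSup₂ (f := fun x (_ : x ∈ S) =>
      MeasurableSpace.comap (fun U : Sample => U x) inferInstance) x hx
  have h2 : Measurable fun u : unitInterval => (u : ℝ) < p :=
    measurableSet_setOfPred.1 (measurableSet_lt measurable_subtype_coe measurable_const)
  exact h2.comp h1

theorem measurableSet_sites {S : Set (ℤ × ℤ)} {P : Sample → Prop} (h : Measurable[sites S] P) :
    MeasurableSet[sites S] {U | P U} :=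
  (@measurableSet_setOfPred _ (sites S) P).2 h

/-- Stated for an arbitrary measurable space so that it also applies to the sub-σ-algebras `sites
S`. -/
theorem measurable_int_comp {Ω β : Type*} [MeasurableSpace Ω] [MeasurableSpace β] {f : Ω → ℤ}
    (hf : Measurable f) (g : ℤ → β) : Measurable fun ω => g (f ω) :=
  (measurable_of_countable g).comp hf

theorem measurable_mem_opn' (x : ℤ × ℤ) (p : ℝ) : Measurable (fun U => x ∈ opn p U) :=
  (measurable_mem_opn (mem_univ x) p).mono (sites_le _) le_rfl

theorem law_lt (x : ℤ × ℤ) {p : ℝ} (h0 : 0 ≤ p) (h1 : p ≤ 1) :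
    law {U | (U x : ℝ) < p} = ENNReal.ofReal p := by
  have h := (measurePreserving_eval_infinitePi
    (fun _ : ℤ × ℤ => (volume : Measure unitInterval)) x).measure_preimage
    (s := Iio ⟨p, h0, h1⟩) measurableSet_Iio.nullMeasurableSet
  rw [unitInterval.volume_Iio] at h
  exact h

theorem law_eq (x : ℤ × ℤ) (p : ℝ) : law {U | (U x : ℝ) = p} = 0 := by
  by_cases hp : p ∈ unitInterval
  · have h := (measurePreserving_eval_infinitePi
      (fun _ : ℤ × ℤ => (volume : Measure unitInterval)) x).measure_preimage
      (s := {⟨p, hp⟩}) (measurableSet_singleton _).nullMeasurableSet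
    rw [measure_singleton] at h
    rw [← h]
    congr 1
    ext U
    simp [Subtype.ext_iff]
  · convert measure_empty (μ := law)
    ext U
    simp only [mem_ofPred_eq, mem_empty_iff_false, iff_false]
    rintro rfl
    exact hp (U x).2

/-- If `Z` is determined by one σ-algebra and `D z` by an independent one, with probability not
depending on `z`, then `D (Z ω)` has this probability and is independent of the first one. -/
theorem measure_restart {Ω : Type*} {m1 m2 m0 : MeasurableSpace Ω} {μ : Measure Ω}
    (hi : Indep m1 m2 μ) (h1 : m1 ≤ m0) (h2 : m2 ≤ m0) {Z : Ω → ℤ} (hZ : Measurable[m1] Z)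
    {B : Set Ω} (hB : MeasurableSet[m1] B) {D : ℤ → Set Ω} (hD : ∀ z, MeasurableSet[m2] (D z))
    {d : ENNReal} (hd : ∀ z, μ (D z) = d) : μ (B ∩ {ω | ω ∈ D (Z ω)}) = μ B * d := by
  have hm : ∀ z, MeasurableSet[m1] (B ∩ Z ⁻¹' {z}) := fun z =>
    hB.inter (hZ (measurableSet_singleton z))
  have e1 : B ∩ {ω | ω ∈ D (Z ω)} = ⋃ z, (B ∩ Z ⁻¹' {z}) ∩ D z := by
    ext ω; simp
  have e2 : B = ⋃ z, B ∩ Z ⁻¹' {z} := by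
    ext ω; simp
  have d1 : Pairwise (Function.onFun Disjoint fun z => B ∩ Z ⁻¹' {z}) := by
    intro z z' hz
    refine Set.disjoint_left.2 fun ω h h' => hz ?_
    exact h.2.symm.trans h'.2
  rw [e1, measure_iUnion (fun z z' hz => (d1 hz).mono inter_subset_left inter_subset_left)
    fun z => (h1 _ (hm z)).inter (h2 _ (hD z))]
  conv_rhs => rw [e2, measure_iUnion d1 fun z => h1 _ (hm z)]
  rw [← ENNReal.tsum_mul_right]
  refine tsum_congr fun z => ?_
  rw [(Indep_iff _ _ _).1 hi _ _ (hm z) (hD z), hd]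

/-! ### Measurability of the upper edge -/

section
variable {Ω : Type*} [MeasurableSpace Ω] {O : Ω → Set (ℤ × ℤ)} {E : Ω → Set ℤ}

theorem measurable_mem_ent {a : ℤ} {n : ℕ} (hE : ∀ y, Measurable fun ω => y ∈ E ω)
    (hO : ∀ x : ℤ × ℤ, a ≤ x.1 → x.1 < a + n → Measurable fun ω => x ∈ O ω) (y : ℤ) :
    Measurable fun ω => y ∈ ent (O ω) a (E ω) n := by
  induction n generalizing y with
  | zero => exact hE y
  | succ n ih =>
    have ih' := ih fun x h1 h2 => hO x h1 (by push_cast; omega)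
    have h : ∀ i : ℤ, Measurable fun ω => (a + n, i) ∈ O ω :=
      fun i => hO _ (by simp) (by push_cast; simp)
    simp only [ent, colStep, mem_ofPred_eq]
    refine Measurable.exists fun e => (ih' e).and (Measurable.exists fun j => ?_)
    refine measurable_const.and (Measurable.and ?_ measurable_const)
    exact Measurable.forall fun i => measurable_const.imp (measurable_const.imp (h i))

/-- The default value 0 covers empty and unbounded sets. In this form the level sets of `sSup` are
countable combinations of membership events, which gives measurability without assuming `Good`. -/
theorem Int.sSup_eq_iff (E : Set ℤ) (y : ℤ) : sSup E = y ↔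
    (y ∈ E ∧ ∀ z ∈ E, z ≤ y) ∨ (¬ (∃ w, w ∈ E ∧ ∀ z ∈ E, z ≤ w)) ∧ y = 0 := by
  by_cases h : ∃ w, IsGreatest E w
  · obtain ⟨w, hw⟩ := h
    have h' : ∃ w, w ∈ E ∧ ∀ z ∈ E, z ≤ w := ⟨w, hw⟩
    rw [hw.csSup_eq]
    simp only [h', not_true_eq_false, false_and, or_false]
    exact ⟨fun h => h ▸ hw, fun h => hw.unique h⟩
  · have h' : ¬ ∃ w, w ∈ E ∧ ∀ z ∈ E, z ≤ w := h
    have h0 : sSup E = 0 := by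
      rcases E.eq_empty_or_nonempty with rfl | hne
      · exact Int.csSup_empty
      · refine Int.csSup_of_not_bddAbove fun hb =>
          h ⟨_, Int.csSup_mem hne hb, fun z hz => le_csSup hb hz⟩
    rw [h0]
    simp only [h', not_false_eq_true, true_and]
    constructor
    · rintro rfl; exact .inr rfl
    · rintro (h1 | h1)
      · exact absurd ⟨y, h1⟩ h'
      · exact h1.symm

theorem measurable_sSup_int (hE : ∀ y, Measurable fun ω => y ∈ E ω) :
    Measurable fun ω => sSup (E ω) := by
  refine measurable_to_countable' fun y => ?_
  have e : (fun ω => sSup (E ω)) ⁻¹' {y} = {ω | (y ∈ E ω ∧ ∀ z ∈ E ω, z ≤ y) ∨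
      (¬ (∃ w, w ∈ E ω ∧ ∀ z ∈ E ω, z ≤ w)) ∧ y = 0} := by
    ext ω; exact Int.sSup_eq_iff _ _
  rw [e, measurableSet_setOfPred]
  have h1 : ∀ w : ℤ, Measurable fun ω => ∀ z ∈ E ω, z ≤ w :=
    fun w => Measurable.forall fun z => (hE z).imp measurable_const
  exact ((hE y).and (h1 y)).or ((Measurable.exists fun w => (hE w).and (h1 w)).not.and
    measurable_const)

theorem measurable_top {a b : ℤ} {n : ℕ}
    (hO : ∀ x : ℤ × ℤ, a ≤ x.1 → x.1 < a + n → Measurable fun ω => x ∈ O ω) :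
    Measurable fun ω => top (O ω) a b n :=
  measurable_sSup_int (measurable_mem_ent (fun _ => measurable_const) hO)

end

/-- The sites of the columns `a, …, c - 1`. -/
def cols (a c : ℤ) : Set (ℤ × ℤ) := {x | a ≤ x.1 ∧ x.1 < c}

theorem measurable_top_cols (p : ℝ) {a b : ℤ} {n : ℕ} {S : Set (ℤ × ℤ)}
    (hS : cols a (a + n) ⊆ S) : Measurable[sites S] fun U => top (opn p U) a b n :=
  @measurable_top _ (sites S) _ _ _ _ fun _ h1 h2 => measurable_mem_opn (hS ⟨h1, h2⟩) p

theorem measurable_top_opn (p : ℝ) (a b : ℤ) (n : ℕ) :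
    Measurable fun U => top (opn p U) a b n :=
  measurable_top fun _ _ _ => measurable_mem_opn' _ p


/-! ### Almost sure goodness of the environment -/

/-- Independence over disjoint sets of sites. It serves for runs in a column, runs in a row, and
stacks of rows. -/
theorem law_forall_lt {S : ℕ → Set (ℤ × ℤ)} (hS : Pairwise (Function.onFun Disjoint S))
    {D : ℕ → Set Sample} (hD : ∀ i, MeasurableSet[sites (S i)] (D i)) {d : ENNReal}
    (hd : ∀ i, law (D i) = d) (k : ℕ) : law {U | ∀ i < k, U ∈ D i} = d ^ k := by
  have hm : ∀ k, MeasurableSet[sites (⋃ i < k, S i)] {U | ∀ i < k, U ∈ D i} := by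
    intro k
    have : {U | ∀ i < k, U ∈ D i} = ⋂ i, ⋂ (_ : i < k), D i := by ext U; simp
    rw [this]
    refine @MeasurableSet.iInter _ _ (_) _ _ fun i => @MeasurableSet.iInter _ _ (_) _ _ fun hi => ?_
    exact sites_mono (subset_iUnion₂ (s := fun i (_ : i < k) => S i) i hi) _ (hD i)
  induction k with
  | zero => simp
  | succ k ih =>
    have e : {U | ∀ i < k + 1, U ∈ D i} = {U | ∀ i < k, U ∈ D i} ∩ D k := by
      ext U
      simp only [mem_ofPred_eq, mem_inter_iff]
      constructor
      · exact fun h => ⟨fun i hi => h i (by omega), h k (by omega)⟩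
      · rintro ⟨h1, h2⟩ i hi
        rcases Nat.lt_succ_iff_lt_or_eq.1 hi with h | rfl
        · exact h1 i h
        · exact h2
    have hdis : Disjoint (⋃ i < k, S i) (S k) := by
      simp only [disjoint_iUnion_left]
      exact fun i hi => hS hi.ne
    rw [e, (Indep_iff _ _ _).1 (indep_sites hdis) _ _ (hm k) (hD k), ih, hd, pow_succ]

theorem law_column_open (p : ℝ) (h0 : 0 ≤ p) (h1 : p ≤ 1) (a b : ℤ) (k : ℕ) :
    law {U | ∀ i < k, (a, b + (i : ℤ)) ∈ opn p U} = ENNReal.ofReal p ^ k := by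
  refine law_forall_lt (S := fun i => {(a, b + (i : ℤ))}) ?_
    (D := fun i => {U | (a, b + (i : ℤ)) ∈ opn p U}) ?_ ?_ k
  · intro i j hij
    simpa [Function.onFun] using hij
  · exact fun i => measurableSet_sites (measurable_mem_opn (mem_singleton _) p)
  · exact fun i => law_lt _ h0 h1

theorem law_row_open (p : ℝ) (h0 : 0 ≤ p) (h1 : p ≤ 1) (a b : ℤ) (n : ℕ) :
    law {U | ∀ i < n, (a + (i : ℤ), b) ∈ opn p U} = ENNReal.ofReal p ^ n := by
  refine law_forall_lt (S := fun i => {(a + (i : ℤ), b)}) ?_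
    (D := fun i => {U | (a + (i : ℤ), b) ∈ opn p U}) ?_ ?_ n
  · intro i j hij
    simpa [Function.onFun] using hij
  · exact fun i => measurableSet_sites (measurable_mem_opn (mem_singleton _) p)
  · exact fun i => law_lt _ h0 h1

theorem law_rows_blocked (p : ℝ) (h0 : 0 ≤ p) (h1 : p ≤ 1) (a b : ℤ) (n k : ℕ) :
    law {U | ∀ j < k, ¬ ∀ i < n, (a + (i : ℤ), b - (j : ℤ)) ∈ opn p U} =
      (1 - ENNReal.ofReal p ^ n) ^ k := by
  have hm : ∀ j : ℕ, MeasurableSet[sites {x | x.2 = b - (j : ℤ)}]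
      {U | ∀ i < n, (a + (i : ℤ), b - (j : ℤ)) ∈ opn p U} := by
    intro j
    refine measurableSet_sites (@Measurable.forall _ _ (sites _) _ _ fun i => ?_)
    refine @Measurable.forall _ _ (sites _) _ _ fun _ => measurable_mem_opn ?_ p
    rfl
  refine law_forall_lt (S := fun j => {x | x.2 = b - (j : ℤ)}) ?_
    (D := fun j => {U | ∀ i < n, (a + (i : ℤ), b - (j : ℤ)) ∈ opn p U}ᶜ) ?_ ?_ k
  · intro i j hij
    refine Set.disjoint_left.2 fun x (h : _ = _) (h' : _ = _) => hij ?_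
    omega
  · exact fun j => (hm j).compl
  · intro j
    rw [prob_compl_eq_one_sub (sites_le _ _ (hm j)), law_row_open p h0 h1]

theorem eq_zero_of_le_pow {x r : ENNReal} (hr : r < 1) (h : ∀ k : ℕ, x ≤ r ^ k) : x = 0 :=
  le_antisymm (ge_of_tendsto' (ENNReal.tendsto_pow_atTop_nhds_zero_of_lt_one hr) h) zero_le

theorem one_sub_pow_lt_one {p : ℝ} (h0 : 0 < p) (n : ℕ) : 1 - ENNReal.ofReal p ^ n < 1 :=
  ENNReal.sub_lt_self ENNReal.one_ne_top one_ne_zero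
    (pow_ne_zero _ (ENNReal.ofReal_pos.2 h0).ne')

/-- A column open from some height on, or a strip in which all low rows are blocked, has probability
at most the `k`-th power of a number below 1, for every `k`. -/
theorem ae_good {p : ℝ} (h0 : 0 < p) (h1 : p < 1) : ∀ᵐ U ∂law, Good (opn p U) := by
  have hc : ∀ᵐ U ∂law, ∀ a b : ℤ, ∃ i, b ≤ i ∧ (a, i) ∉ opn p U := by
    refine ae_all_iff.2 fun a => ae_all_iff.2 fun b => ?_
    refine eq_zero_of_le_pow (r := ENNReal.ofReal p) (by simpa) fun k => ?_
    rw [← law_column_open p h0.le h1.le a b]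
    refine measure_mono fun U hU i _ => ?_
    by_contra hi
    exact hU ⟨b + i, by omega, hi⟩
  have hr : ∀ᵐ U ∂law, ∀ (a b : ℤ) (n : ℕ), ∃ i ≤ b, ∀ k : ℕ, k < n → (a + k, i) ∈ opn p U := by
    refine ae_all_iff.2 fun a => ae_all_iff.2 fun b => ae_all_iff.2 fun n => ?_
    refine eq_zero_of_le_pow (one_sub_pow_lt_one h0 n) fun k => ?_
    rw [← law_rows_blocked p h0.le h1.le a b]
    refine measure_mono fun U hU j _ hj => hU ⟨b - j, by omega, hj⟩
  filter_upwards [hc, hr] with U h2 h3 using ⟨h2, h3⟩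

/-! ### Integrability of the upper edge -/

theorem lintegral_nat_le {Ω : Type*} [MeasurableSpace Ω] {μ : Measure Ω} {N : Ω → ℕ}
    (hN : Measurable N) {c r : ENNReal} (h : ∀ j : ℕ, μ {ω | j < N ω} ≤ c * r ^ j) :
    ∫⁻ ω, (N ω : ENNReal) ∂μ ≤ c * (1 - r)⁻¹ := by
  have e : ∀ ω, (N ω : ENNReal) = ∑' j : ℕ, {ω | j < N ω}.indicator 1 ω := by
    intro ω
    rw [tsum_eq_sum (s := Finset.range (N ω))]
    · rw [Finset.sum_congr rfl (g := fun _ => 1)]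
      · simp
      · intro j hj
        simpa [Set.indicator] using hj
    · intro j hj
      simpa [Set.indicator] using hj
  have hm : ∀ j : ℕ, MeasurableSet {ω | j < N ω} := fun j => measurableSet_lt measurable_const hN
  simp_rw [e]
  rw [lintegral_tsum fun j => (measurable_one.indicator (hm j)).aemeasurable]
  simp_rw [lintegral_indicator_one (hm _)]
  calc _ ≤ ∑' j : ℕ, c * r ^ j := ENNReal.tsum_le_tsum h
    _ = _ := by rw [ENNReal.tsum_mul_left, ENNReal.tsum_geometric]

/-- An edge above `j` requires a run that starts at or below 0 and covers the heights `0, …, j`,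
which has probability at most `p ^ (j + 1)`. The explicit value is needed to show that `pc` is
positive. -/
theorem lintegral_top_one_le {p : ℝ} (h0 : 0 < p) (h1 : p < 1) :
    ∫⁻ U, ((top (opn p U) 0 0 1).toNat : ENNReal) ∂law ≤
      ENNReal.ofReal p * (1 - ENNReal.ofReal p)⁻¹ := by
  refine lintegral_nat_le (measurable_int_comp (measurable_top_opn p 0 0 1) Int.toNat) fun j => ?_
  rw [mul_comm, ← pow_succ, ← law_column_open p h0.le h1.le 0 0]
  refine measure_mono_ae ?_
  filter_upwards [ae_good h0 h1] with U hU hj i hi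
  obtain ⟨e, he, k, hk, hr, hy⟩ := hU.top_mem (a := 0) (b := 0) (n := 1)
  have he : e ≤ 0 := he
  have hj : j < (top (opn p U) 0 0 1).toNat := hj
  simpa using hr i (by omega) (by omega)

/-- A completely open row at height `-i` keeps the edge at or above `-i`, so the negative part has
geometric tails. -/
theorem lintegral_neg_top_lt_top {p : ℝ} (h0 : 0 < p) (h1 : p < 1) (n : ℕ) :
    ∫⁻ U, ((-top (opn p U) 0 0 n).toNat : ENNReal) ∂law < ⊤ := by
  refine (lintegral_nat_le (c := 1) (r := 1 - ENNReal.ofReal p ^ n)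
    (measurable_int_comp (measurable_top_opn p 0 0 n) fun z => (-z).toNat) fun j => ?_).trans_lt ?_
  · rw [one_mul, ← law_rows_blocked p h0.le h1.le 0 0]
    refine measure_mono_ae ?_
    filter_upwards [ae_good h0 h1] with U hU hj i hi hrow
    have hj : j < (-top (opn p U) 0 0 n).toNat := hj
    have := hU.le_top (mem_ent_of_row (E := Iic 0) (a := 0) (n := n) (i := 0 - i)
      (by simp) (fun k hk => hrow k hk))
    omega
  · rw [one_mul, ENNReal.inv_lt_top, tsub_pos_iff_lt]
    exact one_sub_pow_lt_one h0 n

/-- The expected height of the upper edge in column `n`. -/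
noncomputable def meanTop (p : ℝ) (n : ℕ) : ℝ := ∫ U, (top (opn p U) 0 0 n : ℝ) ∂law

theorem integrable_int_of_lintegral {Ω : Type*} [MeasurableSpace Ω] {μ : Measure Ω} {f : Ω → ℤ}
    (hf : Measurable f) (h1 : ∫⁻ ω, ((f ω).toNat : ENNReal) ∂μ < ⊤)
    (h2 : ∫⁻ ω, ((-f ω).toNat : ENNReal) ∂μ < ⊤) : Integrable (fun ω => (f ω : ℝ)) μ := by
  refine ⟨(measurable_int_comp hf fun z => (z : ℝ)).aestronglyMeasurable, ?_⟩
  have : ∀ ω, ‖(f ω : ℝ)‖ₑ = ((f ω).toNat : ENNReal) + ((-f ω).toNat : ENNReal) := by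
    intro ω
    have : |f ω| = (((f ω).toNat + (-f ω).toNat : ℕ) : ℤ) := by
      rcases abs_cases (f ω) with h | h <;> omega
    rw [← ofReal_norm, Real.norm_eq_abs, ← Int.cast_abs, this]
    push_cast
    rw [ENNReal.ofReal_add (by positivity) (by positivity)]
    simp
  simp only [HasFiniteIntegral, this]
  rw [lintegral_add_left]
  · exact ENNReal.add_lt_top.2 ⟨h1, h2⟩
  · exact measurable_int_comp hf fun z => (z.toNat : ENNReal)

theorem integrable_top_one {p : ℝ} (h0 : 0 < p) (h1 : p < 1) :
    Integrable (fun U => (top (opn p U) 0 0 1 : ℝ)) law := by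
  refine integrable_int_of_lintegral (measurable_top_opn p 0 0 1) ?_
    (lintegral_neg_top_lt_top h0 h1 1)
  refine (lintegral_top_one_le h0 h1).trans_lt (ENNReal.mul_lt_top ENNReal.ofReal_lt_top ?_)
  rw [ENNReal.inv_lt_top, tsub_pos_iff_lt]
  simpa

theorem meanTop_one_le {p : ℝ} (h0 : 0 < p) (h1 : p < 1) : meanTop p 1 ≤ p / (1 - p) := by
  have hm := measurable_top_opn p 0 0 1
  have h2 : meanTop p 1 ≤ ∫ U, ((top (opn p U) 0 0 1).toNat : ℝ) ∂law := by
    refine integral_mono (integrable_top_one h0 h1) ?_ fun U => ?_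
    · refine ⟨(measurable_int_comp hm fun z => (z.toNat : ℝ)).aestronglyMeasurable, ?_⟩
      refine lt_of_le_of_lt ?_ (integrable_top_one h0 h1).2
      refine lintegral_mono fun U => ?_
      rw [← ofReal_norm, ← ofReal_norm]
      refine ENNReal.ofReal_le_ofReal ?_
      rw [Real.norm_eq_abs, Real.norm_eq_abs, Nat.abs_cast, ← Int.cast_abs, ← Int.cast_natCast]
      refine Int.cast_le.2 ?_
      rcases abs_cases (top (opn p U) 0 0 1) with h | h <;> omega
    · show ((top (opn p U) 0 0 1 : ℤ) : ℝ) ≤ _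
      rw [← Int.cast_natCast]
      exact Int.cast_le.2 (Int.self_le_toNat _)
  refine h2.trans ?_
  rw [integral_eq_lintegral_of_nonneg_ae (ae_of_all _ fun _ => Nat.cast_nonneg _)
    (measurable_int_comp hm fun z => (z.toNat : ℝ)).aestronglyMeasurable]
  refine ENNReal.toReal_le_of_le_ofReal (by have := sub_pos.2 h1; positivity) ?_
  simp only [ENNReal.ofReal_natCast]
  refine (lintegral_top_one_le h0 h1).trans_eq ?_
  rw [div_eq_mul_inv, ENNReal.ofReal_mul h0.le, ENNReal.ofReal_inv_of_pos (sub_pos.2 h1),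
    ENNReal.ofReal_sub _ h0.le, ENNReal.ofReal_one]


/-! ### Restarting the half-line: the law of large numbers -/

theorem cols_disjoint (a b c : ℤ) : Disjoint (cols a b) (cols b c) :=
  Set.disjoint_left.2 fun _ h h' => absurd h.2 (not_lt.2 h'.1)

/-- For a quantity whose starting height is itself random; the countably many possible heights are
treated separately. -/
theorem measurable_int_index {Ω β : Type*} [MeasurableSpace Ω] [MeasurableSpace β] {Z : Ω → ℤ}
    (hZ : Measurable Z) {f : ℤ → Ω → β} (hf : ∀ z, Measurable (f z)) :
    Measurable fun ω => f (Z ω) ω := by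
  intro s hs
  have : (fun ω => f (Z ω) ω) ⁻¹' s = ⋃ z, Z ⁻¹' {z} ∩ f z ⁻¹' s := by ext ω; simp
  rw [this]
  exact MeasurableSet.iUnion fun z => (hZ (measurableSet_singleton z)).inter (hf z hs)

theorem law_top_sub {p : ℝ} (h0 : 0 < p) (h1 : p < 1) (a z : ℤ) (n : ℕ) (T : Set ℝ) :
    law {U | ((top (opn p U) a z n - z : ℤ) : ℝ) ∈ T} =
      law {U | (top (opn p U) 0 0 n : ℝ) ∈ T} := by
  rw [← law_reindex (Equiv.addRight ((a, z) : ℤ × ℤ)) {U | (top (opn p U) 0 0 n : ℝ) ∈ T}]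
  refine measure_congr ?_
  filter_upwards [ae_good h0 h1] with U hU
  have := hU.top_translate (a := 0) (b := 0) (n := n) (a, z)
  simp only [zero_add] at this
  refine propext ?_
  show _ ↔ ((top (opn p (reindex (Equiv.addRight ((a, z) : ℤ × ℤ)) U)) 0 0 n : ℤ) : ℝ) ∈ T
  rw [opn_reindex]
  have e : (Equiv.addRight ((a, z) : ℤ × ℤ)) ⁻¹' opn p U = (fun w => w + (a, z)) ⁻¹' opn p U := rfl
  rw [e, this]
  rfl

/-- The upper edge, restarted from a full half-line every `m` columns. -/
noncomputable def blockTop (O : Set (ℤ × ℤ)) (m : ℕ) (a b : ℤ) : ℕ → ℤ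
  | 0 => b
  | j + 1 => top O (a + m * j) (blockTop O m a b j) m

theorem Good.top_le_blockTop {O : Set (ℤ × ℤ)} (hO : Good O) (m : ℕ) (a b : ℤ) (j : ℕ) :
    top O a b (m * j) ≤ blockTop O m a b j := by
  induction j with
  | zero => simp [blockTop]
  | succ j ih =>
    rw [mul_add, mul_one]
    refine hO.top_add_le.trans ?_
    simp only [blockTop]
    push_cast
    exact hO.top_mono hO subset_rfl ih

theorem measurable_blockTop (p : ℝ) (m : ℕ) (a b : ℤ) (j : ℕ) :
    Measurable[sites (cols a (a + m * j))] fun U => blockTop (opn p U) m a b j := by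
  induction j with
  | zero => exact measurable_const
  | succ j ih =>
    refine @measurable_int_index _ _ (sites (cols a (a + m * (j + 1 : ℕ)))) _ _ ?_
      (fun z U => top (opn p U) (a + m * j) z m) fun z => ?_
    · refine ih.mono (sites_mono fun x hx => ⟨hx.1, hx.2.trans_le ?_⟩) le_rfl
      push_cast; nlinarith
    · refine measurable_top_cols p fun x hx => ⟨le_trans ?_ hx.1, hx.2.trans_le ?_⟩
      · have : (0 : ℤ) ≤ m * j := by positivity
        omega
      · push_cast; nlinarith

theorem measurable_int_sub_cast {Ω : Type*} [MeasurableSpace Ω] {f g : Ω → ℤ} (hf : Measurable f)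
    (hg : Measurable g) : Measurable fun ω => ((f ω - g ω : ℤ) : ℝ) :=
  measurable_int_comp (hf.sub hg) fun z => (z : ℝ)

/-- The increments of the restarted upper edge. -/
noncomputable def blockIncr (p : ℝ) (m : ℕ) (a b : ℤ) (j : ℕ) (U : Sample) : ℝ :=
  ((blockTop (opn p U) m a b (j + 1) - blockTop (opn p U) m a b j : ℤ) : ℝ)

theorem measurable_blockIncr (p : ℝ) (m : ℕ) (a b : ℤ) {j k : ℕ} (hjk : j < k) :
    Measurable[sites (cols a (a + m * k))] (blockIncr p m a b j) := by
  have h : ∀ i : ℕ, i ≤ k →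
      Measurable[sites (cols a (a + m * k))] fun U => blockTop (opn p U) m a b i := by
    intro i hi
    refine (measurable_blockTop p m a b i).mono
      (sites_mono fun x hx => ⟨hx.1, hx.2.trans_le ?_⟩) le_rfl
    gcongr
  exact @measurable_int_sub_cast _ (sites (cols a (a + m * k))) _ _ (h _ hjk) (h _ hjk.le)

/-- The restarted edge is determined by the columns already passed. The next increment uses the next
`m` columns only, and by translation its law does not depend on the height at which it starts. -/
theorem law_inter_blockIncr {p : ℝ} (h0 : 0 < p) (h1 : p < 1) (m : ℕ) (a b : ℤ) (j : ℕ)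
    {B : Set Sample} (hB : MeasurableSet[sites (cols a (a + m * j))] B) {T : Set ℝ}
    (hT : MeasurableSet T) :
    law (B ∩ blockIncr p m a b j ⁻¹' T) = law B * law {U | (top (opn p U) 0 0 m : ℝ) ∈ T} := by
  refine measure_restart (indep_sites (cols_disjoint a (a + m * j) (a + m * j + m)))
    (sites_le _) (sites_le _) (measurable_blockTop p m a b j) hB
    (D := fun z => {U | ((top (opn p U) (a + m * j) z m - z : ℤ) : ℝ) ∈ T}) (fun z => ?_)
    fun z => law_top_sub h0 h1 _ z m T
  exact @measurable_int_comp _ _ (sites _) _ _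
    (measurable_top_cols p (b := z) (subset_refl (cols (a + m * j) (a + m * j + m))))
    (fun y => ((y - z : ℤ) : ℝ)) _ hT

theorem law_blockIncr {p : ℝ} (h0 : 0 < p) (h1 : p < 1) (m : ℕ) (a b : ℤ) (j : ℕ) {T : Set ℝ}
    (hT : MeasurableSet T) :
    law (blockIncr p m a b j ⁻¹' T) = law {U | (top (opn p U) 0 0 m : ℝ) ∈ T} := by
  simpa using law_inter_blockIncr h0 h1 m a b j (B := univ)
    (@MeasurableSet.univ _ (sites _)) hT

theorem identDistrib_blockIncr {p : ℝ} (h0 : 0 < p) (h1 : p < 1) (m : ℕ) (a b : ℤ) (j : ℕ) :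
    IdentDistrib (blockIncr p m a b j) (fun U => (top (opn p U) 0 0 m : ℝ)) law law := by
  have hm1 : Measurable (blockIncr p m a b j) :=
    (measurable_blockIncr p m a b j.lt_succ_self).mono (sites_le _) le_rfl
  have hm2 : Measurable (fun U => (top (opn p U) 0 0 m : ℝ)) :=
    measurable_int_comp (measurable_top_opn p 0 0 m) fun z => (z : ℝ)
  refine ⟨hm1.aemeasurable, hm2.aemeasurable, Measure.ext fun T hT => ?_⟩
  rw [Measure.map_apply hm1 hT, Measure.map_apply hm2 hT, law_blockIncr h0 h1 m a b j hT]
  rfl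

theorem indepFun_blockIncr {p : ℝ} (h0 : 0 < p) (h1 : p < 1) (m : ℕ) (a b : ℤ) {i j : ℕ}
    (hij : i < j) : IndepFun (blockIncr p m a b i) (blockIncr p m a b j) law := by
  rw [indepFun_iff_measure_inter_preimage_eq_mul]
  intro S T hS hT
  rw [law_inter_blockIncr h0 h1 m a b j (measurable_blockIncr p m a b hij hS) hT,
    law_blockIncr h0 h1 m a b j hT]

theorem sum_blockIncr (p : ℝ) (m : ℕ) (a b : ℤ) (j : ℕ) (U : Sample) :
    ∑ i ∈ Finset.range j, blockIncr p m a b i U = (blockTop (opn p U) m a b j : ℝ) - b := by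
  simp only [blockIncr, Int.cast_sub]
  rw [Finset.sum_range_sub (fun i => (blockTop (opn p U) m a b i : ℝ))]
  rfl

/-- The edge restarted in every column dominates the true edge and is a sum of integrable
increments; this controls the positive part. -/
theorem integrable_top {p : ℝ} (h0 : 0 < p) (h1 : p < 1) (n : ℕ) :
    Integrable (fun U => (top (opn p U) 0 0 n : ℝ)) law := by
  have hm := measurable_top_opn p 0 0 n
  refine integrable_int_of_lintegral hm ?_ (lintegral_neg_top_lt_top h0 h1 n)
  have hB : Integrable (fun U => ∑ i ∈ Finset.range n, blockIncr p 1 0 0 i U) law :=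
    integrable_finsetSum _ fun i _ =>
      (identDistrib_blockIncr h0 h1 1 0 0 i).integrable_iff.2 (integrable_top_one h0 h1)
  refine lt_of_le_of_lt (lintegral_mono_ae ?_) hB.2
  filter_upwards [ae_good h0 h1] with U hU
  have h2 := hU.top_le_blockTop 1 0 0 n
  rw [one_mul] at h2
  rw [sum_blockIncr, ← ofReal_norm, Real.norm_eq_abs, ← ENNReal.ofReal_natCast]
  refine ENNReal.ofReal_le_ofReal ?_
  rw [Int.cast_zero, sub_zero, ← Int.cast_abs, ← Int.cast_natCast]
  refine Int.cast_le.2 ?_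
  have := le_abs_self (blockTop (opn p U) 1 0 0 n)
  have := abs_nonneg (blockTop (opn p U) 1 0 0 n)
  omega

theorem integrable_blockIncr {p : ℝ} (h0 : 0 < p) (h1 : p < 1) (m : ℕ) (a b : ℤ) (j : ℕ) :
    Integrable (blockIncr p m a b j) law :=
  (identDistrib_blockIncr h0 h1 m a b j).integrable_iff.2 (integrable_top h0 h1 m)

theorem integral_blockIncr {p : ℝ} (h0 : 0 < p) (h1 : p < 1) (m : ℕ) (a b : ℤ) (j : ℕ) :
    ∫ U, blockIncr p m a b j U ∂law = meanTop p m :=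
  (identDistrib_blockIncr h0 h1 m a b j).integral_eq

theorem blockTop_strong_law {p : ℝ} (h0 : 0 < p) (h1 : p < 1) (m : ℕ) (a b : ℤ) :
    ∀ᵐ U ∂law, Tendsto (fun j : ℕ => ((blockTop (opn p U) m a b j : ℝ) - b) / j) atTop
      (𝓝 (meanTop p m)) := by
  -- Pairwise independence of the increments suffices for this form of the strong law.
  have h := strong_law_ae_real (blockIncr p m a b) (integrable_blockIncr h0 h1 m a b 0) ?_
    fun i => (identDistrib_blockIncr h0 h1 m a b i).trans (identDistrib_blockIncr h0 h1 m a b 0).symm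
  · filter_upwards [h] with U hU
    simpa only [sum_blockIncr, integral_blockIncr h0 h1] using hU
  · intro i j hij
    rcases lt_or_gt_of_ne hij with h | h
    · exact indepFun_blockIncr h0 h1 m a b h
    · exact (indepFun_blockIncr h0 h1 m a b h).symm

theorem exists_bound_of_eventually_le {f : ℕ → ℝ} (h : ∀ᶠ j in atTop, f j ≤ 0) :
    ∃ K : ℝ, ∀ j, f j ≤ K := by
  obtain ⟨N, hN⟩ := eventually_atTop.1 h
  refine ⟨∑ i ∈ Finset.range N, |f i|, fun j => ?_⟩
  have h0 : 0 ≤ ∑ i ∈ Finset.range N, |f i| := Finset.sum_nonneg fun _ _ => abs_nonneg _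
  rcases lt_or_ge j N with hj | hj
  · exact (le_abs_self _).trans (Finset.single_le_sum (f := fun i => |f i|)
      (fun _ _ => abs_nonneg _) (Finset.mem_range.2 hj))
  · exact (hN j hj).trans h0

/-- If the mean edge height in column `m` is less than `r * m`, the upper edge grows at most with
slope `r`. -/
theorem ae_top_le {p : ℝ} (h0 : 0 < p) (h1 : p < 1) {m : ℕ} (hm : 0 < m) {r : ℝ} (hr0 : 0 ≤ r)
    (hr : meanTop p m < r * m) :
    ∀ᵐ U ∂law, ∃ K : ℕ, ∀ n : ℕ, (top (opn p U) 0 0 n : ℝ) ≤ r * n + K := by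
  -- The block sequence below starts at a random height, so the strong law is taken for all starting
  -- points at once.
  have hall := ae_all_iff.2 fun a : ℤ => ae_all_iff.2 fun b : ℤ => blockTop_strong_law h0 h1 m a b
  filter_upwards [ae_good h0 h1, hall] with U hU hS
  -- One residue class modulo `m` at a time: the blocks start at the edge in column `i`. The bounds
  -- for the finitely many `i < m` are combined afterwards.
  have key : ∀ i : ℕ, ∃ K : ℝ, ∀ j : ℕ, (top (opn p U) 0 0 (i + m * j) : ℝ) ≤ r * m * j + K := by
    intro i
    set b := top (opn p U) 0 0 i with hb
    have h2 : ∀ᶠ j : ℕ in atTop, (blockTop (opn p U) m i b j : ℝ) - b - r * m * j ≤ 0 := by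
      filter_upwards [(hS i b).eventually (gt_mem_nhds hr), eventually_gt_atTop 0] with j hj hj0
      rw [div_lt_iff₀ (by exact_mod_cast hj0)] at hj
      linarith
    obtain ⟨K, hK⟩ := exists_bound_of_eventually_le h2
    refine ⟨K + b, fun j => ?_⟩
    have h3 : top (opn p U) 0 0 (i + m * j) ≤ blockTop (opn p U) m i b j := by
      have := hU.top_add_le (a := 0) (b := 0) (m := i) (n := m * j)
      rw [zero_add] at this
      exact this.trans (hU.top_le_blockTop m i b j)
    have := hK j
    have : (top (opn p U) 0 0 (i + m * j) : ℝ) ≤ (blockTop (opn p U) m i b j : ℝ) := by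
      exact_mod_cast h3
    linarith
  choose K hK using key
  obtain ⟨B, hB⟩ : ∃ B : ℕ, ∀ i < m, K i ≤ B := by
    refine ⟨⌈∑ i ∈ Finset.range m, |K i|⌉₊, fun i hi => ?_⟩
    refine le_trans ?_ (Nat.le_ceil _)
    exact (le_abs_self _).trans (Finset.single_le_sum (f := fun i => |K i|)
      (fun _ _ => abs_nonneg _) (Finset.mem_range.2 hi))
  refine ⟨B, fun n => ?_⟩
  have h2 := hK (n % m) (n / m)
  have h3 := hB _ (Nat.mod_lt n hm)
  rw [Nat.mod_add_div] at h2
  have h4 : (m : ℝ) * (n / m : ℕ) ≤ n := by exact_mod_cast Nat.mul_div_le n m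
  have := mul_le_mul_of_nonneg_left h4 hr0
  linarith


theorem measurable_indicator_one {Ω : Type*} [MeasurableSpace Ω] {F : Set Ω} (hF : MeasurableSet F) :
    Measurable (F.indicator (1 : Ω → ℝ)) :=
  measurable_one.indicator hF

theorem measurable_real_mul {Ω : Type*} [MeasurableSpace Ω] {f g : Ω → ℝ} (hf : Measurable f)
    (hg : Measurable g) : Measurable fun ω => f ω * g ω :=
  hf.mul hg

/-! ### Strict monotonicity of the mean edge height -/

theorem Good.mono {O O' P : Set (ℤ × ℤ)} (h1 : Good O) (h2 : Good O') (h : O ⊆ P) (h' : P ⊆ O') :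
    Good P where
  closed a b := by
    obtain ⟨i, hi, hc⟩ := h2.closed a b
    exact ⟨i, hi, fun hP => hc (h' hP)⟩
  row a b n := by
    obtain ⟨i, hi, hr⟩ := h1.row a b n
    exact ⟨i, hi, fun k hk => h (hr k hk)⟩

/-- The upper edge at column `k + n` with parameter `p'` in the first `k` columns and `p` in the
others. -/
noncomputable def hybridTop (p p' : ℝ) (k n : ℕ) (U : Sample) : ℤ :=
  sSup (ent (opn p U) k (ent (opn p' U) 0 (Iic 0) k) n)

theorem measurable_hybridTop (p p' : ℝ) (k n : ℕ) : Measurable (hybridTop p p' k n) := by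
  refine measurable_sSup_int (measurable_mem_ent ?_ fun _ _ _ => measurable_mem_opn' _ _)
  exact measurable_mem_ent (fun _ => measurable_const) fun _ _ _ => measurable_mem_opn' _ _

theorem isGreatest_hybridTop {p p' : ℝ} (hp : p ≤ p') {U : Sample} (hU : Good (opn p U))
    (hU' : Good (opn p' U)) (k n : ℕ) :
    IsGreatest (ent (opn p U) k (ent (opn p' U) 0 (Iic 0) k) n) (hybridTop p p' k n U) := by
  have hb := hU.bddAbove_ent (a := k) (hU'.bddAbove_ent (a := 0) (bddAbove_Iic (a := 0)) k) n
  refine ⟨Int.csSup_mem ?_ hb, fun _ h => le_csSup hb h⟩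
  have h := hU.ent_nonempty 0 0 (k + n)
  rw [ent_add, zero_add] at h
  exact h.mono (ent_mono subset_rfl (ent_mono (opn_mono hp U) subset_rfl))

theorem hybridTop_bounds {p p' : ℝ} (hp : p ≤ p') {U : Sample} (hU : Good (opn p U))
    (hU' : Good (opn p' U)) (k n : ℕ) : top (opn p U) 0 0 (k + n) ≤ hybridTop p p' k n U ∧
      hybridTop p p' k n U ≤ top (opn p' U) 0 0 (k + n) := by
  have h := isGreatest_hybridTop hp hU hU' k n
  constructor
  · refine h.2 ?_
    have := hU.top_mem (a := 0) (b := 0) (n := k + n)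
    rw [ent_add, zero_add] at this
    exact ent_mono subset_rfl (ent_mono (opn_mono hp U) subset_rfl) this
  · refine hU'.le_top ?_
    rw [ent_add, zero_add]
    exact ent_mono (opn_mono hp U) subset_rfl h.1

theorem integrable_hybridTop {p p' : ℝ} (h0 : 0 < p) (hp : p ≤ p') (h1 : p' < 1) (k n : ℕ) :
    Integrable (fun U => (hybridTop p p' k n U : ℝ)) law := by
  refine Integrable.mono' ((integrable_top h0 (hp.trans_lt h1) (k + n)).abs.add
    (integrable_top (h0.trans_le hp) h1 (k + n)).abs)
    (measurable_int_comp (measurable_hybridTop p p' k n) fun z => (z : ℝ)).aestronglyMeasurable ?_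
  filter_upwards [ae_good h0 (hp.trans_lt h1), ae_good (h0.trans_le hp) h1] with U hU hU'
  obtain ⟨h2, h3⟩ := hybridTop_bounds hp hU hU' k n
  have h2' : (top (opn p U) 0 0 (k + n) : ℝ) ≤ hybridTop p p' k n U := by exact_mod_cast h2
  have h3' : (hybridTop p p' k n U : ℝ) ≤ top (opn p' U) 0 0 (k + n) := by exact_mod_cast h3
  rw [Real.norm_eq_abs, Pi.add_apply]
  refine abs_le.2 ⟨?_, ?_⟩
  · have := neg_abs_le (top (opn p U) 0 0 (k + n) : ℝ)
    have := abs_nonneg (top (opn p' U) 0 0 (k + n) : ℝ)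
    linarith
  · have := le_abs_self (top (opn p' U) 0 0 (k + n) : ℝ)
    have := abs_nonneg (top (opn p U) 0 0 (k + n) : ℝ)
    linarith

/-- The gain at column `k + 1 + n` from opening the site `(k, z)` at the upper edge. -/
noncomputable def gain (p p' : ℝ) (k n : ℕ) (z : ℤ) (U : Sample) : ℝ :=
  ({U : Sample | p ≤ U (k, z) ∧ (U (k, z) : ℝ) < p'}.indicator 1 U) *
    ((top (opn p U) (k + 1) (z + 1) n - top (opn p U) (k + 1) z n : ℤ) : ℝ)

/-- Suppose the site at the edge is closed at `p` and open at `p'`. Treated with `p`, column `k`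
lets nothing out above `t`; treated with `p'`, it also gives the entry `t + 1`. The difference of
the hybrid edges is therefore at least that of the edges started from `t + 1` and from `t`. -/
theorem gain_le {p p' : ℝ} (hp : p ≤ p') {U : Sample} (hU : Good (opn p U))
    (hU' : Good (opn p' U)) (k n : ℕ) :
    gain p p' k n (top (opn p' U) 0 0 k) U ≤
      ((hybridTop p p' (k + 1) n U - hybridTop p p' k (n + 1) U : ℤ) : ℝ) := by
  set A := ent (opn p' U) 0 (Iic 0) k with hA
  set t := top (opn p' U) 0 0 k with ht
  have g1 := isGreatest_hybridTop hp hU hU' (k + 1) n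
  have g2 := isGreatest_hybridTop hp hU hU' k (n + 1)
  have e1 : ent (opn p U) (k + 1 : ℕ) (ent (opn p' U) 0 (Iic 0) (k + 1)) n =
      ent (opn p U) (k + 1) (colStep (opn p' U) k A) n := by
    simp [ent, hA]
  have e2 : ent (opn p U) k A (n + 1) = ent (opn p U) (k + 1) (colStep (opn p U) k A) n := by
    rw [add_comm n 1, ent_add]
    simp [ent]
  rw [e1] at g1
  rw [e2] at g2
  have hmono : hybridTop p p' k (n + 1) U ≤ hybridTop p p' (k + 1) n U :=
    g1.2 (ent_mono subset_rfl (colStep_mono (fun _ h => opn_mono hp U h) subset_rfl) g2.1)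
  by_cases hF : p ≤ U (k, t) ∧ (U (k, t) : ℝ) < p'
  swap
  · rw [gain, indicator_of_notMem (by exact hF), zero_mul]
    exact_mod_cast sub_nonneg.2 hmono
  rw [gain, indicator_of_mem (by exact hF), Pi.one_apply, one_mul]
  refine Int.cast_le.2 ?_
  have htA : t ∈ A := hU'.top_mem
  have hsub : colStep (opn p U) k A ⊆ Iic t := by
    rintro y ⟨e, he, j, hj, hr, hy⟩
    have he' : e ≤ t := hU'.le_top he
    have : ¬ t ≤ j := fun h => absurd (hr t he' h) (not_lt.2 hF.1)
    rw [mem_Iic]; omega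
  have hle : hybridTop p p' k (n + 1) U ≤ top (opn p U) (k + 1) t n :=
    hU.le_top (ent_mono subset_rfl hsub g2.1)
  -- If the extra starting height improves the edge at all, the best path must start from it, and
  -- that start is available at `p'`.
  rcases lt_or_ge (top (opn p U) (k + 1) t n) (top (opn p U) (k + 1) (t + 1) n) with h | h
  · have hmem := hU.top_mem (a := k + 1) (b := t + 1) (n := n)
    have e3 : Iic (t + 1) = Iic t ∪ {t + 1} := by
      ext i; simp; omega
    have : top (opn p U) (k + 1) (t + 1) n ≤ hybridTop p p' (k + 1) n U := by
      rw [e3, ent_union] at hmem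
      rcases hmem with hmem | hmem
      · exact absurd (hU.le_top hmem) (not_le.2 h)
      · refine g1.2 (ent_mono subset_rfl ?_ hmem)
        rintro _ rfl
        refine ⟨t, htA, t, le_rfl, fun i h1 h2 => ?_, .inr rfl⟩
        obtain rfl : i = t := by omega
        exact hF.2
    omega
  · omega

theorem measurable_gain_sites (p p' : ℝ) (k n : ℕ) (z : ℤ) :
    Measurable[sites (cols k (k + 1 + n))] (gain p p' k n z) := by
  have hk : ((k, z) : ℤ × ℤ) ∈ cols k (k + 1 + n) := ⟨le_rfl, by show (k : ℤ) < _; omega⟩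
  have hF : MeasurableSet[sites (cols k (k + 1 + n))]
      {U : Sample | p ≤ U (k, z) ∧ (U (k, z) : ℝ) < p'} := by
    have h1 := measurableSet_sites (measurable_mem_opn hk p')
    have h2 := (measurableSet_sites (measurable_mem_opn hk p)).compl
    convert h2.inter h1 using 1
    ext U
    simp [opn]
  have ht : ∀ y, Measurable[sites (cols k (k + 1 + n))] fun U => top (opn p U) (k + 1) y n :=
    fun y => measurable_top_cols p fun x hx => ⟨by have := hx.1; omega, hx.2⟩
  exact @measurable_real_mul _ (sites _) _ _
    (@measurable_indicator_one _ (sites _) _ hF)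
    (@measurable_int_sub_cast _ (sites _) _ _ (ht _) (ht _))

theorem law_gain {p : ℝ} (p' : ℝ) (h0 : 0 < p) (h1 : p < 1) (k n : ℕ) (z : ℤ) (T : Set ℝ) :
    law {U | gain p p' k n z U ∈ T} = law {U | gain p p' k n 0 U ∈ T} := by
  rw [← law_reindex (Equiv.addRight ((0, z) : ℤ × ℤ)) {U | gain p p' k n 0 U ∈ T}]
  refine measure_congr ?_
  filter_upwards [ae_good h0 h1] with U hU
  have e1 := hU.top_translate (a := k + 1) (b := 1) (n := n) (0, z)
  have e2 := hU.top_translate (a := k + 1) (b := 0) (n := n) (0, z)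
  have e : opn p (reindex (Equiv.addRight ((0, z) : ℤ × ℤ)) U) =
    (fun w => w + (0, z)) ⁻¹' opn p U := opn_reindex _ _ _
  have e3 : gain p p' k n 0 (reindex (Equiv.addRight ((0, z) : ℤ × ℤ)) U) = gain p p' k n z U := by
    simp only [gain, e, zero_add, e1, e2, add_zero, add_comm 1 z]
    congr 1
    · simp [indicator, reindex_apply]
    · simp
  refine propext ?_
  show _ ↔ gain p p' k n 0 (reindex (Equiv.addRight ((0, z) : ℤ × ℤ)) U) ∈ T
  rw [e3]
  rfl

theorem identDistrib_top_sub {p : ℝ} (h0 : 0 < p) (h1 : p < 1) (a z : ℤ) (n : ℕ) :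
    IdentDistrib (fun U => ((top (opn p U) a z n - z : ℤ) : ℝ))
      (fun U => (top (opn p U) 0 0 n : ℝ)) law law := by
  have hm1 : Measurable (fun U => ((top (opn p U) a z n - z : ℤ) : ℝ)) :=
    measurable_int_comp (measurable_top_opn p a z n) fun y => ((y - z : ℤ) : ℝ)
  have hm2 : Measurable (fun U => (top (opn p U) 0 0 n : ℝ)) :=
    measurable_int_comp (measurable_top_opn p 0 0 n) fun z => (z : ℝ)
  refine ⟨hm1.aemeasurable, hm2.aemeasurable, Measure.ext fun T hT => ?_⟩
  rw [Measure.map_apply hm1 hT, Measure.map_apply hm2 hT]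
  exact law_top_sub h0 h1 a z n T

theorem integrable_top' {p : ℝ} (h0 : 0 < p) (h1 : p < 1) (a z : ℤ) (n : ℕ) :
    Integrable (fun U => (top (opn p U) a z n : ℝ)) law := by
  have h := ((identDistrib_top_sub h0 h1 a z n).integrable_iff.2 (integrable_top h0 h1 n)).add
    (integrable_const (z : ℝ))
  refine h.congr (ae_of_all _ fun U => ?_)
  simp

theorem integral_top' {p : ℝ} (h0 : 0 < p) (h1 : p < 1) (a z : ℤ) (n : ℕ) :
    ∫ U, (top (opn p U) a z n : ℝ) ∂law = meanTop p n + z := by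
  have h := (identDistrib_top_sub h0 h1 a z n).integral_eq
  rw [meanTop, ← h]
  simp only [Int.cast_sub]
  rw [integral_sub (integrable_top' h0 h1 a z n) (integrable_const _)]
  simp

/-- The two factors depend on disjoint columns. The indicator has mean `p' - p`, and raising the
half-line by one raises the mean edge by exactly one. -/
theorem integral_gain {p p' : ℝ} (h0 : 0 < p) (hp : p ≤ p') (h1 : p' < 1) (k n : ℕ) :
    Integrable (gain p p' k n 0) law ∧ ∫ U, gain p p' k n 0 U ∂law = p' - p := by
  have hp1 := hp.trans_lt h1
  set F := {U : Sample | p ≤ U (k, 0) ∧ (U (k, 0) : ℝ) < p'} with hF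
  have hFm : MeasurableSet[sites (cols k (k + 1))] F := by
    have hk : ((k, 0) : ℤ × ℤ) ∈ cols k (k + 1) := ⟨le_rfl, by show (k : ℤ) < _; omega⟩
    have h1 := measurableSet_sites (measurable_mem_opn hk p')
    have h2 := (measurableSet_sites (measurable_mem_opn hk p)).compl
    convert h2.inter h1 using 1
    ext U
    simp [opn, hF]
  have hlF : law F = ENNReal.ofReal (p' - p) := by
    have e : F = {U | (U (k, 0) : ℝ) < p'} \ {U | (U (k, 0) : ℝ) < p} := by
      ext U; simp [hF, and_comm]
    have hs : {U : Sample | (U (k, 0) : ℝ) < p} ⊆ {U | (U (k, 0) : ℝ) < p'} :=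
      fun U h => lt_of_lt_of_le h hp
    rw [e, measure_sdiff hs
      (measurableSet_setOfPred.2 (measurable_mem_opn' (k, 0) p)).nullMeasurableSet
      (measure_ne_top _ _), law_lt _ (h0.le.trans hp) h1.le, law_lt _ h0.le hp1.le,
      ENNReal.ofReal_sub _ h0.le]
  set f : Sample → ℝ := F.indicator 1 with hf
  set g : Sample → ℝ := fun U =>
    ((top (opn p U) (k + 1) (0 + 1) n - top (opn p U) (k + 1) 0 n : ℤ) : ℝ) with hg
  have hfm : Measurable[sites (cols k (k + 1))] f :=
    @measurable_indicator_one _ (sites _) _ hFm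
  have hgm : Measurable[sites (cols (k + 1) (k + 1 + n))] g :=
    @measurable_int_sub_cast _ (sites _) _ _ (measurable_top_cols p subset_rfl)
      (measurable_top_cols p subset_rfl)
  have hind : IndepFun f g law :=
    indep_of_indep_of_le_left (indep_of_indep_of_le_right
      (indep_sites (cols_disjoint k (k + 1) (k + 1 + n))) hgm.comap_le) hfm.comap_le
  have hfm' : Measurable f := hfm.mono (sites_le _) le_rfl
  have hgm' : Measurable g := hgm.mono (sites_le _) le_rfl
  have hfi : Integrable f law := (integrable_const (1 : ℝ)).indicator (sites_le _ _ hFm)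
  have hgi : Integrable g law := by
    simp only [hg, Int.cast_sub]
    exact (integrable_top' h0 hp1 _ _ n).sub (integrable_top' h0 hp1 _ _ n)
  refine ⟨hind.integrable_mul hfi hgi, ?_⟩
  have := hind.integral_mul_eq_mul_integral hfm'.aestronglyMeasurable hgm'.aestronglyMeasurable
  refine this.trans ?_
  have i1 : ∫ U, f U ∂law = p' - p := by
    rw [hf, integral_indicator_one (sites_le _ _ hFm), measureReal_def, hlF,
      ENNReal.toReal_ofReal (sub_nonneg.2 hp)]
  have i2 : ∫ U, g U ∂law = 1 := by
    simp only [hg, Int.cast_sub]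
    rw [integral_sub (integrable_top' h0 hp1 _ _ n) (integrable_top' h0 hp1 _ _ n),
      integral_top' h0 hp1, integral_top' h0 hp1]
    simp
  rw [i1, i2, mul_one]

/-- The edge in column `k` depends on earlier columns only, so evaluating the gain at this random
height does not change its law. -/
theorem integral_gain_top {p p' : ℝ} (h0 : 0 < p) (hp : p ≤ p') (h1 : p' < 1) (k n : ℕ) :
    Integrable (fun U => gain p p' k n (top (opn p' U) 0 0 k) U) law ∧
      ∫ U, gain p p' k n (top (opn p' U) 0 0 k) U ∂law = p' - p := by
  have hp1 := hp.trans_lt h1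
  have hZ : Measurable[sites (cols 0 k)] fun U => top (opn p' U) 0 0 k :=
    measurable_top_cols p' (by simp)
  have hm1 : Measurable (fun U => gain p p' k n (top (opn p' U) 0 0 k) U) :=
    measurable_int_index (hZ.mono (sites_le _) le_rfl) fun z =>
      (measurable_gain_sites p p' k n z).mono (sites_le _) le_rfl
  have hm2 : Measurable (gain p p' k n 0) :=
    (measurable_gain_sites p p' k n 0).mono (sites_le _) le_rfl
  have hid : IdentDistrib (fun U => gain p p' k n (top (opn p' U) 0 0 k) U) (gain p p' k n 0)
      law law := by
    refine ⟨hm1.aemeasurable, hm2.aemeasurable, Measure.ext fun T hT => ?_⟩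
    rw [Measure.map_apply hm1 hT, Measure.map_apply hm2 hT]
    have := measure_restart (indep_sites (cols_disjoint 0 k (k + 1 + n))) (sites_le _) (sites_le _)
      hZ (@MeasurableSet.univ _ (sites _)) (D := fun z => {U | gain p p' k n z U ∈ T})
      (fun z => measurable_gain_sites p p' k n z hT) fun z => law_gain p' h0 hp1 k n z T
    rw [univ_inter, measure_univ, one_mul] at this
    exact this
  have := integral_gain h0 hp h1 k n
  exact ⟨hid.integrable_iff.2 this.1, hid.integral_eq.trans this.2⟩

/-- The parameter is switched from `p` to `p'` one column at a time, and each switch raises the mean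
edge by at least `p' - p`. -/
theorem meanTop_add_le {p p' : ℝ} (h0 : 0 < p) (hp : p ≤ p') (h1 : p' < 1) (n : ℕ) :
    meanTop p n + (p' - p) * n ≤ meanTop p' n := by
  have key : ∀ k n : ℕ, meanTop p (k + n) + (p' - p) * k ≤
      ∫ U, (hybridTop p p' k n U : ℝ) ∂law := by
    intro k
    induction k with
    | zero => intro n; simp [hybridTop, meanTop, top, ent]
    | succ k ih =>
      intro n
      have h2 := ih (n + 1)
      have h3 : ∫ U, gain p p' k n (top (opn p' U) 0 0 k) U ∂law ≤
          ∫ U, ((hybridTop p p' (k + 1) n U - hybridTop p p' k (n + 1) U : ℤ) : ℝ) ∂law := by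
        refine integral_mono_ae (integral_gain_top h0 hp h1 k n).1 ?_ ?_
        · simp only [Int.cast_sub]
          exact (integrable_hybridTop h0 hp h1 _ _).sub (integrable_hybridTop h0 hp h1 _ _)
        · filter_upwards [ae_good h0 (hp.trans_lt h1), ae_good (h0.trans_le hp) h1] with U hU hU'
          exact gain_le hp hU hU' k n
      simp only [Int.cast_sub] at h3
      rw [(integral_gain_top h0 hp h1 k n).2, integral_sub (integrable_hybridTop h0 hp h1 _ _)
        (integrable_hybridTop h0 hp h1 _ _)] at h3
      rw [show k + 1 + n = k + (n + 1) by ring]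
      push_cast
      linarith
  have := key n 0
  simpa [hybridTop, meanTop, top, ent] using this

/-! ### Right-continuity of the mean edge height -/

/-- An open row at height `c` shields the region above it: a path coming from below can be replaced
by one that follows the row. The edge is thereby determined by a finite box. -/
theorem mem_ent_Icc_of_row {O : Set (ℤ × ℤ)} {a b c : ℤ} {n : ℕ} (hcb : c ≤ b)
    (hr : ∀ k : ℕ, k < n → (a + k, c) ∈ O) {y : ℤ} (hy : y ∈ ent O a (Iic b) n) (hc : c ≤ y) :
    y ∈ ent O a (Icc c b) n := by
  induction n generalizing y with
  | zero => exact ⟨hc, hy⟩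
  | succ n ih =>
    obtain ⟨e, he, j, hj, hrun, hy⟩ := hy
    have hcE : c ∈ ent O a (Icc c b) n := mem_ent_of_row ⟨le_rfl, hcb⟩ fun k hk => hr k (by omega)
    by_cases hec : c ≤ e
    · exact ⟨e, ih (fun k hk => hr k (by omega)) he hec, j, hj, hrun, hy⟩
    · by_cases hjc : c ≤ j
      · exact ⟨c, hcE, j, hjc, fun i h1 h2 => hrun i (by omega) h2, hy⟩
      · obtain rfl : y = c := by omega
        refine ⟨y, hcE, y, le_rfl, fun i h1 h2 => ?_, .inl rfl⟩
        obtain rfl : i = y := by omega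
        exact hr n (by omega)

theorem mem_ent_of_box {O O' : Set (ℤ × ℤ)} {a c : ℤ} {E : Set ℤ} (hE : ∀ e ∈ E, c ≤ e) {n : ℕ}
    {y : ℤ} (hy : y ∈ ent O a E n)
    (h : ∀ x ∈ O, a ≤ x.1 → x.1 < a + n → c ≤ x.2 → x.2 ≤ y → x ∈ O') : y ∈ ent O' a E n := by
  suffices c ≤ y ∧ y ∈ ent O' a E n from this.2
  induction n generalizing y with
  | zero => exact ⟨hE y hy, hy⟩
  | succ n ih =>
    obtain ⟨e, he, j, hj, hrun, hy⟩ := hy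
    obtain ⟨h1, h2⟩ := ih he fun x h1 h2 h3 h4 h5 =>
      h x h1 h2 (by push_cast; omega) h4 (by omega)
    refine ⟨by omega, e, h2, j, hj, fun i h3 h4 => ?_, hy⟩
    exact h _ (hrun i h3 h4) (by simp) (by push_cast; simp) (by simp; omega) (by simp; omega)

/-- Almost surely the edge is constant for `p'` slightly above `p`: it depends on a finite box, in
which no further site opens once `p'` is close to `p`. The edges at `p` and at one larger parameter
dominate. -/
theorem tendsto_meanTop_right {p : ℝ} (h0 : 0 < p) (h1 : p < 1) (n : ℕ) :
    Tendsto (fun p' => meanTop p' n) (𝓝[>] p) (𝓝 (meanTop p n)) := by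
  obtain ⟨p1, hp1, hp1'⟩ := exists_between h1
  have hp1p := h0.trans hp1
  have hev : ∀ᶠ p' in 𝓝[>] p, p < p' ∧ p' < p1 := by
    filter_upwards [self_mem_nhdsWithin, mem_nhdsWithin_of_mem_nhds (Iio_mem_nhds hp1)]
      with p' h2 h3 using ⟨h2, h3⟩
  refine tendsto_integral_filter_of_dominated_convergence
    (fun U => |(top (opn p U) 0 0 n : ℝ)| + |(top (opn p1 U) 0 0 n : ℝ)|) ?_ ?_ ?_ ?_
  · exact Eventually.of_forall fun p' => (measurable_int_comp (measurable_top_opn p' 0 0 n)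
      fun z => (z : ℝ)).aestronglyMeasurable
  · filter_upwards [hev] with p' hp'
    filter_upwards [ae_good h0 h1, ae_good hp1p hp1'] with U hU hU1
    have hU' := hU.mono hU1 (opn_mono hp'.1.le U) (opn_mono hp'.2.le U)
    have h2 : (top (opn p U) 0 0 n : ℝ) ≤ top (opn p' U) 0 0 n := by
      exact_mod_cast hU.top_mono hU' (opn_mono hp'.1.le U) le_rfl
    have h3 : (top (opn p' U) 0 0 n : ℝ) ≤ top (opn p1 U) 0 0 n := by
      exact_mod_cast hU'.top_mono hU1 (opn_mono hp'.2.le U) le_rfl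
    rw [Real.norm_eq_abs]
    refine abs_le.2 ⟨?_, ?_⟩
    · have := neg_abs_le (top (opn p U) 0 0 n : ℝ)
      have := abs_nonneg (top (opn p1 U) 0 0 n : ℝ)
      linarith
    · have := le_abs_self (top (opn p1 U) 0 0 n : ℝ)
      have := abs_nonneg (top (opn p U) 0 0 n : ℝ)
      linarith
  · exact (integrable_top h0 h1 n).abs.add (integrable_top hp1p hp1' n).abs
  -- Openness is the strict inequality `U x < p`, so sites with `U x = p` would be open for all `p'
  -- > p` but closed at `p`.
  · have hne : ∀ᵐ U ∂law, ∀ x, (U x : ℝ) ≠ p := by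
      refine ae_all_iff.2 fun x => ?_
      have := law_eq x p
      exact measure_mono_null (fun U hU => not_not.1 hU) this
    filter_upwards [ae_good h0 h1, ae_good hp1p hp1', hne] with U hU hU1 hne
    obtain ⟨c, hc, hr⟩ := hU.row 0 0 n
    have hfin : ((Ico (0 : ℤ) n) ×ˢ (Icc c (top (opn p1 U) 0 0 n))).Finite :=
      (finite_Ico _ _).prod (finite_Icc _ _)
    have hbox : ∀ᶠ p' in 𝓝[>] p, ∀ x ∈ (Ico (0 : ℤ) n) ×ˢ (Icc c (top (opn p1 U) 0 0 n)),
        x ∈ opn p' U → x ∈ opn p U := by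
      refine (eventually_all_finite hfin).2 fun x _ => ?_
      rcases lt_or_ge (U x : ℝ) p with h | h
      · exact Eventually.of_forall fun _ _ => h
      · have : p < U x := lt_of_le_of_ne h (hne x).symm
        filter_upwards [mem_nhdsWithin_of_mem_nhds (Iio_mem_nhds this)] with p' hp' hx
        exact absurd (show (U x : ℝ) < p' from hx) (not_lt.2 (le_of_lt hp'))
    refine tendsto_const_nhds.congr' ?_
    filter_upwards [hev, hbox] with p' hp' hb
    have hU' := hU.mono hU1 (opn_mono hp'.1.le U) (opn_mono hp'.2.le U)
    have h2 := hU.top_mono hU' (opn_mono hp'.1.le U) le_rfl (a := 0) (b := 0) (n := n)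
    have h3 := hU'.top_mono hU1 (opn_mono hp'.2.le U) le_rfl (a := 0) (b := 0) (n := n)
    have hrp' : ∀ k : ℕ, k < n → (0 + (k : ℤ), c) ∈ opn p' U := fun k hk =>
      opn_mono hp'.1.le U (hr k hk)
    have h4 : c ≤ top (opn p' U) 0 0 n := hU'.le_top (mem_ent_of_row (E := Iic 0) hc hrp')
    have h5 := mem_ent_Icc_of_row hc hrp' hU'.top_mem h4
    have h6 := mem_ent_of_box (O' := opn p U) (c := c) (fun e he => he.1) h5
      fun x hx k1 k2 k3 k4 => hb x ⟨⟨k1, by simpa using k2⟩, k3, k4.trans h3⟩ hx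
    have h7 := hU.le_top (ent_mono subset_rfl Icc_subset_Iic_self h6)
    rw [le_antisymm h2 h7]


/-! ### Crossings of tubes -/

/-- The sites of the columns `a, …, a + L` at vertical distance at most `h` from the line of slope
`s` through `(a, b)`. -/
def tube (a b : ℤ) (L h : ℕ) (s : ℝ) : Set (ℤ × ℤ) :=
  {x | a ≤ x.1 ∧ x.1 ≤ a + L ∧ |(x.2 : ℝ) - b - s * (x.1 - a)| ≤ h}

/-- There is an open path through the tube, from its first to its last column. -/
def Crossed (O : Set (ℤ × ℤ)) (a b : ℤ) (L h : ℕ) (s : ℝ) : Prop :=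
  ∃ x y : ℤ × ℤ, x.1 = a ∧ y.1 = a + L ∧ x ∈ tube a b L h s ∧ y ∈ tube a b L h s ∧
    Reach (O ∩ tube a b L h s) x y

theorem mem_tube {a b : ℤ} {L h : ℕ} {s : ℝ} {x : ℤ × ℤ} : x ∈ tube a b L h s ↔
    a ≤ x.1 ∧ x.1 ≤ a + L ∧ (b : ℝ) + s * (x.1 - a) - h ≤ x.2 ∧
      (x.2 : ℝ) ≤ b + s * (x.1 - a) + h := by
  simp only [tube, mem_ofPred_eq, abs_le]
  constructor <;> rintro ⟨h1, h2, h3, h4⟩ <;> refine ⟨h1, h2, ?_, ?_⟩ <;> linarith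

theorem Reach.mem_of_inter {O R : Set (ℤ × ℤ)} {x y : ℤ × ℤ} (h : Reach (O ∩ R) x y) (hy : y ∈ R) :
    x ∈ R := by
  rcases h.eq_or_mem with rfl | h
  · exact hy
  · exact h.2

/-- The region covered by a chain of tubes of average slope `s`. -/
def lane (a b : ℤ) (W : ℕ) (s : ℝ) : Set (ℤ × ℤ) :=
  {x | a ≤ x.1 ∧ |(x.2 : ℝ) - b - s * (x.1 - a)| ≤ W}

/-- Compatibility of the dimensions `L`, `h` of a tube and its slope `s` with the overlap factor
`Q` of successive tubes. -/
structure Admissible (Q L h : ℕ) (s : ℝ) : Prop where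
  one_lt : 1 < s
  cross : (7 + 2 * s) ≤ (s - 1 / s) * Q
  wide : (s + 3) ^ 2 ≤ Q
  pos : 1 ≤ h
  long : 2 * (Q * h) ≤ L

/-- Horizontal distance of successive tubes. -/
def strideX (Q L h : ℕ) : ℤ := L - Q * h

/-- Vertical distance of successive tubes. -/
noncomputable def strideY (Q L h : ℕ) (s : ℝ) : ℤ := ⌊s * (strideX Q L h : ℝ)⌋ - 2 * h - 1

/-- Vertical position of the connecting tube. -/
noncomputable def linkY (Q L h : ℕ) (s : ℝ) : ℤ := ⌈s * ((strideX Q L h : ℝ) + 2 * h)⌉ + h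

/-! ### Linking tubes into chains -/

section
variable {Q L h : ℕ} {s : ℝ}

theorem Admissible.strideX_bounds (hA : Admissible Q L h s) : (Q * h : ℤ) ≤ strideX Q L h ∧ (L : ℤ) ≤ 2 * strideX Q L h ∧
    0 < strideX Q L h ∧ (2 : ℤ) * h ≤ Q * h := by
  have h1 := hA.long
  have h2 : 16 ≤ Q := by
    have := hA.wide
    have := hA.one_lt
    have : (16 : ℝ) ≤ Q := by nlinarith
    exact_mod_cast this
  have h3 := hA.pos
  have h4 : 2 * h ≤ Q * h := by gcongr; omega
  zify at h1 h4
  unfold strideX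
  refine ⟨by linarith, by linarith, ?_, by linarith⟩
  have : (1 : ℤ) ≤ h := by exact_mod_cast h3
  linarith

theorem strideY_bounds (Q L h : ℕ) (s : ℝ) :
    2 * (h : ℝ) + 1 ≤ s * (strideX Q L h : ℝ) - (strideY Q L h s : ℝ) ∧
      s * (strideX Q L h : ℝ) - (strideY Q L h s : ℝ) ≤ 2 * (h : ℝ) + 2 := by
  have h1 := Int.floor_le (s * (strideX Q L h : ℝ))
  have h2 := Int.lt_floor_add_one (s * (strideX Q L h : ℝ))
  unfold strideY
  push_cast
  constructor <;> linarith

theorem linkY_bounds (Q L h : ℕ) (s : ℝ) :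
    s * ((strideX Q L h : ℝ) + 2 * h) + h ≤ linkY Q L h s ∧
      (linkY Q L h s : ℝ) ≤ s * ((strideX Q L h : ℝ) + 2 * h) + h + 1 := by
  have h1 := Int.le_ceil (s * ((strideX Q L h : ℝ) + 2 * h))
  have h2 := Int.ceil_lt_add_one (s * ((strideX Q L h : ℝ) + 2 * h))
  unfold linkY
  push_cast
  constructor <;> linarith

/-- A path through a tube is continued to the next tube by a path through the connecting tube. -/
theorem Admissible.link (hA : Admissible Q L h s) {O : Set (ℤ × ℤ)} {x y : ℤ} {f g : ℤ × ℤ} (hg : g ∈ tube x y L h s)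
    (hfg : Reach (O ∩ tube x y L h s) f g) (hf1 : f.1 ≤ x + strideX Q L h + 2 * h)
    (hg1 : g.1 = x + L)
    (hlow : Crossed (flip O) (y + linkY Q L h s) (x + strideX Q L h + h) L h s)
    (hup : Crossed O (x + strideX Q L h) (y + strideY Q L h s) L h s) :
    ∃ f' g' : ℤ × ℤ, g' ∈ tube (x + strideX Q L h) (y + strideY Q L h s) L h s ∧
      f'.1 = x + L ∧ g'.1 = x + strideX Q L h + L ∧
      Reach (O ∩ tube (x + strideX Q L h) (y + strideY Q L h s) L h s) f' g' ∧
      Reach (O ∩ (tube x y L h s ∪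
        flip (tube (y + linkY Q L h s) (x + strideX Q L h + h) L h s) ∪
        tube (x + strideX Q L h) (y + strideY Q L h s) L h s)) f f' := by
  obtain ⟨hx1, hx2, hx3, hx4⟩ := hA.strideX_bounds
  obtain ⟨hy1, hy2⟩ := strideY_bounds Q L h s
  obtain ⟨hl1, hl2⟩ := linkY_bounds Q L h s
  have hs := hA.one_lt
  have hcr := hA.cross
  have hpos : (1 : ℝ) ≤ h := by exact_mod_cast hA.pos
  have hAr : (strideX Q L h : ℝ) = L - Q * h := by simp [strideX]
  set A := strideX Q L h with hAdef
  set B := strideY Q L h s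
  set b := linkY Q L h s
  set T := tube x y L h s
  set T' := tube (x + A) (y + B) L h s
  set D := flip (tube (y + b) (x + A + h) L h s)
  have hAL : A = L - Q * h := rfl
  have hLr : (L : ℝ) ≤ 2 * A := by exact_mod_cast hx2
  -- Over the overlap of `Q * h` columns, lines of slopes `s` and `1 / s` separate by the right-hand
  -- side, which pays for the vertical offsets and the widths of the three tubes; their total is at
  -- most `7 * h + 2 * s * h` because `h ≥ 1`.
  have hκ : (7 + 2 * s) * h ≤ s * (Q * h) - (Q * h) / s := by
    have := mul_le_mul_of_nonneg_right hcr (by linarith : (0 : ℝ) ≤ h)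
    calc _ ≤ _ := this
      _ = _ := by ring
  have hκ' : 7 * (h : ℝ) + 2 * (s * h) ≤ s * (Q * h) - (Q * h) / s := by linarith
  have hl2' : (b : ℝ) ≤ s * A + 2 * (s * h) + h + 1 := by linarith
  -- the connecting path
  obtain ⟨u, v, hu1, hv1, hu, hv, huv⟩ := hlow
  have huv' : Reach (O ∩ D) u.swap v.swap := Reach.flip huv
  rw [mem_tube] at hu hv
  have hu3 : u.swap.1 ≤ x + A + 2 * h := by
    have := hu.2.2.2
    rw [hu1] at this
    push_cast at this
    have h2 : (u.2 : ℝ) ≤ (x + A + 2 * h : ℤ) := by push_cast; linarith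
    exact_mod_cast h2
  have hv3 : x + L ≤ v.swap.1 := by
    have := hv.2.2.1
    rw [hv1] at this
    push_cast at this
    have h1 : (L : ℝ) ≤ s * L := le_mul_of_one_le_left (by positivity) hs.le
    have h3 : (0 : ℝ) ≤ A := by exact_mod_cast hx3.le
    have h2 : ((x + L : ℤ) : ℝ) ≤ v.2 := by push_cast; linarith
    exact_mod_cast h2
  have hvD : v.swap ∈ D := by
    show v ∈ tube _ _ _ _ _
    exact mem_tube.2 hv
  obtain ⟨e0, he0, hue0, he0v⟩ := huv'.exists_column hu3 (by omega)
  obtain ⟨e1, he1, he01, he1v⟩ := he0v.exists_column (c := x + L) (by omega) hv3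
  have he0D : e0.swap ∈ tube (y + b) (x + A + h) L h s := he0v.mem_of_inter hvD
  have he1D : e1.swap ∈ tube (y + b) (x + A + h) L h s := he1v.mem_of_inter hvD
  rw [mem_tube] at he0D he1D
  have he0h : (y : ℝ) + b ≤ e0.2 := by exact_mod_cast he0D.1
  have he1h : (e1.2 : ℝ) ≤ y + b + (Q * h) / s := by
    have := he1D.2.2.1
    simp only [Prod.fst_swap, Prod.snd_swap, he1] at this
    push_cast at this
    rw [← sub_le_iff_le_add', le_div_iff₀ (by linarith)]
    nlinarith
  -- the first tube
  obtain ⟨g0, hg0, hfg0, hg0g⟩ := hfg.exists_column hf1 (by omega)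
  have hg0T := mem_tube.1 (hg0g.mem_of_inter hg)
  have hgT := mem_tube.1 hg
  -- the next tube
  obtain ⟨x', y', hx', hy', hx'T, hy'T, hxy'⟩ := hup
  obtain ⟨f0, hf0, hxf0, hf0y⟩ := hxy'.exists_column (c := x + A + 2 * h) (by omega) (by omega)
  obtain ⟨f1, hf1', hf01, hf1y⟩ := hf0y.exists_column (c := x + L) (by omega) (by omega)
  have hf0T := mem_tube.1 (hf0y.mem_of_inter hy'T)
  have hf1T := mem_tube.1 (hf1y.mem_of_inter hy'T)
  rw [hg0] at hg0T
  rw [hg1] at hgT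
  rw [hf0] at hf0T
  rw [hf1'] at hf1T
  push_cast at hg0T hgT hf0T hf1T
  have m1 : O ∩ T ⊆ O ∩ (T ∪ D ∪ T') := inter_subset_inter_right _ fun _ h => .inl (.inl h)
  have m2 : O ∩ D ⊆ O ∩ (T ∪ D ∪ T') := inter_subset_inter_right _ fun _ h => .inl (.inr h)
  have m3 : O ∩ T' ⊆ O ∩ (T ∪ D ∪ T') := inter_subset_inter_right _ fun _ h => .inr h
  -- Order of the paths: in column `x + A + 2 * h` the next tube is below the first and the
  -- connecting path above it; in column `x + L` the connecting path is below both.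
  have c1 : g0.2 ≤ e0.2 := by
    have : (g0.2 : ℝ) ≤ e0.2 := by linarith [hg0T.2.2.2]
    exact_mod_cast this
  have c2 : e1.2 ≤ f1.2 := by
    have : (e1.2 : ℝ) ≤ f1.2 := by
      have := hf1T.2.2.1
      have e : s * ((x : ℝ) + L - (x + A)) = s * (Q * h) := by rw [hAr]; ring
      rw [e] at this
      linarith
    exact_mod_cast this
  have c3 : e1.2 ≤ g.2 := by
    have : (e1.2 : ℝ) ≤ g.2 := by
      have := hgT.2.2.1
      have e : s * ((x : ℝ) + L - x) = s * A + s * (Q * h) := by rw [hAr]; ring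
      rw [e] at this
      linarith
    exact_mod_cast this
  have c4 : f0.2 ≤ g0.2 := by
    have : (f0.2 : ℝ) ≤ g0.2 := by
      have k1 := hf0T.2.2.2
      have k2 := hg0T.2.2.1
      have e : s * ((x : ℝ) + A + 2 * h - (x + A)) = s * (2 * h) := by ring
      have e' : s * ((x : ℝ) + A + 2 * h - x) = s * A + s * (2 * h) := by ring
      rw [e] at k1
      rw [e'] at k2
      linarith
    exact_mod_cast this
  -- The first path crosses onto the connecting path, and the path so obtained crosses the one in
  -- the next tube.
  have r1 : Reach (O ∩ (T ∪ D ∪ T')) g0 e1 :=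
    (hg0g.mono m1).cross_left (he01.mono m2) (by omega) (by omega) c1 c3
  have r2 : Reach (O ∩ (T ∪ D ∪ T')) g0 f1 :=
    (hf01.mono m3).cross_right r1 (by omega) (by omega) c4 c2
  exact ⟨f1, y', hy'T, hf1', hy', hf1y, (hfg0.mono m1).trans r2⟩

theorem Admissible.tube_subset_lane (hA : Admissible Q L h s) (a b : ℤ) (i : ℕ) :
    tube (a + i * strideX Q L h) (b + i * strideY Q L h s) L h s ⊆
      lane a b (Q * L) (strideY Q L h s / strideX Q L h) := by
  obtain ⟨hx1, hx2, hx3, hx4⟩ := hA.strideX_bounds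
  obtain ⟨hy1, hy2⟩ := strideY_bounds Q L h s
  have hs := hA.one_lt
  have hw := hA.wide
  have hpos : (1 : ℝ) ≤ h := by exact_mod_cast hA.pos
  have hlong : 2 * ((Q : ℝ) * h) ≤ L := by exact_mod_cast hA.long
  set A := strideX Q L h
  set B := strideY Q L h s
  intro z hz
  rw [mem_tube] at hz
  obtain ⟨h1, h2, h3, h4⟩ := hz
  have hAr : (0 : ℝ) < A := by exact_mod_cast hx3
  have hLA : (L : ℝ) ≤ 2 * A := by exact_mod_cast hx2
  have h1' : (a : ℝ) + i * A ≤ z.1 := by exact_mod_cast h1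
  have h2' : (z.1 : ℝ) ≤ a + i * A + L := by exact_mod_cast h2
  push_cast at h3 h4
  refine ⟨le_trans (by nlinarith) h1, ?_⟩
  set c : ℝ := z.1 - (a + i * A) with hc
  set σ : ℝ := B / A with hσ
  have hσA : σ * A = B := div_mul_cancel₀ _ hAr.ne'
  have hd : 0 ≤ s - σ := by
    rw [sub_nonneg, hσ, div_le_iff₀ hAr]; linarith
  have hd2 : (s - σ) * A ≤ 2 * h + 2 := by rw [sub_mul, hσA]; exact hy2
  have hdc : (s - σ) * c ≤ 4 * h + 4 := by
    have : (s - σ) * c ≤ (s - σ) * (2 * A) := by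
      refine mul_le_mul_of_nonneg_left ?_ hd
      linarith
    linarith
  have hdc0 : 0 ≤ (s - σ) * c := mul_nonneg hd (by linarith)
  have e : (z.2 : ℝ) - b - σ * (z.1 - a) = ((z.2 : ℝ) - (b + i * B) - s * c) + (s - σ) * c := by
    rw [hc, ← hσA]; ring
  have hQ : (16 : ℝ) ≤ Q := by nlinarith
  have hQL : 9 * (h : ℝ) ≤ Q * L := by nlinarith
  rw [e, abs_le]
  push_cast
  constructor <;> linarith

theorem Admissible.link_subset_lane (hA : Admissible Q L h s) (a b : ℤ) (i : ℕ) :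
    flip (tube (b + i * strideY Q L h s + linkY Q L h s)
      (a + i * strideX Q L h + strideX Q L h + h) L h s) ⊆
      lane a b (Q * L) (strideY Q L h s / strideX Q L h) := by
  obtain ⟨hx1, hx2, hx3, hx4⟩ := hA.strideX_bounds
  obtain ⟨hy1, hy2⟩ := strideY_bounds Q L h s
  obtain ⟨hl1, hl2⟩ := linkY_bounds Q L h s
  have hs := hA.one_lt
  have hw := hA.wide
  have hpos : (1 : ℝ) ≤ h := by exact_mod_cast hA.pos
  have hlong : 2 * ((Q : ℝ) * h) ≤ L := by exact_mod_cast hA.long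
  have hxr : (Q : ℝ) * h ≤ strideX Q L h := by exact_mod_cast hx1
  set A := strideX Q L h
  set B := strideY Q L h s
  set k := linkY Q L h s
  intro z hz
  rw [mem_flip, mem_tube] at hz
  simp only [Prod.fst_swap, Prod.snd_swap] at hz
  obtain ⟨h1, h2, h3, h4⟩ := hz
  have hAr : (0 : ℝ) < A := by exact_mod_cast hx3
  have h1' : (b : ℝ) + i * B + k ≤ z.2 := by exact_mod_cast h1
  have h2' : (z.2 : ℝ) ≤ b + i * B + k + L := by exact_mod_cast h2
  push_cast at h3 h4
  set r : ℝ := z.2 - (b + i * B + k) with hr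
  have hr0 : 0 ≤ r := by linarith
  have hrL : r ≤ L := by linarith
  have hsr : s * r ≤ s * L := mul_le_mul_of_nonneg_left hrL (by linarith)
  have hsr0 : 0 ≤ s * r := mul_nonneg (by linarith) hr0
  have hia : (0 : ℝ) ≤ i * A := by positivity
  have hQ : (16 : ℝ) ≤ Q := by nlinarith
  have hhL : (32 : ℝ) * h ≤ L := by nlinarith
  refine ⟨?_, ?_⟩
  · have : (a : ℝ) ≤ z.1 := by linarith
    exact_mod_cast this
  set σ : ℝ := B / A with hσ
  have hσA : σ * A = B := div_mul_cancel₀ _ hAr.ne'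
  have hσs : σ ≤ s := by
    rw [hσ, div_le_iff₀ hAr]; linarith
  have hσ0 : 0 ≤ σ := by
    refine div_nonneg ?_ hAr.le
    have : (Q : ℝ) * h ≤ s * A := hxr.trans (le_mul_of_one_le_left hAr.le hs.le)
    nlinarith
  set c : ℝ := z.1 - (a + i * A + A) with hc
  have hc0 : 0 ≤ c := by linarith
  have hcL : c ≤ 2 * h + s * L := by linarith
  -- The connecting tube rises by `L` and so extends up to `s * L + 2 * h` columns, along which the
  -- lane rises by about `s ^ 2 * L`. This is why `Q` has to exceed `(s + 3) ^ 2`.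
  have hσc : σ * c ≤ s * (2 * h + s * L) := mul_le_mul hσs hcL hc0 (by linarith)
  have hσc0 : 0 ≤ σ * c := mul_nonneg hσ0 hc0
  have e : (z.2 : ℝ) - b - σ * (z.1 - a) = (k - B) + r - σ * c := by
    rw [hc, hr, ← hσA]; ring
  have hkB : (k : ℝ) - B ≤ 3 * h + 3 + s * (2 * h) := by
    have : s * ((A : ℝ) + 2 * h) = s * A + s * (2 * h) := by ring
    linarith
  have hkB0 : (0 : ℝ) ≤ k - B := by
    have : 0 ≤ s * (2 * (h : ℝ)) := by positivity
    have : s * ((A : ℝ) + 2 * h) = s * A + s * (2 * h) := by ring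
    linarith
  have hL0 : (0 : ℝ) ≤ L := by positivity
  have hsh : s * (32 * h) ≤ s * L := mul_le_mul_of_nonneg_left hhL (by linarith)
  have hQL : (s + 3) ^ 2 * L ≤ Q * L := mul_le_mul_of_nonneg_right hw hL0
  have hexp : (s + 3) ^ 2 * L = s * (s * L) + 6 * (s * L) + 9 * L := by ring
  have hsL : (0 : ℝ) ≤ s * L := by positivity
  have hssL : (0 : ℝ) ≤ s * (s * L) := by positivity
  rw [e, abs_le]
  push_cast
  constructor <;> linarith

/-- If all tubes and connecting tubes of a chain are crossed, there is an open path along it. -/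
theorem Admissible.chain (hA : Admissible Q L h s) {O : Set (ℤ × ℤ)} {a b : ℤ} {m : ℕ}
    (hup : ∀ i < m + 1,
      Crossed O (a + i * strideX Q L h) (b + i * strideY Q L h s) L h s)
    (hlow : ∀ i < m, Crossed (flip O) (b + i * strideY Q L h s + linkY Q L h s)
      (a + i * strideX Q L h + strideX Q L h + h) L h s) :
    ∃ x g : ℤ × ℤ, x.1 = a ∧ x ∈ tube a b L h s ∧ g.1 = a + m * strideX Q L h + L ∧
      g ∈ lane a b (Q * L) (strideY Q L h s / strideX Q L h) ∧
      Reach (O ∩ lane a b (Q * L) (strideY Q L h s / strideX Q L h)) x g := by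
  obtain ⟨hx1, hx2, hx3, hx4⟩ := hA.strideX_bounds
  have hAL : strideX Q L h = L - Q * h := rfl
  suffices ∃ x f g : ℤ × ℤ, x.1 = a ∧ x ∈ tube a b L h s ∧
      f.1 ≤ a + m * strideX Q L h + strideX Q L h + 2 * h ∧
      g.1 = a + m * strideX Q L h + L ∧
      g ∈ tube (a + m * strideX Q L h) (b + m * strideY Q L h s) L h s ∧
      Reach (O ∩ tube (a + m * strideX Q L h) (b + m * strideY Q L h s) L h s) f g ∧
      Reach (O ∩ lane a b (Q * L) (strideY Q L h s / strideX Q L h)) x f by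
    obtain ⟨x, f, g, h1, h2, -, h3, h4, h5, h6⟩ := this
    exact ⟨x, g, h1, h2, h3, hA.tube_subset_lane a b m h4,
      h6.trans (h5.mono (inter_subset_inter_right _ (hA.tube_subset_lane a b m)))⟩
  induction m with
  | zero =>
    obtain ⟨x, y, h1, h2, h3, h4, h5⟩ := hup 0 (by omega)
    simp only [Nat.cast_zero, zero_mul, add_zero] at h1 h2 h3 h4 h5 ⊢
    exact ⟨x, x, y, h1, h3, by omega, h2, h4, h5, .refl _⟩
  | succ m ih =>
    obtain ⟨x, f, g, h1, h2, h3, h4, h5, h6, h7⟩ :=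
      ih (fun i hi => hup i (by omega)) (fun i hi => hlow i (by omega))
    have hup' := hup (m + 1) (by omega)
    have e1 : a + ((m + 1 : ℕ) : ℤ) * strideX Q L h =
      a + m * strideX Q L h + strideX Q L h := by push_cast; ring
    have e2 : b + ((m + 1 : ℕ) : ℤ) * strideY Q L h s =
      b + m * strideY Q L h s + strideY Q L h s := by push_cast; ring
    have s1 := hA.tube_subset_lane a b m
    have s2 := hA.link_subset_lane a b m
    have s3 := hA.tube_subset_lane a b (m + 1)
    rw [e1, e2] at hup' s3
    obtain ⟨f', g', k1, k2, k3, k4, k5⟩ := hA.link h5 h6 h3 h4 (hlow m (by omega)) hup'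
    rw [e1, e2]
    refine ⟨x, f', g', h1, h2, by omega, k3, k1, k4, h7.trans (k5.mono ?_)⟩
    exact inter_subset_inter_right _ (union_subset (union_subset s1 s2) s3)

end


/-! ### Crossing probabilities -/

theorem Reach.exists_finset {O : Set (ℤ × ℤ)} {x y : ℤ × ℤ} (h : Reach O x y) :
    ∃ F : Finset (ℤ × ℤ), (F : Set (ℤ × ℤ)) ⊆ O ∧ Reach (F : Set (ℤ × ℤ)) x y := by
  induction h with
  | refl => exact ⟨∅, by simp, .refl _⟩
  | @tail y y' hr hs ih =>
    obtain ⟨F, h1, h2⟩ := ih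
    refine ⟨insert y F, ?_, ?_⟩
    · rw [Finset.coe_insert]
      exact insert_subset hs.1 h1
    · refine (h2.mono ?_).trans (Step.reach ⟨?_, hs.2⟩)
      · rw [Finset.coe_insert]; exact subset_insert _ _
      · simp

theorem Crossed.mono {O O' : Set (ℤ × ℤ)} {a b : ℤ} {L h : ℕ} {s : ℝ}
    (hO : O ∩ tube a b L h s ⊆ O') (hc : Crossed O a b L h s) : Crossed O' a b L h s := by
  obtain ⟨x, y, h1, h2, h3, h4, h5⟩ := hc
  exact ⟨x, y, h1, h2, h3, h4, h5.mono fun z hz => ⟨hO hz, hz.2⟩⟩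

/-- A crossing is witnessed by finitely many open sites. Hence it is a countable union of cylinder
events, and it persists under a small decrease of the parameter. -/
theorem crossed_iff_finset {O : Set (ℤ × ℤ)} {a b : ℤ} {L h : ℕ} {s : ℝ} :
    Crossed O a b L h s ↔ ∃ F : Finset (ℤ × ℤ), ((F : Set (ℤ × ℤ)) ⊆ tube a b L h s ∧
      Crossed (F : Set (ℤ × ℤ)) a b L h s) ∧ ∀ z ∈ F, z ∈ O := by
  constructor
  · rintro ⟨x, y, h1, h2, h3, h4, h5⟩
    obtain ⟨F, h6, h7⟩ := h5.exists_finset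
    refine ⟨F, ⟨fun z hz => (h6 hz).2, x, y, h1, h2, h3, h4, h7.mono fun z hz => ?_⟩,
      fun z hz => (h6 hz).1⟩
    exact ⟨hz, (h6 hz).2⟩
  · rintro ⟨F, ⟨h1, h2⟩, h3⟩
    exact h2.mono fun z hz => h3 z hz.1

theorem measurable_crossed {Ω : Type*} [MeasurableSpace Ω] {O : Ω → Set (ℤ × ℤ)} {a b : ℤ}
    {L h : ℕ} {s : ℝ} (hO : ∀ x ∈ tube a b L h s, Measurable fun ω => x ∈ O ω) :
    Measurable fun ω => Crossed (O ω) a b L h s := by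
  have e : (fun ω => Crossed (O ω) a b L h s) = fun ω => ∃ F : Finset (ℤ × ℤ),
      ((F : Set (ℤ × ℤ)) ⊆ tube a b L h s ∧ Crossed (F : Set (ℤ × ℤ)) a b L h s) ∧
        ∀ z ∈ F, z ∈ O ω := funext fun ω => propext crossed_iff_finset
  rw [e]
  refine Measurable.exists fun F => ?_
  by_cases hF : (F : Set (ℤ × ℤ)) ⊆ tube a b L h s ∧ Crossed (F : Set (ℤ × ℤ)) a b L h s
  · simp only [hF, and_self, true_and]
    exact Measurable.forall fun z => Measurable.forall fun hz => hO z (hF.1 hz)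
  · simp only [hF, false_and]
    exact measurable_const

theorem crossed_translate {O : Set (ℤ × ℤ)} {L h : ℕ} {s : ℝ} (a b : ℤ) :
    Crossed ((fun w => w + (a, b)) ⁻¹' O) 0 0 L h s ↔ Crossed O a b L h s := by
  have ht : tube 0 0 L h s = (fun w => w + (a, b)) ⁻¹' tube a b L h s := by
    ext w
    simp only [mem_preimage, mem_tube, Prod.fst_add, Prod.snd_add]
    push_cast
    refine and_congr (by omega) (and_congr (by omega) (and_congr ?_ ?_)) <;>
    · constructor <;> intro h <;> ring_nf at h ⊢ <;> linarith
  constructor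
  · rintro ⟨x, y, h1, h2, h3, h4, h5⟩
    rw [ht] at h3 h4 h5
    refine ⟨x + (a, b), y + (a, b), by simp [h1], by simp [h2]; ring, h3, h4, ?_⟩
    exact Reach.translate (a, b) h5
  · rintro ⟨x, y, h1, h2, h3, h4, h5⟩
    refine ⟨x - (a, b), y - (a, b), by simp [h1], by simp [h2], ?_, ?_, ?_⟩
    · rw [ht]; simpa using h3
    · rw [ht]; simpa using h4
    · rw [ht]
      have := (reach_translate (O := O ∩ tube a b L h s) (x := x - (a, b)) (y := y - (a, b))
        (a, b)).2 (by simpa using h5)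
      exact this

/-- The probability that a tube is not crossed. -/
noncomputable def failProb (p : ℝ) (L h : ℕ) (s : ℝ) : ENNReal :=
  law {U | ¬ Crossed (opn p U) 0 0 L h s}

theorem law_not_crossed (p : ℝ) (a b : ℤ) (L h : ℕ) (s : ℝ) :
    law {U | ¬ Crossed (opn p U) a b L h s} = failProb p L h s := by
  rw [failProb, ← law_reindex (Equiv.addRight ((a, b) : ℤ × ℤ))
    {U | ¬ Crossed (opn p U) 0 0 L h s}]
  congr 1
  ext U
  show _ ↔ ¬ Crossed (opn p (reindex (Equiv.addRight ((a, b) : ℤ × ℤ)) U)) 0 0 L h s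
  rw [opn_reindex]
  exact (not_congr (crossed_translate a b)).symm

theorem law_not_crossed_flip (p : ℝ) (a b : ℤ) (L h : ℕ) (s : ℝ) :
    law {U | ¬ Crossed (flip (opn p U)) a b L h s} = failProb p L h s := by
  rw [← law_not_crossed p a b, ← law_reindex (Equiv.prodComm ℤ ℤ)
    {U | ¬ Crossed (opn p U) a b L h s}]
  congr 1

/-- All tubes and connecting tubes of a chain of `m + 1` tubes are crossed. -/
def ChainCrossed (O : Set (ℤ × ℤ)) (Q L h : ℕ) (s : ℝ) (m : ℕ) (a b : ℤ) : Prop :=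
  (∀ i < m + 1, Crossed O (a + i * strideX Q L h) (b + i * strideY Q L h s) L h s) ∧
  ∀ i < m, Crossed (flip O) (b + i * strideY Q L h s + linkY Q L h s)
    (a + i * strideX Q L h + strideX Q L h + h) L h s

section
variable {Q L h : ℕ} {s : ℝ}

theorem Admissible.measurable_chainCrossed (hA : Admissible Q L h s) (p : ℝ) (m : ℕ) (a b : ℤ) :
    Measurable[sites (lane a b (Q * L) (strideY Q L h s / strideX Q L h))]
      fun U => ChainCrossed (opn p U) Q L h s m a b := by
  refine @Measurable.and _ (sites _) _ _ ?_ ?_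
  · refine @Measurable.forall _ _ (sites _) _ _ fun i =>
      @Measurable.forall _ _ (sites _) _ _ fun _ => ?_
    refine @measurable_crossed _ (sites _) _ _ _ _ _ _ fun x hx => ?_
    exact measurable_mem_opn (hA.tube_subset_lane a b i hx) p
  · refine @Measurable.forall _ _ (sites _) _ _ fun i =>
      @Measurable.forall _ _ (sites _) _ _ fun _ => ?_
    refine @measurable_crossed _ (sites _) _ _ _ _ _ _ fun x hx => ?_
    exact measurable_mem_opn (x := x.swap) (hA.link_subset_lane a b i hx) p

/-- Union bound over `m + 1` tubes and `m` connecting tubes, all with the same failure probability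
by translation and reflection. -/
theorem law_not_chainCrossed (p : ℝ) (m : ℕ) (a b : ℤ) :
    law {U | ¬ ChainCrossed (opn p U) Q L h s m a b} ≤ (2 * m + 1 : ℕ) * failProb p L h s := by
  have hsub : {U | ¬ ChainCrossed (opn p U) Q L h s m a b} ⊆
      (⋃ i ∈ Finset.range (m + 1), {U | ¬ Crossed (opn p U) (a + (i : ℤ) * strideX Q L h)
        (b + (i : ℤ) * strideY Q L h s) L h s}) ∪
      ⋃ i ∈ Finset.range m, {U | ¬ Crossed (flip (opn p U))
        (b + (i : ℤ) * strideY Q L h s + linkY Q L h s)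
        (a + (i : ℤ) * strideX Q L h + strideX Q L h + h) L h s} := by
    intro U hU
    by_contra hc
    simp only [mem_union, mem_iUnion, Finset.mem_range, not_or, not_exists, mem_ofPred_eq,
      not_not] at hc
    exact hU ⟨fun i hi => hc.1 i hi, fun i hi => hc.2 i hi⟩
  refine (measure_mono hsub).trans ((measure_union_le _ _).trans ?_)
  have h1 := measure_biUnion_finset_le (μ := law) (Finset.range (m + 1))
    fun i : ℕ => {U | ¬ Crossed (opn p U) (a + (i : ℤ) * strideX Q L h)
        (b + (i : ℤ) * strideY Q L h s) L h s}
  have h2 := measure_biUnion_finset_le (μ := law) (Finset.range m)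
    fun i : ℕ => {U | ¬ Crossed (flip (opn p U))
        (b + (i : ℤ) * strideY Q L h s + linkY Q L h s)
        (a + (i : ℤ) * strideX Q L h + strideX Q L h + h) L h s}
  simp only [law_not_crossed, law_not_crossed_flip, Finset.sum_const, Finset.card_range,
    nsmul_eq_mul] at h1 h2
  refine (add_le_add h1 h2).trans_eq ?_
  push_cast
  ring

theorem Admissible.crossed_of_chainCrossed (hA : Admissible Q L h s) {O : Set (ℤ × ℤ)} {m : ℕ}
    {b : ℤ} (hb : |b| ≤ Q * L + 1) (hc : ChainCrossed O Q L h s m 0 b) :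
    Crossed O 0 0 ((m + 1) * (L - Q * h)) (3 * (Q * L)) (strideY Q L h s / strideX Q L h) := by
  obtain ⟨x, g, h1, h2, h3, h4, h5⟩ := hA.chain hc.1 hc.2
  obtain ⟨hx1, hx2, hx3, hx4⟩ := hA.strideX_bounds
  have hQh : Q * h ≤ L := by have := hA.long; omega
  have hL' : (((m + 1) * (L - Q * h) : ℕ) : ℤ) = m * strideX Q L h + strideX Q L h := by
    push_cast [Nat.cast_sub hQh]
    unfold strideX
    ring
  have hAL : strideX Q L h = L - Q * h := rfl
  have hmA : (0 : ℤ) ≤ m * strideX Q L h := by positivity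
  have hQh0 : (0 : ℤ) ≤ Q * h := by positivity
  obtain ⟨q, hq1, hxq, hqg⟩ := h5.exists_column
    (c := (((m + 1) * (L - Q * h) : ℕ) : ℤ)) (by omega) (by omega)
  have hsub : ∀ z ∈ lane 0 b (Q * L) (strideY Q L h s / strideX Q L h),
      z.1 ≤ (((m + 1) * (L - Q * h) : ℕ) : ℤ) →
      z ∈ tube 0 0 ((m + 1) * (L - Q * h)) (3 * (Q * L)) (strideY Q L h s / strideX Q L h) := by
    rintro z ⟨hz1, hz2⟩ hz3
    refine ⟨hz1, by simpa using hz3, ?_⟩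
    have hb' : |(b : ℝ)| ≤ Q * L + 1 := by exact_mod_cast hb
    -- The offset `Q * L + 1` of the chain and the half-width `Q * L` of its lane fit into the new
    -- half-width `3 * (Q * L)`.
    have hQL : (1 : ℝ) ≤ Q * L := by
      have h6 : 1 ≤ Q * L := by
        have h7 := hA.wide
        have h8 := hA.one_lt
        have h9 : (0 : ℝ) < Q := by nlinarith
        have h10 : 0 < Q := by exact_mod_cast h9
        have h11 : 0 < L := by omega
        exact Nat.mul_pos h10 h11
      exact_mod_cast h6
    rw [abs_le] at hz2 hb' ⊢
    push_cast at hz2 ⊢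
    constructor <;> linarith
  have hqlane := hqg.mem_of_inter h4
  have hx0 := hxq.mem_of_inter hqlane
  have := hxq.le
  refine ⟨x, q, h1, by simpa using hq1, hsub x hx0 (by omega), hsub q hqlane hq1.le, ?_⟩
  refine (hxq.inter (R := tube 0 0 ((m + 1) * (L - Q * h)) (3 * (Q * L))
    (strideY Q L h s / strideX Q L h)) fun r hr1 hr2 => ?_).mono fun z hz => ⟨hz.1.1, hz.2⟩
  have := hr2.le
  exact hsub r (hr2.mem_of_inter hqlane) (by omega)

theorem lane_disjoint (W : ℕ) (σ : ℝ) :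
    Disjoint (lane 0 (W + 1 : ℤ) W σ) (lane 0 (-(W + 1 : ℤ)) W σ) := by
  refine Set.disjoint_left.2 fun z h1 h2 => ?_
  have h3 := (abs_le.1 h1.2).1
  have h4 := (abs_le.1 h2.2).2
  push_cast at h3 h4
  linarith

/-- Two disjoint chains: failure at a larger scale requires two independent failures. -/
theorem Admissible.failProb_le (hA : Admissible Q L h s) (p : ℝ) (m : ℕ) :
    failProb p ((m + 1) * (L - Q * h)) (3 * (Q * L)) (strideY Q L h s / strideX Q L h) ≤
      ((2 * m + 1 : ℕ) * failProb p L h s) ^ 2 := by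
  -- The base points at heights `W` and `-W` are just far enough apart for the two lanes to be
  -- disjoint.
  set W : ℤ := (Q * L : ℕ) + 1 with hW
  have hind := indep_sites (lane_disjoint (Q * L) (strideY Q L h s / strideX Q L h : ℝ))
  have hm1 := (measurableSet_sites (hA.measurable_chainCrossed p m 0 W)).compl
  have hm2 := (measurableSet_sites (hA.measurable_chainCrossed p m 0 (-W))).compl
  have hmul := (Indep_iff _ _ _).1 hind _ _ hm1 hm2
  have hWabs : |W| ≤ Q * L + 1 := by
    rw [abs_of_nonneg (by positivity), hW]; push_cast; rfl
  calc _ ≤ law ({U | ChainCrossed (opn p U) Q L h s m 0 W}ᶜ ∩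
        {U | ChainCrossed (opn p U) Q L h s m 0 (-W)}ᶜ) := by
        refine measure_mono fun U hU => ⟨fun hc => hU ?_, fun hc => hU ?_⟩
        · exact hA.crossed_of_chainCrossed hWabs hc
        · exact hA.crossed_of_chainCrossed (by rwa [abs_neg]) hc
    _ = _ := hmul
    _ ≤ _ := by
      rw [sq]
      exact mul_le_mul' (law_not_chainCrossed p m 0 W) (law_not_chainCrossed p m 0 (-W))

/-- Failure probabilities are left-continuous in the parameter. -/
theorem exists_lt_failProb_lt {p : ℝ} {δ : ENNReal} (hδ : failProb p L h s < δ) :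
    ∃ p' < p, failProb p' L h s < δ := by
  obtain ⟨u, humono, hup, hu⟩ := exists_seq_strictMono_tendsto p
  have hanti : Antitone fun n => {U | ¬ Crossed (opn (u n) U) 0 0 L h s} := by
    intro i j hij U hU hc
    exact hU (hc.mono fun z hz => opn_mono (humono.monotone hij) U hz.1)
  have hmeas : ∀ n, NullMeasurableSet {U | ¬ Crossed (opn (u n) U) 0 0 L h s} law := fun n =>
    (measurableSet_setOfPred.2
      (measurable_crossed fun x _ => measurable_mem_opn' x (u n)).not).nullMeasurableSet
  have hlim := tendsto_measure_iInter_atTop hmeas hanti ⟨0, measure_ne_top _ _⟩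
  have hle : law (⋂ n, {U | ¬ Crossed (opn (u n) U) 0 0 L h s}) ≤ failProb p L h s := by
    refine measure_mono fun U hU hc => ?_
    obtain ⟨F, ⟨hF1, hF2⟩, hF3⟩ := crossed_iff_finset.1 hc
    have : ∀ᶠ n in atTop, ∀ z ∈ F, z ∈ opn (u n) U := by
      refine (Filter.eventually_all_finset F).2 fun z hz => ?_
      exact hu.eventually (lt_mem_nhds (hF3 z hz))
    obtain ⟨n, hn⟩ := this.exists
    exact mem_iInter.1 hU n (hF2.mono fun z hz => hn z hz.1)
  obtain ⟨n, hn⟩ := (hlim.eventually (gt_mem_nhds (hle.trans_lt hδ))).exists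
  exact ⟨u n, hup n, hn⟩

theorem failProb_anti {p p' : ℝ} (hp : p ≤ p') : failProb p' L h s ≤ failProb p L h s :=
  measure_mono fun U hU hc => hU (hc.mono fun _ hz => opn_mono hp U hz.1)

end


/-! ### Multi-scale iteration -/

/-- The dimensions and slope of the tubes at successive scales. -/
noncomputable def scale (Q M L h : ℕ) (s : ℝ) : ℕ → ℕ × ℕ × ℝ
  | 0 => (L, h, s)
  | k + 1 =>
    (M * 2 ^ k * ((scale Q M L h s k).1 - Q * (scale Q M L h s k).2.1),
      3 * (Q * (scale Q M L h s k).1),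
      strideY Q (scale Q M L h s k).1 (scale Q M L h s k).2.1 (scale Q M L h s k).2.2 /
        strideX Q (scale Q M L h s k).1 (scale Q M L h s k).2.1)

/-- The constants of the iteration, for tubes of initial slope `s₀` and limiting slope above `t`. -/
structure ScaleConst (t s₀ ε : ℝ) (Q M : ℕ) : Prop where
  one_lt : 1 < t
  cross : (7 + 2 * s₀) ≤ (t - 1 / t) * Q
  wide : (s₀ + 3) ^ 2 ≤ Q
  pos : 0 < ε
  loss : 32 * ε ≤ s₀ - t
  long : 2 * Q * ε ≤ 1
  ratio : 12 * (Q : ℝ) ≤ ε * M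
  err : 8 * (Q : ℝ) ≤ (s₀ - t) * M
  four_le : 4 ≤ M

/-- The properties preserved by the iteration. -/
structure ScaleInv (p t s₀ ε : ℝ) (M : ℕ) (k L h : ℕ) (s : ℝ) : Prop where
  pos : 1 ≤ h
  thin : (h : ℝ) * 2 ^ k ≤ ε * L
  steep : (t + s₀) / 2 + 16 * ε / 2 ^ k ≤ s
  le : s ≤ s₀
  fail : failProb p L h s ≤ ENNReal.ofReal (1 / (64 * M ^ 2 * 16 ^ k))

section
variable {p t s₀ ε : ℝ} {Q M k L h : ℕ} {s : ℝ}

theorem exists_scaleConst {t s₀ : ℝ} (ht : 1 < t) (hs : t < s₀) :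
    ∃ (ε : ℝ) (Q M : ℕ), ScaleConst t s₀ ε Q M := by
  have h1 : 0 < t - 1 / t := by
    rw [sub_pos, div_lt_iff₀ (by linarith)]; nlinarith
  obtain ⟨Q, hQ⟩ := exists_nat_ge (max ((7 + 2 * s₀) / (t - 1 / t)) ((s₀ + 3) ^ 2))
  have hQ1 := (le_max_left _ _).trans hQ
  have hQ2 := (le_max_right _ _).trans hQ
  have hQ0 : (0 : ℝ) < Q := by nlinarith
  obtain ⟨ε, hε0, hε⟩ : ∃ ε : ℝ, 0 < ε ∧ ε ≤ (s₀ - t) / 32 ∧ ε ≤ 1 / (2 * Q) := by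
    refine ⟨min ((s₀ - t) / 32) (1 / (2 * Q)), lt_min (by linarith) (by positivity),
      min_le_left _ _, min_le_right _ _⟩
  obtain ⟨M, hM⟩ := exists_nat_ge (max (12 * Q / ε) (max (8 * Q / (s₀ - t)) 4))
  have hM1 := (le_max_left _ _).trans hM
  have hM2 := ((le_max_left _ _).trans (le_max_right _ _)).trans hM
  have hM3 := ((le_max_right _ _).trans (le_max_right _ _)).trans hM
  refine ⟨ε, Q, M, ht, ?_, hQ2, hε0, by linarith [hε.1], ?_, ?_, ?_, by exact_mod_cast hM3⟩
  · rw [div_le_iff₀ h1] at hQ1; linarith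
  · have := hε.2
    rw [le_div_iff₀ (by positivity)] at this
    linarith
  · rw [div_le_iff₀ hε0] at hM1; linarith
  · rw [div_le_iff₀ (by linarith)] at hM2; linarith

theorem ScaleInv.admissible (hC : ScaleConst t s₀ ε Q M) (hI : ScaleInv p t s₀ ε M k L h s) :
    Admissible Q L h s := by
  have h1 := hC.one_lt
  have h2 := hC.loss
  have h3 := hC.pos
  have h4 : t ≤ s := by
    have := hI.steep
    have : 0 ≤ 16 * ε / 2 ^ k := by positivity
    linarith
  have h5 := hI.le
  refine ⟨by linarith, ?_, ?_, hI.pos, ?_⟩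
  · have h6 : t - 1 / t ≤ s - 1 / s := by
      have := one_div_le_one_div_of_le (by linarith) h4
      linarith
    have := mul_le_mul_of_nonneg_right h6 (Nat.cast_nonneg (α := ℝ) Q)
    have := hC.cross
    linarith
  · have := hC.wide
    have : (s + 3) ^ 2 ≤ (s₀ + 3) ^ 2 := by
      refine pow_le_pow_left₀ (by linarith) (by linarith) 2
    linarith
  · have h6 := hI.thin
    have h7 : (h : ℝ) ≤ h * 2 ^ k := le_mul_of_one_le_right (by positivity) (one_le_pow₀ (by norm_num))
    have h8 := hC.long
    have h9 : 2 * (Q * (h : ℝ)) ≤ L := by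
      have : 2 * (Q : ℝ) * h ≤ 2 * Q * (ε * L) :=
        mul_le_mul_of_nonneg_left (h7.trans h6) (by positivity)
      have := mul_le_mul_of_nonneg_right h8 (Nat.cast_nonneg (α := ℝ) L)
      linarith
    exact_mod_cast h9

theorem ScaleInv.next (hC : ScaleConst t s₀ ε Q M) (hI : ScaleInv p t s₀ ε M k L h s) :
    ScaleInv p t s₀ ε M (k + 1) (M * 2 ^ k * (L - Q * h)) (3 * (Q * L))
      (strideY Q L h s / strideX Q L h) := by
  have hA := hI.admissible hC
  obtain ⟨hx1, hx2, hx3, hx4⟩ := hA.strideX_bounds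
  obtain ⟨hy1, hy2⟩ := strideY_bounds Q L h s
  have hQh : Q * h ≤ L := by have := hA.long; omega
  have hAr : (0 : ℝ) < strideX Q L h := by exact_mod_cast hx3
  have hLA : (L : ℝ) ≤ 2 * strideX Q L h := by exact_mod_cast hx2
  have hcast : ((L - Q * h : ℕ) : ℝ) = strideX Q L h := by
    rw [Nat.cast_sub hQh]; simp [strideX]
  have hM4 : (4 : ℝ) ≤ M := by exact_mod_cast hC.four_le
  have hε := hC.pos
  have hh : (1 : ℝ) ≤ h := by exact_mod_cast hI.pos
  have hs1 := hA.one_lt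
  have hQ0 : 0 < Q := by
    have h7 := hA.wide
    have h9 : (0 : ℝ) < Q := by nlinarith
    exact_mod_cast h9
  have hL0 : 0 < L := by
    have := hA.long
    have : 0 < Q * h := Nat.mul_pos hQ0 hI.pos
    omega
  refine ⟨?_, ?_, ?_, ?_, ?_⟩
  · have : 0 < Q * L := Nat.mul_pos hQ0 hL0
    omega
  · push_cast
    rw [hcast, pow_succ]
    have h2 : (0 : ℝ) < 2 ^ k := by positivity
    have h3 : 12 * (Q : ℝ) * L ≤ ε * M * (2 * strideX Q L h) :=
      mul_le_mul hC.ratio hLA (by positivity) (by positivity)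
    have := mul_le_mul_of_nonneg_left h3 h2.le
    linarith
  · have h1 := hI.steep
    -- The slope lost at scale `k` is at most `8 * ε / 2 ^ k`; the total `16 * ε` is half the margin
    -- between `s₀` and `t` at most.
    have h2 : (s - strideY Q L h s / strideX Q L h) ≤ 8 * ε / 2 ^ k := by
      have e : s - (strideY Q L h s : ℝ) / strideX Q L h =
          (s * strideX Q L h - strideY Q L h s) / strideX Q L h := by
        field_simp
      rw [e, div_le_div_iff₀ hAr (by positivity)]
      have h3 := hI.thin
      have h4 : (s * strideX Q L h - strideY Q L h s) * 2 ^ k ≤ (4 * h) * 2 ^ k :=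
        mul_le_mul_of_nonneg_right (by linarith) (by positivity)
      have h5 : ε * L ≤ ε * (2 * strideX Q L h) := mul_le_mul_of_nonneg_left hLA hε.le
      linarith
    have e2 : 16 * ε / 2 ^ (k + 1) = 16 * ε / 2 ^ k - 8 * ε / 2 ^ k := by
      rw [pow_succ]; field_simp; ring
    rw [e2]
    linarith
  · refine le_trans ?_ hI.le
    rw [div_le_iff₀ hAr]
    linarith
  · have hm : M * 2 ^ k - 1 + 1 = M * 2 ^ k := by
      have : 0 < M * 2 ^ k := Nat.mul_pos (by have := hC.four_le; omega) (by positivity)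
      omega
    have h1 := hA.failProb_le p (M * 2 ^ k - 1)
    rw [hm] at h1
    refine h1.trans ?_
    have h2 : ((2 * (M * 2 ^ k - 1) + 1 : ℕ) : ENNReal) * failProb p L h s ≤
        ENNReal.ofReal (2 * (M * 2 ^ k) * (1 / (64 * M ^ 2 * 16 ^ k))) := by
      rw [ENNReal.ofReal_mul (by positivity)]
      refine mul_le_mul' ?_ hI.fail
      rw [← ENNReal.ofReal_natCast]
      refine ENNReal.ofReal_le_ofReal ?_
      have : 2 * (M * 2 ^ k - 1) + 1 ≤ 2 * (M * 2 ^ k) := by omega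
      exact_mod_cast this
    refine (pow_le_pow_left' h2 2).trans ?_
    rw [← ENNReal.ofReal_pow (by positivity)]
    refine ENNReal.ofReal_le_ofReal ?_
    have hM0 : (0 : ℝ) < M := by linarith
    have e4 : (16 : ℝ) ^ k = (2 ^ k) ^ 4 := by
      rw [← pow_mul, mul_comm, pow_mul]; norm_num
    rw [pow_succ (16 : ℝ), e4]
    have h1k : (1 : ℝ) ≤ 2 ^ k := one_le_pow₀ (by norm_num)
    set w : ℝ := 2 ^ k
    -- The number of tubes in a chain grows like `2 ^ k`, but squaring more than compensates; the
    -- constants match since `64 * 16 = 1024`.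
    have e5 : (2 * (M * w) * (1 / (64 * (M : ℝ) ^ 2 * w ^ 4))) ^ 2 = 1 / (1024 * M ^ 2 * w ^ 6) := by
      field_simp; norm_num
    rw [e5]
    refine one_div_le_one_div_of_le (by positivity) ?_
    have : w ^ 4 ≤ w ^ 6 := pow_le_pow_right₀ h1k (by norm_num)
    have := mul_le_mul_of_nonneg_left this (by positivity : (0 : ℝ) ≤ 1024 * M ^ 2)
    linarith

theorem scaleInv_scale (hC : ScaleConst t s₀ ε Q M) (hI : ScaleInv p t s₀ ε M 0 L h s) (k : ℕ) :
    ScaleInv p t s₀ ε M k (scale Q M L h s k).1 (scale Q M L h s k).2.1 (scale Q M L h s k).2.2 := by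
  induction k with
  | zero => exact hI
  | succ k ih => exact ih.next hC

theorem exists_between_of_tendsto {L : ℕ → ℕ} (hL : ∀ k, k ≤ L k) {k n : ℕ} (h : L k ≤ n) :
    ∃ j, k ≤ j ∧ L j ≤ n ∧ n ≤ L (j + 1) := by
  by_contra! hc
  have : ∀ i, L (k + i) ≤ n := by
    intro i
    induction i with
    | zero => exact h
    | succ i ih => exact (hc (k + i) (by omega) ih).le
  have h1 := this (n + 1)
  have h2 := hL (k + (n + 1))
  omega

/-- A chain of tubes bounds the upper edge from below. -/
theorem Admissible.le_top_of_chainCrossed (hA : Admissible Q L h s) {O : Set (ℤ × ℤ)}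
    (hO : Good O) {m n : ℕ} (hn : n ≤ (m + 1) * (L - Q * h))
    (hc : ChainCrossed O Q L h s m 0 (-(Q * L : ℕ))) :
    (strideY Q L h s / strideX Q L h : ℝ) * n - 2 * (Q * L) ≤ top O 0 0 n := by
  obtain ⟨x, g, h1, h2, h3, h4, h5⟩ := hA.chain hc.1 hc.2
  obtain ⟨hx1, hx2, hx3, hx4⟩ := hA.strideX_bounds
  have hQh : Q * h ≤ L := by have := hA.long; omega
  have hAL : strideX Q L h = L - Q * h := rfl
  have hL' : (((m + 1) * (L - Q * h) : ℕ) : ℤ) = m * strideX Q L h + strideX Q L h := by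
    push_cast [Nat.cast_sub hQh]
    unfold strideX
    ring
  have hn' : (n : ℤ) ≤ (((m + 1) * (L - Q * h) : ℕ) : ℤ) := by exact_mod_cast hn
  have hQh0 : (0 : ℤ) ≤ Q * h := by positivity
  obtain ⟨q, hq1, hxq, hqg⟩ := h5.exists_column (c := n) (by omega) (by omega)
  have hqlane := hqg.mem_of_inter h4
  -- Starting the chain at height `-(Q * L)` puts its whole first column section below 0, so its
  -- paths count for the upper edge.
  have hx2' : x.2 ≤ 0 := by
    have h6 := (mem_tube.1 h2).2.2.2
    rw [h1] at h6
    have h7 : (h : ℝ) ≤ Q * L := by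
      have hs := hA.one_lt
      have hw := hA.wide
      have : (1 : ℝ) ≤ Q := by nlinarith
      have hl : 2 * ((Q : ℝ) * h) ≤ L := by exact_mod_cast hA.long
      have h0 : (0 : ℝ) ≤ h := by positivity
      nlinarith
    have : (x.2 : ℝ) ≤ 0 := by push_cast at h6; linarith
    exact_mod_cast this
  have hx : x = (0, x.2) := Prod.ext h1 rfl
  have hq : q = ((n : ℤ), q.2) := Prod.ext hq1 rfl
  rw [hx, hq] at hxq
  obtain ⟨z, hz1, hz2, hz3⟩ := hxq.exists_ent (E := Iic 0) (n := n) hx2' (by simp)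
  have hzl : ((n : ℤ), z) ∈ lane 0 (-(Q * L : ℕ)) (Q * L) (strideY Q L h s / strideX Q L h) := by
    rcases hz2.eq_or_lt with hz2 | hz2
    · rw [hz2, ← hq]; exact hqlane
    · exact (hz3 z le_rfl hz2).2
  have h6 := (abs_le.1 hzl.2).1
  have h7 : z ≤ top O 0 0 n := hO.le_top (ent_mono inter_subset_left subset_rfl hz1)
  have h8 : (z : ℝ) ≤ top O 0 0 n := by exact_mod_cast h7
  push_cast at h6
  simp only [sub_zero] at h6
  linarith

/-- If thin tubes are crossed with large enough probability at one scale, the upper edge grows at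
least with slope `t`. -/
theorem ScaleInv.ae_le_top (hC : ScaleConst t s₀ ε Q M) (hI : ScaleInv p t s₀ ε M 0 L h s)
    (h0 : 0 < p) (h1 : p < 1) :
    ∀ᵐ U ∂law, ∃ K : ℕ, ∀ n : ℕ, t * n - K ≤ top (opn p U) 0 0 n := by
  set S := scale Q M L h s with hS
  have hinv : ∀ k, ScaleInv p t s₀ ε M k (S k).1 (S k).2.1 (S k).2.2 := scaleInv_scale hC hI
  have hadm := fun k => (hinv k).admissible hC
  have hM4 := hC.four_le
  have hM4' : (4 : ℝ) ≤ M := by exact_mod_cast hM4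
  have hLk : ∀ k, (S (k + 1)).1 = M * 2 ^ k * ((S k).1 - Q * (S k).2.1) := fun k => rfl
  have hsk : ∀ k, (S (k + 1)).2.2 = strideY Q (S k).1 (S k).2.1 (S k).2.2 /
    strideX Q (S k).1 (S k).2.1 := fun k => rfl
  have hgrow : ∀ k, M * 2 ^ k * (S k).1 ≤ 2 * (S (k + 1)).1 := by
    intro k
    have := (hadm k).long
    rw [hLk]
    calc M * 2 ^ k * (S k).1 ≤ M * 2 ^ k * (2 * ((S k).1 - Q * (S k).2.1)) :=
          Nat.mul_le_mul_left _ (by omega)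
      _ = _ := by ring
  have hunb : ∀ k, k + 1 ≤ (S k).1 := by
    intro k
    induction k with
    | zero =>
      have h2 := (hadm 0).long
      have h3 := (hadm 0).pos
      have h4 : 0 < Q := by
        have h7 := (hadm 0).wide
        have h8 := (hadm 0).one_lt
        have h9 : (0 : ℝ) < Q := by nlinarith
        exact_mod_cast h9
      have : 0 < Q * (S 0).2.1 := Nat.mul_pos h4 h3
      omega
    | succ k ih =>
      have h2 := hgrow k
      have h3 : 1 ≤ 2 ^ k := Nat.one_le_two_pow
      have h4 : 4 * 1 * (S k).1 ≤ M * 2 ^ k * (S k).1 := by gcongr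
      omega
  -- A chain of scale `k` tubes with this many links reaches at least to the tube length of scale `k
  -- + 2`, so every large column is covered by some scale.
  set mm : ℕ → ℕ := fun k => M * 2 ^ k * (M * 2 ^ (k + 1)) - 1 with hmm
  have hmm1 : ∀ k, mm k + 1 = M * 2 ^ k * (M * 2 ^ (k + 1)) := by
    intro k
    have : 0 < M * 2 ^ k * (M * 2 ^ (k + 1)) := by positivity
    simp only [hmm]; omega
  set bad : ℕ → Set Sample := fun k =>
    {U | ¬ ChainCrossed (opn p U) Q (S k).1 (S k).2.1 (S k).2.2 (mm k) 0 (-(Q * (S k).1 : ℕ))}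
  have hbad : ∀ k, law (bad k) ≤ ENNReal.ofReal ((1 / 16) * (1 / 4) ^ k) := by
    intro k
    refine (law_not_chainCrossed p (mm k) 0 _).trans ?_
    refine (mul_le_mul' le_rfl (hinv k).fail).trans ?_
    rw [← ENNReal.ofReal_natCast, ← ENNReal.ofReal_mul (by positivity)]
    refine ENNReal.ofReal_le_ofReal ?_
    have h2 : ((2 * mm k + 1 : ℕ) : ℝ) ≤ 2 * (M * 2 ^ k * (M * 2 ^ (k + 1))) := by
      have := hmm1 k
      have : 2 * mm k + 1 ≤ 2 * (M * 2 ^ k * (M * 2 ^ (k + 1))) := by omega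
      exact_mod_cast this
    refine (mul_le_mul_of_nonneg_right h2 (by positivity)).trans_eq ?_
    have hM0 : (M : ℝ) ≠ 0 := by positivity
    have e4 : (16 : ℝ) ^ k = (2 ^ k) ^ 4 := by
      rw [← pow_mul, mul_comm, pow_mul]; norm_num
    have e3 : (1 / 4 : ℝ) ^ k = 1 / (2 ^ k) ^ 2 := by
      rw [← pow_mul, mul_comm, pow_mul, one_div_pow]; norm_num
    rw [e4, e3, pow_succ]
    field_simp
    norm_num
  have hsum : ∑' k, law (bad k) ≠ ⊤ := by
    refine ne_top_of_le_ne_top ?_ (ENNReal.tsum_le_tsum hbad)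
    have hs : Summable fun k : ℕ => (1 / 16 : ℝ) * (1 / 4) ^ k :=
      (summable_geometric_of_lt_one (by norm_num) (by norm_num)).mul_left _
    rw [← ENNReal.ofReal_tsum_of_nonneg (fun _ => by positivity) hs]
    exact ENNReal.ofReal_ne_top
  filter_upwards [ae_eventually_notMem hsum, ae_good h0 h1] with U hU hgood
  obtain ⟨k0, hk0⟩ := eventually_atTop.1 hU
  -- For `n` between the lengths of scales `k + 1` and `k + 2`, the scale `k` chain has slope at
  -- least `(t + s₀) / 2`, and its width costs at most `(s₀ - t) / 2 * n`.
  have key : ∀ n, (S (k0 + 1)).1 ≤ n → t * n ≤ top (opn p U) 0 0 n := by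
    intro n hn
    obtain ⟨j, hj1, hj2, hj3⟩ := exists_between_of_tendsto (L := fun k => (S k).1)
      (fun k => by have := hunb k; omega) hn
    obtain ⟨k, rfl⟩ : ∃ k, j = k + 1 := ⟨j - 1, by omega⟩
    have hc := not_not.1 (hk0 k (by omega))
    have hn' : n ≤ (mm k + 1) * ((S k).1 - Q * (S k).2.1) := by
      refine hj3.trans ?_
      show (S (k + 1 + 1)).1 ≤ _
      rw [hLk (k + 1), hmm1]
      calc _ ≤ M * 2 ^ (k + 1) * (S (k + 1)).1 := Nat.mul_le_mul_left _ (Nat.sub_le _ _)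
        _ = _ := by rw [hLk k]; ring
    have h2 := (hadm k).le_top_of_chainCrossed hgood hn' hc
    rw [← hsk k] at h2
    have h3 := (hinv (k + 1)).steep
    have h4 : 0 ≤ 16 * ε / 2 ^ (k + 1) := by have := hC.pos; positivity
    have h5 : (M : ℝ) * (S k).1 ≤ 2 * n := by
      have h6 : M * (S k).1 ≤ 2 * n := by
        have h7 : M * (S k).1 ≤ M * 2 ^ k * (S k).1 :=
          Nat.mul_le_mul_right _ (Nat.le_mul_of_pos_right _ (by positivity))
        have h8 := hgrow k
        have h9 : (S (k + 1)).1 ≤ n := hj2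
        omega
      exact_mod_cast h6
    have h6 : 2 * ((Q : ℝ) * (S k).1) ≤ (s₀ - t) / 2 * n := by
      have h7 := mul_le_mul_of_nonneg_right hC.err (Nat.cast_nonneg (α := ℝ) (S k).1)
      have h8 := mul_le_mul_of_nonneg_left h5 (by have := hC.loss; have := hC.pos; linarith :
        0 ≤ s₀ - t)
      linarith
    have h7 : ((t + s₀) / 2) * n ≤ (S (k + 1)).2.2 * n :=
      mul_le_mul_of_nonneg_right (by linarith) (Nat.cast_nonneg n)
    linarith
  obtain ⟨K, hK⟩ := exists_bound_of_eventually_le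
    (f := fun n : ℕ => t * n - top (opn p U) 0 0 n) (by
      filter_upwards [eventually_ge_atTop (S (k0 + 1)).1] with n hn
      linarith [key n hn])
  refine ⟨⌈K⌉₊, fun n => ?_⟩
  have := hK n
  have := Nat.le_ceil K
  linarith

end


/-! ### Thin tubes along the mean slope are crossed -/

/-- The random constant in `ae_top_le` is almost surely finite, hence bounded with high probability,
and by translation invariance one bound serves every starting point. -/
theorem exists_bound_top {p : ℝ} (h0 : 0 < p) (h1 : p < 1) {m : ℕ} (hm : 0 < m) {r : ℝ}
    (hr0 : 0 ≤ r) (hr : meanTop p m < r * m) {δ : ENNReal} (hδ : 0 < δ) :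
    ∃ K : ℕ, ∀ x y : ℤ,
      law {U | ¬ ∀ n : ℕ, (top (opn p U) x y n : ℝ) ≤ y + r * n + K} < δ := by
  set S : ℕ → Set Sample := fun K =>
    {U | ¬ ∀ n : ℕ, (top (opn p U) 0 0 n : ℝ) ≤ r * n + K} with hS
  have hmeas : ∀ K, NullMeasurableSet (S K) law := by
    intro K
    refine (measurableSet_setOfPred.2 (Measurable.not (Measurable.forall fun n => ?_))).nullMeasurableSet
    exact measurableSet_setOfPred.1 (measurableSet_le
      (measurable_int_comp (measurable_top_opn p 0 0 n) fun z => (z : ℝ)) measurable_const)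
  have hanti : Antitone S := by
    intro i j hij U hU hc
    refine hU fun n => (hc n).trans ?_
    have : (i : ℝ) ≤ j := by exact_mod_cast hij
    linarith
  have hlim := tendsto_measure_iInter_atTop hmeas hanti ⟨0, measure_ne_top _ _⟩
  have hz : law (⋂ K, S K) = 0 := by
    refine measure_mono_null ?_ (ae_iff.1 (ae_top_le h0 h1 hm hr0 hr))
    rintro U hU ⟨K, hK⟩
    exact mem_iInter.1 hU K hK
  rw [hz] at hlim
  obtain ⟨K, hK⟩ := (hlim.eventually (gt_mem_nhds hδ)).exists
  refine ⟨K, fun x y => lt_of_eq_of_lt ?_ hK⟩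
  show _ = law (S K)
  rw [← law_reindex (Equiv.addRight ((x, y) : ℤ × ℤ)) (S K)]
  refine measure_congr ?_
  filter_upwards [ae_good h0 h1] with U hU
  refine propext (not_congr (forall_congr' fun n => ?_))
  have e := hU.top_translate (a := 0) (b := 0) (n := n) (x, y)
  simp only [zero_add] at e
  rw [opn_reindex]
  have e' : (Equiv.addRight ((x, y) : ℤ × ℤ)) ⁻¹' opn p U = (fun w => w + (x, y)) ⁻¹' opn p U := rfl
  rw [e', e]
  push_cast
  constructor <;> intro h <;> linarith

/-- The restarted edge lies above the true one, and their means differ by at most `ε * δ / 8` per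
column when `meanTop p m / m` is close to `a`. Markov's inequality makes the difference small with
high probability, while the restarted edge obeys the strong law. -/
theorem exists_law_top_lt {p : ℝ} (h0 : 0 < p) (h1 : p < 1) {a : ℝ}
    (ha : ∀ n : ℕ, a * n ≤ meanTop p n)
    (ha' : ∀ ε > 0, ∃ m : ℕ, 0 < m ∧ meanTop p m < (a + ε) * m) {ε δ : ℝ} (hε : 0 < ε)
    (hδ : 0 < δ) : ∃ m : ℕ, 0 < m ∧ ∀ᶠ j : ℕ in atTop,
      law {U | (top (opn p U) 0 0 (m * j) : ℝ) < (a - ε) * (m * j : ℕ)} < ENNReal.ofReal δ := by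
  obtain ⟨m, hm, hmean⟩ := ha' (ε * δ / 8) (by positivity)
  have hm0 : (0 : ℝ) < m := by exact_mod_cast hm
  refine ⟨m, hm, ?_⟩
  have hSL := blockTop_strong_law h0 h1 m 0 0
  have hmeasB : ∀ j, Measurable fun U => (blockTop (opn p U) m 0 0 j : ℝ) := fun j =>
    measurable_int_comp ((measurable_blockTop p m 0 0 j).mono (sites_le _) le_rfl) fun z => (z : ℝ)
  have hTM := tendstoInMeasure_of_tendsto_ae (μ := law)
    (f := fun (j : ℕ) U => ((blockTop (opn p U) m 0 0 j : ℝ) - (0 : ℤ)) / j)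
    (g := fun _ => meanTop p m)
    (fun j => (((hmeasB j).sub_const _).div_const _).aestronglyMeasurable) hSL
  rw [tendstoInMeasure_iff_dist] at hTM
  have hT := hTM (ε / 2 * m) (by positivity)
  have hδ2 : (0 : ENNReal) < ENNReal.ofReal (δ / 2) := ENNReal.ofReal_pos.2 (by positivity)
  filter_upwards [hT.eventually (gt_mem_nhds hδ2), eventually_gt_atTop 0] with j hj hj0
  have hj0' : (0 : ℝ) < j := by exact_mod_cast hj0
  set N : ℝ := m * j with hN
  have hN0 : 0 < N := by positivity
  set Z : Sample → ℝ := fun U => (blockTop (opn p U) m 0 0 j : ℝ) - top (opn p U) 0 0 (m * j)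
    with hZ
  have hBint : Integrable (fun U => (blockTop (opn p U) m 0 0 j : ℝ)) law := by
    have : Integrable (fun U => ∑ i ∈ Finset.range j, blockIncr p m 0 0 i U) law :=
      integrable_finsetSum _ fun i _ => integrable_blockIncr h0 h1 m 0 0 i
    simpa [sum_blockIncr] using this
  have hBmean : ∫ U, (blockTop (opn p U) m 0 0 j : ℝ) ∂law = j * meanTop p m := by
    have e : (fun U => (blockTop (opn p U) m 0 0 j : ℝ)) =
        fun U => ∑ i ∈ Finset.range j, blockIncr p m 0 0 i U := by
      funext U; simp [sum_blockIncr]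
    rw [e, integral_finsetSum _ fun i _ => integrable_blockIncr h0 h1 m 0 0 i]
    simp [integral_blockIncr h0 h1]
  have hZint : Integrable Z law := hBint.sub (integrable_top h0 h1 (m * j))
  have hZ0 : 0 ≤ᵐ[law] Z := by
    filter_upwards [ae_good h0 h1] with U hU
    have := hU.top_le_blockTop m 0 0 j
    have : (top (opn p U) 0 0 (m * j) : ℝ) ≤ blockTop (opn p U) m 0 0 j := by exact_mod_cast this
    simp only [hZ, Pi.zero_apply]
    linarith
  have hZmean : ∫ U, Z U ∂law ≤ ε * δ / 8 * N := by
    rw [hZ, integral_sub hBint (integrable_top h0 h1 (m * j)), hBmean]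
    have h2 := ha (m * j)
    have h3 := mul_le_mul_of_nonneg_left hmean.le hj0'.le
    push_cast at h2
    change _ - meanTop p (m * j) ≤ _
    rw [hN]
    linarith
  have hMark := mul_meas_ge_le_integral_of_nonneg hZ0 hZint (ε / 2 * N)
  have hMark' : law {U | ε / 2 * N ≤ Z U} ≤ ENNReal.ofReal (δ / 4) := by
    rw [← ENNReal.ofReal_toReal (measure_ne_top law {U | ε / 2 * N ≤ Z U})]
    refine ENNReal.ofReal_le_ofReal ?_
    have h4 := hMark.trans hZmean
    have h5 : 0 < ε / 2 * N := by positivity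
    change _ * (law {U | ε / 2 * N ≤ Z U}).toReal ≤ _ at h4
    have h6 : ε * δ / 8 * N = ε / 2 * N * (δ / 4) := by ring
    rw [h6] at h4
    exact le_of_mul_le_mul_left h4 h5
  have hsub : {U | (top (opn p U) 0 0 (m * j) : ℝ) < (a - ε) * (m * j : ℕ)} ⊆
      {U | ε / 2 * N ≤ Z U} ∪ {U | ε / 2 * m ≤
        dist (((blockTop (opn p U) m 0 0 j : ℝ) - (0 : ℤ)) / j) (meanTop p m)} := by
    intro U hU
    have hU : (top (opn p U) 0 0 (m * j) : ℝ) < (a - ε) * (m * j : ℕ) := hU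
    rcases le_or_gt (ε / 2 * N) (Z U) with h | h
    · exact .inl h
    · right
      show ε / 2 * m ≤ dist _ _
      rw [Real.dist_eq, abs_sub_comm]
      refine le_trans ?_ (le_abs_self _)
      have h2 : (blockTop (opn p U) m 0 0 j : ℝ) < (a - ε / 2) * N := by
        have : Z U = (blockTop (opn p U) m 0 0 j : ℝ) - top (opn p U) 0 0 (m * j) := rfl
        push_cast at hU
        linarith
      have h3 := ha m
      have h4 : ((blockTop (opn p U) m 0 0 j : ℝ) - (0 : ℤ)) / j ≤ (a - ε / 2) * m := by
        rw [div_le_iff₀ hj0']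
        push_cast
        rw [hN] at h2
        linarith
      linarith
  calc _ ≤ _ := measure_mono hsub
    _ ≤ _ := measure_union_le _ _
    _ < ENNReal.ofReal (δ / 2) + ENNReal.ofReal (δ / 2) := by
      refine ENNReal.add_lt_add_of_le_of_lt ?_ (hMark'.trans ?_) hj
      · exact measure_ne_top _ _
      · exact ENNReal.ofReal_le_ofReal (by linarith)
    _ = _ := by rw [← ENNReal.ofReal_add (by positivity) (by positivity)]; ring_nf

theorem Good.reach_le_of_bound {O : Set (ℤ × ℤ)} (hO : Good O) {x y : ℤ} {r : ℝ} (hr : 0 ≤ r)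
    {K : ℕ} (hb : ∀ n : ℕ, (top O x y n : ℝ) ≤ y + r * n + K) {e z c : ℤ} (he : e ≤ y)
    (h : Reach O (x, e) (c, z)) : (z : ℝ) ≤ y + r * (c - x + 1) + K := by
  have hle := h.le
  simp only at hle
  obtain ⟨n, hn⟩ : ∃ n : ℕ, c = x + n := ⟨(c - x).toNat, by omega⟩
  have h1 := hO.reach_le he h hn
  have e1 : (c : ℝ) - x = n := by rw [hn]; push_cast; ring
  rw [e1]
  rcases le_max_iff.1 h1 with h2 | h2
  · have h3 : (z : ℝ) ≤ top O x y n := by exact_mod_cast h2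
    have := hb n
    linarith
  · have h3 : (z : ℝ) ≤ top O x y (n + 1) := by exact_mod_cast h2
    have := hb (n + 1)
    push_cast at this
    linarith

/-- A path to a high upper edge stays in a thin tube, if no path rises much faster than slope
`a`. -/
theorem Good.crossed_of_bounds {O : Set (ℤ × ℤ)} (hO : Good O) {a ε : ℝ} (ha : 0 ≤ a) (hε : 0 ≤ ε)
    {K J D h : ℕ} (hD : 0 < D) {H : ℝ} (hH : H = 2 * ε * (J * D : ℕ) + (a + ε) + K + 1)
    (hh : a * D + H ≤ h)
    (htop : (a - ε) * (J * D : ℕ) ≤ top O 0 0 (J * D))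
    (hb0 : ∀ n : ℕ, (top O 0 0 n : ℝ) ≤ (0 : ℤ) + (a + ε) * n + K)
    (hb : ∀ j < J + 1, ∀ n : ℕ, (top O ((j * D : ℕ) : ℤ) ⌊a * (j * D : ℕ) - H⌋ n : ℝ) ≤
      ⌊a * (j * D : ℕ) - H⌋ + (a + ε) * n + K) :
    Crossed O 0 0 (J * D) h a := by
  obtain ⟨e, he, hr⟩ := exists_reach_of_mem_ent (hO.top_mem (a := 0) (b := 0) (n := J * D))
  have he : e ≤ 0 := he
  have key : ∀ q : ℤ × ℤ, Reach O (0, e) q → Reach O q (0 + (J * D : ℕ), top O 0 0 (J * D)) →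
      q ∈ tube 0 0 (J * D) h a := by
    intro q h1 h2
    have l1 := h1.le
    have l2 := h2.le
    simp only [zero_add] at l1 l2
    obtain ⟨c, hc⟩ : ∃ c : ℕ, q.1 = c := ⟨q.1.toNat, by omega⟩
    have hcN : c ≤ J * D := by omega
    have hcN' : (c : ℝ) ≤ (J * D : ℕ) := by exact_mod_cast hcN
    have hq : q = ((c : ℤ), q.2) := Prod.ext hc rfl
    have hN0 : (0 : ℝ) ≤ (J * D : ℕ) := Nat.cast_nonneg _
    refine mem_tube.2 ⟨by omega, by simpa using l2.1, ?_, ?_⟩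
    · -- lower bound, from the last checkpoint before column `c`
      set j := c / D with hj
      have hjD : j * D ≤ c := Nat.div_mul_le_self c D
      have hjD2 : c < j * D + D := by
        have := Nat.lt_div_mul_add hD (a := c)
        simpa [hj] using this
      have hjJ : j < J + 1 := by
        have : j * D ≤ J * D := hjD.trans hcN
        have := Nat.le_of_mul_le_mul_right this hD
        omega
      obtain ⟨g, hg1, hg2, hg3⟩ := h1.exists_column (c := ((j * D : ℕ) : ℤ)) (by simp; positivity)
        (by rw [hc]; exact_mod_cast hjD)
      have hg : g = (((j * D : ℕ) : ℤ), g.2) := Prod.ext hg1 rfl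
      have hgle := hg3.le
      -- From at or below the checkpoint height the growth bound leads at most to `(a - ε) * (J * D)
      -- - 1`, strictly below the height the path attains.
      have hlow : a * (j * D : ℕ) - H ≤ g.2 := by
        by_contra hlt
        have hle : g.2 ≤ ⌊a * (j * D : ℕ) - H⌋ := Int.le_floor.2 (not_le.1 hlt).le
        have hgy := hg3.trans h2
        rw [hg] at hgy
        have hbd := hO.reach_le_of_bound (by linarith) (hb j hjJ) hle hgy
        have hfl := Int.floor_le (a * (j * D : ℕ) - H)
        have hjN : ((j * D : ℕ) : ℝ) ≤ (J * D : ℕ) := by exact_mod_cast hjD.trans hcN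
        have hj0 : (0 : ℝ) ≤ (j * D : ℕ) := Nat.cast_nonneg _
        simp only [zero_add, Int.cast_natCast] at hbd
        have : 0 ≤ ε * ((j * D : ℕ) : ℝ) := mul_nonneg hε hj0
        have e1 : (a + ε) * (((J * D : ℕ) : ℝ) - (j * D : ℕ) + 1) = a * (J * D : ℕ) +
          ε * (J * D : ℕ) - a * (j * D : ℕ) - ε * (j * D : ℕ) + (a + ε) := by ring
        rw [e1] at hbd
        rw [hH] at hfl hbd
        linarith
      have h3 : (g.2 : ℝ) ≤ q.2 := by exact_mod_cast hgle.2
      have h4 : (c : ℝ) ≤ (j * D : ℕ) + D := by exact_mod_cast hjD2.le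
      have h5 := mul_le_mul_of_nonneg_left h4 ha
      rw [hc]
      push_cast at h5 hlow ⊢
      linarith
    · rw [hq] at h1
      have hbd := hO.reach_le_of_bound (by linarith) hb0 he h1
      rw [hc]
      have h5 : 0 ≤ ε * ((J * D : ℕ) : ℝ) := mul_nonneg hε hN0
      have h6 := mul_le_mul_of_nonneg_left hcN' hε
      have h7 : 0 ≤ a * (D : ℝ) := by positivity
      simp only [Int.cast_zero, Int.cast_natCast, zero_add, sub_zero] at hbd ⊢
      linarith
  refine ⟨(0, e), (0 + (J * D : ℕ), top O 0 0 (J * D)), rfl, rfl, key _ (.refl _) hr,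
    key _ hr (.refl _), hr.inter key⟩

theorem exists_failProb_le {p : ℝ} (h0 : 0 < p) (h1 : p < 1) {a : ℝ} (ha0 : 0 ≤ a)
    (ha : ∀ n : ℕ, a * n ≤ meanTop p n)
    (ha' : ∀ ε > 0, ∃ m : ℕ, 0 < m ∧ meanTop p m < (a + ε) * m) {η δ : ℝ} (hη : 0 < η)
    (hδ : 0 < δ) :
    ∃ L h : ℕ, 1 ≤ h ∧ (h : ℝ) ≤ η * L ∧ failProb p L h a < ENNReal.ofReal δ := by
  set ε := η / 8 with hε
  have hε0 : 0 < ε := by positivity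
  -- Order of choices: the number `J` of checkpoints depends on `η` and `a` only, then `K` is chosen
  -- so that all `J + 2` growth bounds hold together, and finally the length is taken large compared
  -- with `K`.
  obtain ⟨J, hJ⟩ := exists_nat_ge (max (4 * a / η) 1)
  have hJ1 := (le_max_left _ _).trans hJ
  have hJ2 : (1 : ℝ) ≤ J := (le_max_right _ _).trans hJ
  have hJ0 : 0 < J := by exact_mod_cast lt_of_lt_of_le one_pos hJ2
  obtain ⟨m0, hm0, hmean⟩ := ha' ε hε0
  obtain ⟨K, hK⟩ := exists_bound_top h0 h1 hm0 (by linarith : 0 ≤ a + ε) hmean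
    (δ := ENNReal.ofReal (δ / (2 * (J + 2)))) (ENNReal.ofReal_pos.2 (by positivity))
  obtain ⟨m, hm, hev⟩ := exists_law_top_lt h0 h1 ha ha' hε0 (half_pos hδ)
  have hm' : (1 : ℝ) ≤ m := by exact_mod_cast hm
  obtain ⟨j0, hj0⟩ := eventually_atTop.1 hev
  obtain ⟨d, hd⟩ := exists_nat_ge (max (j0 : ℝ) (max (2 * (a + ε + K + 2) / η) 1))
  have hd1 : (j0 : ℝ) ≤ d := (le_max_left _ _).trans hd
  have hd2 := ((le_max_left _ _).trans (le_max_right _ _)).trans hd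
  have hd3 : (1 : ℝ) ≤ d := ((le_max_right _ _).trans (le_max_right _ _)).trans hd
  have hd1' : j0 ≤ d := by exact_mod_cast hd1
  have hd3' : 0 < d := by exact_mod_cast lt_of_lt_of_le one_pos hd3
  set D := m * d with hD
  have hD0 : 0 < D := Nat.mul_pos hm hd3'
  have hDd : (d : ℝ) ≤ D := by
    rw [hD]; push_cast; exact le_mul_of_one_le_left (by linarith) hm'
  have hNd : (d : ℝ) ≤ (J * D : ℕ) := by
    push_cast; exact hDd.trans (le_mul_of_one_le_left (by linarith) hJ2)
  set H : ℝ := 2 * ε * (J * D : ℕ) + (a + ε) + K + 1 with hH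
  set h := ⌈a * D + H⌉₊ with hh
  have haDH : 1 ≤ a * D + H := by
    have : 0 ≤ a * (D : ℝ) := by positivity
    have : 0 ≤ 2 * ε * ((J * D : ℕ) : ℝ) := by positivity
    have : (0 : ℝ) ≤ K := by positivity
    linarith
  refine ⟨J * D, h, ?_, ?_, ?_⟩
  · have : (1 : ℝ) ≤ h := haDH.trans (Nat.le_ceil _)
    exact_mod_cast this
  · have h2 := (Nat.ceil_lt_add_one (by linarith : 0 ≤ a * D + H)).le
    refine h2.trans ?_
    have h3 : a * D ≤ η / 4 * (J * D : ℕ) := by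
      rw [div_le_iff₀ hη] at hJ1
      have := mul_le_mul_of_nonneg_right hJ1 (Nat.cast_nonneg (α := ℝ) D)
      push_cast
      linarith
    have h4 : a + ε + K + 2 ≤ η / 2 * (J * D : ℕ) := by
      rw [div_le_iff₀ hη] at hd2
      have := mul_le_mul_of_nonneg_left hNd hη.le
      linarith
    have h5 : 2 * ε * ((J * D : ℕ) : ℝ) = η / 4 * (J * D : ℕ) := by rw [hε]; ring
    rw [hH, h5]
    linarith
  · set bad0 := {U | (top (opn p U) 0 0 (J * D) : ℝ) < (a - ε) * (J * D : ℕ)}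
    set bad1 := {U | ¬ ∀ n : ℕ, (top (opn p U) 0 0 n : ℝ) ≤ (0 : ℤ) + (a + ε) * n + K}
    set bad2 : ℕ → Set Sample := fun j => {U | ¬ ∀ n : ℕ,
      (top (opn p U) ((j * D : ℕ) : ℤ) ⌊a * (j * D : ℕ) - H⌋ n : ℝ) ≤
        ⌊a * (j * D : ℕ) - H⌋ + (a + ε) * n + K}
    have hsub : failProb p (J * D) h a ≤
        law (bad0 ∪ (bad1 ∪ ⋃ j ∈ Finset.range (J + 1), bad2 j)) := by
      refine measure_mono_ae ?_
      filter_upwards [ae_good h0 h1] with U hU hcr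
      by_contra hc
      have hc' : U ∉ bad0 ∪ (bad1 ∪ ⋃ j ∈ Finset.range (J + 1), bad2 j) := hc
      simp only [mem_union, mem_iUnion, Finset.mem_range, not_or, not_exists] at hc'
      obtain ⟨c0, c1, c2⟩ := hc'
      exact hcr (hU.crossed_of_bounds ha0 hε0.le hD0 hH (Nat.le_ceil _) (not_lt.1 c0)
        (not_not.1 c1) fun j hj => not_not.1 (c2 j hj))
    have hb0 : law bad0 < ENNReal.ofReal (δ / 2) := by
      have := hj0 (J * d) (hd1'.trans (Nat.le_mul_of_pos_left _ hJ0))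
      have e : m * (J * d) = J * D := by rw [hD]; ring
      rwa [e] at this
    have hb2 : law (⋃ j ∈ Finset.range (J + 1), bad2 j) ≤
        (J + 1 : ℕ) * ENNReal.ofReal (δ / (2 * (J + 2))) := by
      refine (measure_biUnion_finset_le _ _).trans ?_
      refine (Finset.sum_le_card_nsmul _ _ _ fun j _ => (hK _ _).le).trans_eq ?_
      simp
    calc _ ≤ _ := hsub
      _ ≤ law bad0 + (law bad1 + law (⋃ j ∈ Finset.range (J + 1), bad2 j)) :=
        (measure_union_le _ _).trans (by gcongr; exact measure_union_le _ _)
      _ < ENNReal.ofReal (δ / 2) + ENNReal.ofReal (δ / 2) := by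
        refine ENNReal.add_lt_add_of_lt_of_le ?_ hb0 ?_
        · exact (ENNReal.add_lt_top.2 ⟨measure_lt_top _ _, measure_lt_top _ _⟩).ne
        · refine (add_le_add (hK 0 0).le hb2).trans_eq ?_
          rw [← ENNReal.ofReal_natCast, ← ENNReal.ofReal_mul (by positivity),
            ← ENNReal.ofReal_add (by positivity) (by positivity)]
          congr 1
          push_cast
          field_simp
          ring
      _ = _ := by rw [← ENNReal.ofReal_add (by positivity) (by positivity)]; ring_nf


/-! ### Infinite clusters -/

/-- The sites that can be reached from `x`. -/
def reachSet (O : Set (ℤ × ℤ)) (x : ℤ × ℤ) : Set (ℤ × ℤ) := {y | Reach O x y}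

section
variable {O : Set (ℤ × ℤ)}

theorem mem_reachSet_flip {x : ℤ × ℤ} :
    x ∈ reachSet (flip O) (0, 0) ↔ x.swap ∈ reachSet O (0, 0) := reach_flip

theorem infinite_reachSet_flip :
    (reachSet (flip O) (0, 0)).Infinite ↔ (reachSet O (0, 0)).Infinite := by
  have : reachSet (flip O) (0, 0) = Prod.swap ⁻¹' reachSet O (0, 0) := by
    ext x; exact mem_reachSet_flip
  rw [this]
  refine not_congr ⟨fun h => ?_, fun h => h.preimage Prod.swap_injective.injOn⟩
  have := h.preimage (f := Prod.swap) Prod.swap_injective.injOn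
  simpa [← preimage_comp] using this

/-- Linear lower bounds on the two edges force an infinite cluster. -/
theorem Good.exists_infinite_reachSet (hO : Good O) (hO' : Good (flip O)) {t : ℝ} (ht : 1 < t)
    {J J' : ℕ} (hJ : ∀ n : ℕ, t * n - J ≤ top O 0 0 n)
    (hJ' : ∀ n : ℕ, t * n - J' ≤ top (flip O) 0 0 n) : ∃ x, (reachSet O x).Infinite := by
  have htinv : 0 < t - 1 / t := by
    rw [sub_pos, div_lt_iff₀ (by linarith)]; nlinarith
  -- From column `n₀` on, the reflected edge path runs below the upper edge, because `t` and `1 / t`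
  -- have separated by more than the additive constants.
  obtain ⟨n₀, hn₀⟩ := exists_nat_ge ((J + J' + 1) / (t - 1 / t))
  rw [div_le_iff₀ htinv] at hn₀
  set hi : ℤ := max 0 (max (top O 0 0 n₀) (top O 0 0 (n₀ + 1))) with hhi
  have upper : ∀ n : ℕ, n₀ ≤ n → ∃ g j : ℤ, g ≤ hi ∧ Reach O (n₀, g) (n, j) ∧ ((n : ℤ), j) ∈ O ∧
      top O 0 0 (n + 1) ≤ j + 1 := by
    intro n hn
    obtain ⟨e, he, j, h1, h2, h3⟩ := exists_last_of_mem_ent_succ (hO.top_mem (a := 0) (b := 0)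
      (n := n + 1))
    simp only [zero_add] at h1 h2
    obtain ⟨⟨g1, g⟩, hg, k1, k2⟩ := h1.exists_column (c := n₀) (by simp) (by simpa using hn)
    simp only at hg
    subst hg
    refine ⟨g, j, ?_, k2, h2, by omega⟩
    exact (hO.reach_le (n := n₀) he k1 (by simp)).trans (le_max_right _ _)
  have lower : ∀ n : ℕ, n₀ ≤ n → ∃ g v : ℤ, 0 ≤ g ∧ Reach O (n₀, g) (n + 1, v) ∧
      v ≤ top O 0 0 (n + 1) := by
    intro n hn
    obtain ⟨m, hm⟩ : ∃ m : ℕ, m = ⌈(n + 1 + J' : ℝ) / t⌉₊ := ⟨_, rfl⟩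
    have hm1 : (n + 1 + J' : ℝ) / t ≤ m := hm ▸ Nat.le_ceil _
    have hm2 : (m : ℝ) < (n + 1 + J' : ℝ) / t + 1 := hm ▸ Nat.ceil_lt_add_one (by positivity)
    obtain ⟨e, he, h1⟩ := exists_reach_of_mem_ent (hO'.top_mem (a := 0) (b := 0) (n := m))
    simp only [zero_add] at h1
    have h2 := reach_flip.1 h1
    simp only [Prod.swap_prod_mk] at h2
    have h3 : ((n : ℤ) + 1) ≤ top (flip O) 0 0 m := by
      rw [div_le_iff₀ (by linarith)] at hm1
      have := hJ' m
      have : (n + 1 : ℝ) ≤ top (flip O) 0 0 m := by linarith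
      exact_mod_cast this
    simp only [mem_Iic] at he
    obtain ⟨⟨c, v⟩, hc, k1, k2⟩ := h2.exists_column (c := (n : ℤ) + 1) (by simp; omega) (by simpa)
    simp only at hc
    subst hc
    obtain ⟨⟨c, g⟩, hc, k3, k4⟩ := k1.exists_column (c := (n₀ : ℤ)) (by simp; omega)
      (by simp; omega)
    simp only at hc
    subst hc
    refine ⟨g, v, k3.le.2, k4, ?_⟩
    have h4 : v ≤ m := k2.le.2
    have h5 := hJ (n + 1)
    have h6 : (m : ℝ) ≤ top O 0 0 (n + 1) := by
      refine le_trans ?_ h5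
      push_cast
      have h7 : (J + J' + 1 : ℝ) ≤ (n + 1) * (t - 1 / t) := by
        refine hn₀.trans (mul_le_mul_of_nonneg_right ?_ htinv.le)
        have : (n₀ : ℝ) ≤ n := by exact_mod_cast hn
        linarith
      have h8 : (n + 1 + J' : ℝ) / t ≤ (n + 1) * (1 / t) + J' := by
        have : (J' : ℝ) / t ≤ J' := div_le_self (by positivity) ht.le
        have e : (n + 1 + J' : ℝ) / t = (n + 1) * (1 / t) + J' / t := by ring
        linarith
      nlinarith
    have h6' : (m : ℤ) ≤ top O 0 0 (n + 1) := by exact_mod_cast h6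
    omega
  -- Every column is reached from the fixed finite segment `0, …, hi` of column `n₀`. The upper path
  -- starts at or below `hi`, the lower one at or above 0. If neither starts in the segment, the
  -- path already constructed either meets the upper one or is squeezed above the lower one and
  -- crosses onto it.
  have key : ∀ n : ℕ, n₀ ≤ n → ∃ f ∈ Finset.Icc 0 hi, ∃ c, Reach O (n₀, f) (n, c) := by
    intro n hn
    induction n, hn using Nat.le_induction with
    | base => exact ⟨0, by simp [hhi], 0, .refl _⟩
    | succ n hn ih =>
      obtain ⟨f, hf, c, hc⟩ := ih
      rw [Finset.mem_Icc] at hf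
      obtain ⟨g, j, hg, h1, h2, h3⟩ := upper n hn
      obtain ⟨g', v, hg', h4, h5⟩ := lower n hn
      have hs : Reach O (n, j) ((n + 1 : ℕ), j) := Step.reach ⟨h2, by simp⟩
      by_cases hg0 : 0 ≤ g
      · exact ⟨g, Finset.mem_Icc.2 ⟨hg0, hg⟩, j, h1.trans hs⟩
      by_cases hjc : c ≤ j
      · exact ⟨f, Finset.mem_Icc.2 hf, j,
          (h1.cross_right hc rfl rfl (by simp; omega) (by simpa)).trans hs⟩
      by_cases hg1 : g' ≤ hi
      · exact ⟨g', Finset.mem_Icc.2 ⟨hg', hg1⟩, v, by simpa using h4⟩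
      obtain ⟨⟨d, w⟩, hd, h6, h7⟩ := h4.exists_column (c := (n : ℤ)) (by simpa) (by simp)
      simp only at hd
      subst hd
      have h8 : w ≤ v := h7.le.2
      exact ⟨f, Finset.mem_Icc.2 hf, v, by
        simpa using (hc.cross_left h6 rfl rfl (by simp; omega) (by simp; omega)).trans h7⟩
  by_contra hfin
  push Not at hfin
  have hU : (⋃ f ∈ Finset.Icc 0 hi, reachSet O (n₀, f)).Finite :=
    (Finset.Icc 0 hi).finite_toSet.biUnion fun f _ => hfin _
  obtain ⟨B, hB⟩ := (hU.image Prod.fst).bddAbove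
  obtain ⟨f, hf, c, hc⟩ := key (max n₀ (B.toNat + 1)) (le_max_left _ _)
  have := hB ⟨_, mem_biUnion (t := fun f => reachSet O ((n₀ : ℤ), f)) hf hc, rfl⟩
  simp only [Nat.cast_max] at this
  have := (le_max_right _ _).trans this
  push_cast at this
  have := Int.self_le_toNat B
  omega

/-- The cluster has finitely many sites in each column and cannot skip a column, so missing one
would make it finite. -/
theorem Good.exists_mem_reachSet_column (hO : Good O) (h : (reachSet O (0, 0)).Infinite) (n : ℕ) :
    ∃ y : ℤ, ((n : ℤ), y) ∈ reachSet O (0, 0) := by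
  by_contra hno
  push Not at hno
  refine h (((Finset.range n).finite_toSet.biUnion (t := fun k => (fun y : ℤ => ((k : ℤ), y)) ''
    Icc 0 (max (top O 0 0 k) (top O 0 0 (k + 1)))) fun k _ => (finite_Icc _ _).image _).subset ?_)
  rintro ⟨a, b⟩ hab
  have hle := Reach.le hab
  simp only at hle
  have ha : a < n := by
    by_contra hge
    obtain ⟨⟨c, y⟩, hc, h1, -⟩ := Reach.exists_column hab (c := n) (by simp) (by simpa using hge)
    simp only at hc
    subst hc
    exact hno y h1
  lift a to ℕ using hle.1
  refine mem_biUnion (x := a) (by simpa using ha) ⟨b, ⟨hle.2, ?_⟩, rfl⟩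
  exact hO.reach_le (n := a) le_rfl hab (by simp)

/-- The path to the edge starts at or below the origin; if it ends above a site of the cluster in
that column, it has crossed the path from the origin. -/
theorem Good.exists_mem_reachSet_top_le (hO : Good O) (h : (reachSet O (0, 0)).Infinite) (n : ℕ) :
    ∃ y : ℤ, ((n : ℤ), y) ∈ reachSet O (0, 0) ∧ top O 0 0 n ≤ y := by
  obtain ⟨c, hc⟩ := hO.exists_mem_reachSet_column h n
  by_cases hct : top O 0 0 n ≤ c
  · exact ⟨c, hc, hct⟩
  obtain ⟨e, he, h1⟩ := exists_reach_of_mem_ent (hO.top_mem (a := 0) (b := 0) (n := n))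
  simp only [zero_add] at h1
  refine ⟨_, ?_, le_rfl⟩
  exact h1.cross_right hc rfl rfl (by simpa using he) (by simp; omega)

theorem Good.reachSet_le (hO : Good O) {r : ℝ} (hr : 0 ≤ r) {K : ℕ}
    (hK : ∀ n : ℕ, (top O 0 0 n : ℝ) ≤ r * n + K) {x : ℤ × ℤ} (hx : x ∈ reachSet O (0, 0)) :
    (x.2 : ℝ) ≤ r * (x.1 + 1) + K := by
  obtain ⟨a, b⟩ := x
  have hle := Reach.le hx
  simp only at hle
  lift a to ℕ using hle.1
  have h1 : b ≤ max (top O 0 0 a) (top O 0 0 (a + 1)) := hO.reach_le (n := a) le_rfl hx (by simp)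
  have h2 := hK a
  have h3 := hK (a + 1)
  push_cast at h3 ⊢
  rcases le_max_iff.1 h1 with h4 | h4
  · have : (b : ℝ) ≤ top O 0 0 a := by exact_mod_cast h4
    linarith
  · have : (b : ℝ) ≤ top O 0 0 (a + 1) := by exact_mod_cast h4
    linarith

end

/-- The reflection that turns the three allowed steps into right, up and diagonal. -/
def mirror : ℤ × ℤ ≃ ℤ × ℤ := (Equiv.neg ℤ).prodCongr (Equiv.refl ℤ)

@[simp] theorem mirror_apply (x : ℤ × ℤ) : mirror x = (-x.1, x.2) := rfl

theorem mirror_mirror (x : ℤ × ℤ) : mirror (mirror x) = x := by simp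

theorem step_mirror (p : ℝ) (U : Sample) (x y : ℤ × ℤ) :
    y - x ∈ env p U x ↔ Step (opn p (reindex mirror U)) (mirror x) (mirror y) := by
  rw [opn_reindex]
  have e : mirror x ∈ mirror ⁻¹' opn p U ↔ (U x : ℝ) < p := by
    rw [mem_preimage, mirror_mirror]; rfl
  unfold Step
  rw [e]
  show _ ∧ _ ↔ _
  refine and_congr_right fun _ => ?_
  simp only [steps, mem_insert_iff, mem_singleton_iff, Prod.ext_iff, Prod.fst_sub, Prod.snd_sub,
    mirror_apply]
  omega

theorem originCluster_eq (p : ℝ) (U : Sample) :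
    originCluster p U = mirror ⁻¹' reachSet (opn p (reindex mirror U)) (0, 0) := by
  ext y
  constructor
  · intro h
    exact Relation.ReflTransGen.lift mirror (fun a b hab => (step_mirror p U a b).1 hab) _ _ h
  · intro h
    have := Relation.ReflTransGen.lift (p := fun a b => b - a ∈ env p U a) mirror
      (fun a b hab => by
        show mirror b - mirror a ∈ env p U (mirror a)
        rw [step_mirror, mirror_mirror, mirror_mirror]; exact hab) _ _ h
    change Connects (env p U) (mirror (0, 0)) (mirror (mirror y)) at this
    rw [mirror_mirror] at this
    exact this

theorem mem_originCluster {p : ℝ} {U : Sample} {x : ℤ × ℤ} : x ∈ originCluster p U ↔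
    (-x.1, x.2) ∈ reachSet (opn p (reindex mirror U)) (0, 0) := by
  rw [originCluster_eq]; rfl

theorem infinite_originCluster {p : ℝ} {U : Sample} : (originCluster p U).Infinite ↔
    (reachSet (opn p (reindex mirror U)) (0, 0)).Infinite := by
  rw [originCluster_eq]
  refine not_congr ⟨fun h => ?_, fun h => h.preimage mirror.injective.injOn⟩
  have := h.image mirror
  rwa [image_preimage_eq _ mirror.surjective] at this

/-! ### The percolation probability -/

theorem theta_eq (p : ℝ) : theta p = law {U | (reachSet (opn p U) (0, 0)).Infinite} := by
  rw [← law_reindex mirror]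
  unfold theta
  congr 1
  ext U
  exact infinite_originCluster

theorem theta_mono {p p' : ℝ} (h : p ≤ p') : theta p ≤ theta p' := by
  rw [theta_eq, theta_eq]
  exact measure_mono fun U hU => Infinite.mono (fun x hx => Reach.mono (opn_mono h U) hx) hU

theorem ae_flip {P : Set (ℤ × ℤ) → Prop} {p : ℝ} (h : ∀ᵐ U ∂law, P (opn p U)) :
    ∀ᵐ U ∂law, P (flip (opn p U)) := by
  filter_upwards [ae_reindex (Equiv.prodComm ℤ ℤ) h] with U hU
  rw [opn_reindex] at hU
  exact hU

/-- Almost surely some site has an infinite cluster. There are countably many sites, all with the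
same probability, so that probability is positive. -/
theorem theta_pos_of_le_top {p t : ℝ} (h0 : 0 < p) (h1 : p < 1) (ht : 1 < t)
    (h : ∀ᵐ U ∂law, ∃ K : ℕ, ∀ n : ℕ, t * n - K ≤ top (opn p U) 0 0 n) : 0 < theta p := by
  by_contra hno
  have hz : law {U | (reachSet (opn p U) (0, 0)).Infinite} = 0 := by
    rw [← theta_eq]; simpa using hno
  have hx : ∀ x : ℤ × ℤ, ∀ᵐ U ∂law, ¬ (reachSet (opn p U) x).Infinite := by
    intro x
    have h2 : ∀ᵐ U ∂law, ¬ (reachSet (opn p U) (0, 0)).Infinite := by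
      simpa [ae_iff] using hz
    filter_upwards [ae_reindex (Equiv.addRight x) h2] with U hU hinf
    refine hU ?_
    rw [opn_reindex]
    have e : reachSet (Equiv.addRight x ⁻¹' opn p U) (0, 0) =
        (Equiv.addRight x) ⁻¹' reachSet (opn p U) x := by
      ext y
      have := reach_translate (O := opn p U) (x := (0, 0)) (y := y) x
      rw [show ((0, 0) : ℤ × ℤ) + x = x from zero_add x] at this
      exact this
    rw [e]
    intro hfin
    have := hfin.image (Equiv.addRight x)
    rw [image_preimage_eq _ (Equiv.addRight x).surjective] at this
    exact hinf this
  have : ∀ᵐ U ∂law, False := by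
    filter_upwards [ae_all_iff.2 hx, ae_good h0 h1, ae_flip (ae_good h0 h1), h,
      ae_flip (P := fun O => ∃ K : ℕ, ∀ n : ℕ, t * n - K ≤ top O 0 0 n) h]
      with U hU hg hg' ⟨J, hJ⟩ ⟨J', hJ'⟩
    obtain ⟨x, hx⟩ := hg.exists_infinite_reachSet hg' ht hJ hJ'
    exact hU x hx
  exact this.exists.elim fun _ h => h

/-! ### The speed of the upper edge -/

/-- The asymptotic mean speed of the upper edge. -/
noncomputable def speed (p : ℝ) : ℝ := ⨅ n : ℕ, meanTop p (n + 1) / (n + 1 : ℕ)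

section
variable {p s : ℝ}

theorem le_speed (hs : ∀ n : ℕ, s * n ≤ meanTop p n) : s ≤ speed p :=
  le_ciInf fun n => (le_div_iff₀ (by positivity)).2 (hs (n + 1))

theorem speed_mul_le (hs : ∀ n : ℕ, s * n ≤ meanTop p n) (n : ℕ) : speed p * n ≤ meanTop p n := by
  cases n with
  | zero => simpa using hs 0
  | succ n =>
    rw [← le_div_iff₀ (by positivity)]
    refine ciInf_le ⟨s, ?_⟩ n
    rintro _ ⟨n, rfl⟩
    exact (le_div_iff₀ (by positivity)).2 (hs (n + 1))

theorem exists_meanTop_lt (h : speed p < s) : ∃ m : ℕ, 0 < m ∧ meanTop p m < s * m := by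
  obtain ⟨n, hn⟩ := exists_lt_of_ciInf_lt h
  exact ⟨n + 1, by omega, (div_lt_iff₀ (by positivity)).1 hn⟩

end

/-- If the mean speed exceeds `1`, so does the almost sure speed, also at slightly smaller
parameters. -/
theorem exists_ae_le_top {p s t : ℝ} (h0 : 0 < p) (h1 : p < 1) (ht : 1 < t) (hts : t < s)
    (hs : ∀ n : ℕ, s * n ≤ meanTop p n) : ∃ p₀, 0 < p₀ ∧ p₀ < p ∧ ∀ p', p₀ ≤ p' → p' < 1 →
      ∀ᵐ U ∂law, ∃ K : ℕ, ∀ n : ℕ, t * n - K ≤ top (opn p' U) 0 0 n := by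
  set a := speed p with ha
  have hsa : s ≤ a := le_speed hs
  have ha1 : ∀ n : ℕ, a * n ≤ meanTop p n := speed_mul_le hs
  have ha2 : ∀ ε > 0, ∃ m : ℕ, 0 < m ∧ meanTop p m < (a + ε) * m := fun ε hε =>
    exists_meanTop_lt (by linarith)
  obtain ⟨ε, Q, M, hC⟩ := exists_scaleConst ht (hts.trans_le hsa)
  have hM : (0 : ℝ) < M := by
    have := hC.four_le
    positivity
  obtain ⟨L, h, hh, hη, hf⟩ := exists_failProb_le h0 h1 (by linarith) ha1 ha2 hC.pos
    (δ := 1 / (64 * M ^ 2)) (by positivity)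
  -- The crossing estimate for this single tube is all the iteration needs; it survives lowering the
  -- parameter, and increasing it again only helps.
  obtain ⟨p₁, hp₁, hf₁⟩ := exists_lt_failProb_lt hf
  refine ⟨max p₁ (p / 2), by simp [h0], max_lt hp₁ (by linarith), fun p' hp' hp'1 => ?_⟩
  have hp0 : 0 < p' := lt_of_lt_of_le (by simp [h0]) hp'
  refine ScaleInv.ae_le_top hC (L := L) (h := h) (s := a) ⟨hh, by simpa using hη, ?_, le_rfl, ?_⟩
    hp0 hp'1
  · have := hC.loss; norm_num; linarith
  · simpa using (failProb_anti ((le_max_left _ _).trans hp')).trans hf₁.le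

/-- Otherwise both the upper edge and its reflection grow with slope at most some `r < 1`, and these
two constraints leave only a bounded region for the cluster. -/
theorem le_meanTop_of_theta_pos {p : ℝ} (h0 : 0 < p) (h1 : p < 1) (hθ : 0 < theta p) (n : ℕ) :
    (n : ℝ) ≤ meanTop p n := by
  rcases Nat.eq_zero_or_pos n with rfl | hn
  · simp [meanTop]
  by_contra! hlt
  have hn' : (0 : ℝ) < n := by exact_mod_cast hn
  obtain ⟨r, hr0, hr1, hr⟩ : ∃ r : ℝ, 0 ≤ r ∧ r < 1 ∧ meanTop p n < r * n := by
    obtain ⟨r, h2, h3⟩ := exists_between (show max 0 (meanTop p n / n) < 1 from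
      max_lt one_pos ((div_lt_one hn').2 hlt))
    exact ⟨r, (le_max_left _ _).trans h2.le, h3, (div_lt_iff₀ hn').1 ((le_max_right _ _).trans_lt h2)⟩
  have hae := ae_top_le h0 h1 hn hr0 hr
  have : ∀ᵐ U ∂law, ¬ (reachSet (opn p U) (0, 0)).Infinite := by
    filter_upwards [ae_good h0 h1, ae_flip (ae_good h0 h1), hae,
      ae_flip (P := fun O => ∃ K : ℕ, ∀ n : ℕ, (top O 0 0 n : ℝ) ≤ r * n + K) hae]
      with U hg hg' ⟨K, hK⟩ ⟨K', hK'⟩ hinf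
    obtain ⟨N, hN⟩ := exists_nat_gt ((r + K + (r + K')) / (1 - r))
    rw [div_lt_iff₀ (by linarith)] at hN
    obtain ⟨y, hy⟩ := hg.exists_mem_reachSet_column hinf N
    have h2 := hg.reachSet_le hr0 hK hy
    have h3 := hg'.reachSet_le hr0 hK' (x := (y, N)) (mem_reachSet_flip.2 hy)
    have h4 := (Reach.le hy).2
    have h5 : (0 : ℝ) ≤ y := by exact_mod_cast h4
    simp only [Int.cast_natCast] at h2 h3
    nlinarith
  rw [theta_eq] at hθ
  have h6 : law {U | (reachSet (opn p U) (0, 0)).Infinite} = 0 := by simpa [ae_iff] using this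
  exact hθ.ne' h6


/-! ### The critical value -/

/-- The staircase that alternates vertical and diagonal steps has slope 2. -/
theorem crossed_univ (L : ℕ) : Crossed univ 0 0 L 1 2 := by
  have key : ∀ k : ℕ, k ≤ L → ((k : ℤ), (2 * k : ℤ)) ∈ tube 0 0 L 1 2 ∧
      Reach (univ ∩ tube 0 0 L 1 2) (0, 0) ((k : ℤ), (2 * k : ℤ)) := by
    intro k hk
    have hm : ((k : ℤ), (2 * k : ℤ)) ∈ tube 0 0 L 1 2 :=
      mem_tube.2 ⟨by simp, by simpa using hk, by simp, by simp⟩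
    refine ⟨hm, ?_⟩
    induction k with
    | zero => exact .refl _
    | succ k ih =>
      have hm1 : ((k : ℤ), (2 * k : ℤ)) ∈ tube 0 0 L 1 2 :=
        mem_tube.2 ⟨by simp, by simp; omega, by simp, by simp⟩
      have hm2 : ((k : ℤ), (2 * k + 1 : ℤ)) ∈ tube 0 0 L 1 2 :=
        mem_tube.2 ⟨by simp, by simp; omega, by simp; linarith, by simp⟩
      refine (ih (by omega) hm1).trans ?_
      have hs1 : Step (univ ∩ tube 0 0 L 1 2) ((k : ℤ), (2 * k : ℤ)) ((k : ℤ), (2 * k + 1 : ℤ)) :=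
        ⟨⟨trivial, hm1⟩, by simp⟩
      refine hs1.reach.trans (Step.reach ⟨⟨trivial, hm2⟩, ?_⟩)
      simp; omega
  obtain ⟨h1, h2⟩ := key L le_rfl
  exact ⟨_, _, rfl, by simp, (key 0 (by omega)).1, h1, h2⟩

theorem failProb_one (L : ℕ) : failProb 1 L 1 2 = 0 := by
  have h : ∀ᵐ U ∂law, ∀ x : ℤ × ℤ, (U x : ℝ) ≠ 1 := by
    refine ae_all_iff.2 fun x => ?_
    have := law_eq x 1
    simpa [ae_iff] using this
  have h' : ∀ᵐ U ∂law, Crossed (opn 1 U) 0 0 L 1 2 := by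
    filter_upwards [h] with U hU
    have : opn 1 U = univ := eq_univ_of_forall fun x => lt_of_le_of_ne (U x).2.2 (hU x)
    rw [this]
    exact crossed_univ L
  exact h'

/-- At `p = 1` slope 2 tubes are crossed almost surely; left-continuity gives a crossing estimate
good enough for the iteration at some `p < 1`. -/
theorem exists_theta_pos : ∃ p : ℝ, 0 < p ∧ p < 1 ∧ 0 < theta p := by
  obtain ⟨ε, Q, M, hC⟩ := exists_scaleConst (t := 3 / 2) (s₀ := 2) (by norm_num) (by norm_num)
  have hM : (0 : ℝ) < M := by
    have := hC.four_le
    positivity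
  obtain ⟨L, hL⟩ := exists_nat_ge (1 / ε)
  rw [div_le_iff₀ hC.pos] at hL
  obtain ⟨p₁, hp₁, hf⟩ := exists_lt_failProb_lt (p := 1) (L := L) (h := 1) (s := 2)
    (δ := ENNReal.ofReal (1 / (64 * M ^ 2)))
    (by rw [failProb_one, ENNReal.ofReal_pos]; positivity)
  have h0 : (0 : ℝ) < max p₁ (1 / 2) := by simp
  have h1 : max p₁ (1 / 2) < 1 := max_lt hp₁ (by norm_num)
  refine ⟨_, h0, h1, theta_pos_of_le_top h0 h1 hC.one_lt ?_⟩
  refine ScaleInv.ae_le_top hC (L := L) (h := 1) (s := 2) ⟨le_rfl, ?_, ?_, le_rfl, ?_⟩ h0 h1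
  · simpa [mul_comm] using hL
  · have := hC.loss; norm_num at this ⊢; linarith
  · simpa using (failProb_anti (le_max_left _ _)).trans hf.le

theorem pc_le {p : ℝ} (h0 : 0 ≤ p) (h1 : p ≤ 1) (h : 0 < theta p) : pc ≤ p :=
  csInf_le ⟨0, fun _ hq => hq.1.1⟩ ⟨⟨h0, h1⟩, h⟩

theorem pc_lt_one : pc < 1 := by
  obtain ⟨p, h0, h1, h⟩ := exists_theta_pos
  exact (pc_le h0.le h1.le h).trans_lt h1

theorem theta_pos_of_pc_lt {p : ℝ} (h : pc < p) : 0 < theta p := by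
  obtain ⟨q, h0, h1, hq⟩ := exists_theta_pos
  have hne : {p : ℝ | p ∈ Icc (0 : ℝ) 1 ∧ 0 < theta p}.Nonempty := ⟨q, ⟨h0.le, h1.le⟩, hq⟩
  obtain ⟨q, ⟨-, hq⟩, hqp⟩ := exists_lt_of_csInf_lt hne h
  exact hq.trans_le (theta_mono hqp.le)

/-- Percolation at `p` requires `meanTop p 1 ≥ 1`, while `meanTop p 1 ≤ p / (1 - p)`, so `pc` is at
least `1 / 2`. -/
theorem pc_pos : 0 < pc := by
  refine lt_of_lt_of_le (b := 1 / 2) (by norm_num) ?_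
  obtain ⟨q, h0, h1, hq⟩ := exists_theta_pos
  refine le_csInf ⟨q, ⟨h0.le, h1.le⟩, hq⟩ ?_
  rintro p ⟨-, hp⟩
  by_contra! hlt
  -- Passing to a larger parameter keeps percolation and ensures positivity.
  set q := max p (1 / 4) with hq
  have hq0 : 0 < q := by simp [hq]
  have hq1 : q < 1 / 2 := max_lt hlt (by norm_num)
  have h2 := le_meanTop_of_theta_pos hq0 (by linarith) (hp.trans_le (theta_mono (le_max_left _ _))) 1
  have h3 := h2.trans (meanTop_one_le hq0 (by linarith))
  rw [le_div_iff₀ (by linarith)] at h3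
  norm_num at h3
  linarith

/-! ### Properties of the speed -/

theorem le_meanTop_of_pc_lt {p : ℝ} (h : pc < p) (h1 : p < 1) (n : ℕ) :
    1 * (n : ℝ) ≤ meanTop p n := by
  rw [one_mul]
  exact le_meanTop_of_theta_pos (pc_pos.trans h) h1 (theta_pos_of_pc_lt h) n

theorem speed_add_le {p p' : ℝ} (h : pc < p) (hp : p ≤ p') (h1 : p' < 1) :
    speed p + (p' - p) ≤ speed p' := by
  refine le_speed fun n => ?_
  have h2 := speed_mul_le (le_meanTop_of_pc_lt h (hp.trans_lt h1)) n
  have h3 := meanTop_add_le (pc_pos.trans h) hp h1 n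
  linarith

/-- Percolation only gives speed at least 1; the strict inequality comes from comparison with a
parameter between `pc` and `p`. -/
theorem one_lt_speed {p : ℝ} (h : pc < p) (h1 : p < 1) : 1 < speed p := by
  obtain ⟨q, hq, hqp⟩ := exists_between h
  have h2 := speed_add_le hq hqp.le h1
  have h3 : 1 ≤ speed q := le_speed (le_meanTop_of_pc_lt hq (hqp.trans h1))
  linarith

theorem ae_top_le_of_speed_lt {p r : ℝ} (h0 : 0 < p) (h1 : p < 1) (hr0 : 0 ≤ r)
    (hr : speed p < r) :
    ∀ᵐ U ∂law, ∃ K : ℕ, ∀ n : ℕ, (top (opn p U) 0 0 n : ℝ) ≤ r * n + K := by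
  obtain ⟨m, hm, hlt⟩ := exists_meanTop_lt hr
  exact ae_top_le h0 h1 hm hr0 hlt

theorem le_speed_of_ae_le_top {p t : ℝ} (h0 : 0 < p) (h1 : p < 1) (ht : 0 < t)
    (h : ∀ᵐ U ∂law, ∃ K : ℕ, ∀ n : ℕ, t * n - K ≤ top (opn p U) 0 0 n) : t ≤ speed p := by
  by_contra! hlt
  obtain ⟨r, hr, hrt⟩ := exists_between (max_lt ht hlt)
  obtain ⟨U, ⟨K, hK⟩, K', hK'⟩ := (h.and (ae_top_le_of_speed_lt h0 h1
    ((le_max_left _ _).trans hr.le) ((le_max_right _ _).trans_lt hr))).exists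
  obtain ⟨n, hn⟩ := exists_nat_gt ((K + K' : ℝ) / (t - r))
  rw [div_lt_iff₀ (by linarith)] at hn
  linarith [hK n, hK' n]

theorem ae_le_top_of_lt_speed {p t : ℝ} (h : pc < p) (h1 : p < 1) (ht : 1 < t)
    (hts : t < speed p) :
    ∀ᵐ U ∂law, ∃ K : ℕ, ∀ n : ℕ, t * n - K ≤ top (opn p U) 0 0 n := by
  obtain ⟨p₀, -, hp, hae⟩ := exists_ae_le_top (pc_pos.trans h) h1 ht hts
    (speed_mul_le (le_meanTop_of_pc_lt h h1))
  exact hae p hp.le h1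

/-- A single column `m` bounds the infimum, and its mean is right-continuous. The case `p = pc` is
included for the limit at criticality. -/
theorem eventually_speed_lt {p b : ℝ} (h : pc ≤ p) (h1 : p < 1) {m : ℕ} (hm : 0 < m)
    (hb : meanTop p m < b * m) : ∀ᶠ q in 𝓝[>] p, speed q < b := by
  filter_upwards [(tendsto_meanTop_right (pc_pos.trans_le h) h1 m).eventually_lt_const hb,
    Ioo_mem_nhdsGT h1] with q hq hpq
  have hm' : (0 : ℝ) < m := by exact_mod_cast hm
  have := speed_mul_le (le_meanTop_of_pc_lt (h.trans_lt hpq.1) hpq.2) m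
  exact lt_of_mul_lt_mul_right (this.trans_lt hq) hm'.le

theorem continuousAt_speed {p : ℝ} (h : pc < p) (h1 : p < 1) : ContinuousAt speed p := by
  refine tendsto_order.2 ⟨fun b hb => ?_, fun b hb => ?_⟩
  · obtain ⟨t, ht, hts⟩ := exists_between (max_lt (one_lt_speed h h1) hb)
    have ht1 : 1 < t := (le_max_left _ _).trans_lt ht
    -- The lower bound holds on both sides of `p`, because the crossing estimate at `p` persists
    -- down to `p₀`.
    obtain ⟨p₀, hp₀, hp, hae⟩ := exists_ae_le_top (pc_pos.trans h) h1 ht1 hts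
      (speed_mul_le (le_meanTop_of_pc_lt h h1))
    filter_upwards [Ioo_mem_nhds hp h1] with q hq
    exact ((le_max_right _ _).trans_lt ht).trans_le (le_speed_of_ae_le_top (hp₀.trans hq.1) hq.2
      (by linarith) (hae q hq.1.le hq.2))
  · rw [← nhdsLE_sup_nhdsGT, eventually_sup]
    constructor
    · filter_upwards [self_mem_nhdsWithin, mem_nhdsWithin_of_mem_nhds (Ioi_mem_nhds h)] with q hq hq'
      have := speed_add_le hq' hq h1
      have : q ≤ p := hq
      linarith
    · obtain ⟨m, hm, hlt⟩ := exists_meanTop_lt hb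
      exact eventually_speed_lt h.le h1 hm hlt

theorem tendsto_speed_pc : Tendsto speed (𝓝[>] pc) (𝓝 1) := by
  refine tendsto_order.2 ⟨fun b hb => ?_, fun b hb => ?_⟩
  · filter_upwards [Ioo_mem_nhdsGT pc_lt_one] with q hq
    exact hb.trans (one_lt_speed hq.1 hq.2)
  · by_cases hm : ∃ m : ℕ, 0 < m ∧ meanTop pc m < b * m
    · obtain ⟨m, hm, hlt⟩ := hm
      exact eventually_speed_lt le_rfl pc_lt_one hm hlt
    -- Here the mean slope at `pc` is at least `b > 1` in every column, and the iteration would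
    -- yield percolation at some `p₀ < pc`.
    · push Not at hm
      obtain ⟨t, ht, htb⟩ := exists_between hb
      obtain ⟨p₀, h0, hp, hae⟩ := exists_ae_le_top pc_pos pc_lt_one ht htb fun n => by
        rcases Nat.eq_zero_or_pos n with rfl | hn
        · simp [meanTop]
        · exact hm n hn
      have h1 := hp.trans pc_lt_one
      exact absurd (pc_le h0.le h1.le (theta_pos_of_le_top h0 h1 ht (hae p₀ le_rfl h1))) (not_le.2 hp)

/-! ### The boundary slope -/

theorem tendsto_div_of_bounds {W : ℕ → ℝ} {a : ℝ}
    (hup : ∀ ε > 0, ∃ K : ℝ, ∀ n : ℕ, W n ≤ (a + ε) * n + K)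
    (hlo : ∀ ε > 0, ∃ K : ℝ, ∀ n : ℕ, (a - ε) * n - K ≤ W n) :
    Tendsto (fun n : ℕ => W n / n) atTop (𝓝 a) := by
  have hK : ∀ K : ℝ, Tendsto (fun n : ℕ => K / (n : ℝ)) atTop (𝓝 0) := fun K =>
    tendsto_const_div_atTop_nhds_zero_nat K
  refine tendsto_order.2 ⟨fun b hb => ?_, fun b hb => ?_⟩
  · obtain ⟨K, hKn⟩ := hlo ((a - b) / 2) (by linarith)
    filter_upwards [(hK K).eventually_lt_const (show 0 < (a - b) / 2 by linarith),
      eventually_gt_atTop 0] with n hn hn0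
    have hn' : (0 : ℝ) < n := by exact_mod_cast hn0
    rw [div_lt_iff₀ hn'] at hn
    rw [lt_div_iff₀ hn']
    linarith [hKn n]
  · obtain ⟨K, hKn⟩ := hup ((b - a) / 2) (by linarith)
    filter_upwards [(hK K).eventually_lt_const (show 0 < (b - a) / 2 by linarith),
      eventually_gt_atTop 0] with n hn hn0
    have hn' : (0 : ℝ) < n := by exact_mod_cast hn0
    rw [div_lt_iff₀ hn'] at hn
    rw [div_lt_iff₀ hn']
    linarith [hKn n]

theorem tendsto_ereal_div_of_bounds {W : ℕ → EReal} {a : ℝ}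
    (hup : ∀ ε > 0, ∃ K : ℝ, ∀ n : ℕ, W n ≤ (((a + ε) * n + K : ℝ) : EReal))
    (hlo : ∀ ε > 0, ∃ K : ℝ, ∀ n : ℕ, (((a - ε) * n - K : ℝ) : EReal) ≤ W n) :
    Tendsto (fun n : ℕ => W n / ((-(n : ℝ) : ℝ) : EReal)) atTop (𝓝 ((-a : ℝ) : EReal)) := by
  have hW : ∀ n, W n = ((W n).toReal : EReal) := by
    intro n
    obtain ⟨K, hK⟩ := hup 1 one_pos
    obtain ⟨K', hK'⟩ := hlo 1 one_pos
    exact (EReal.coe_toReal ((hK n).trans_lt (EReal.coe_lt_top _)).ne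
      ((EReal.bot_lt_coe _).trans_le (hK' n)).ne').symm
  have h : Tendsto (fun n : ℕ => (W n).toReal / n) atTop (𝓝 a) := by
    refine tendsto_div_of_bounds (fun ε hε => ?_) fun ε hε => ?_
    · obtain ⟨K, hK⟩ := hup ε hε
      refine ⟨K, fun n => ?_⟩
      have := hK n
      rw [hW n] at this
      exact_mod_cast this
    · obtain ⟨K, hK⟩ := hlo ε hε
      refine ⟨K, fun n => ?_⟩
      have := hK n
      rw [hW n] at this
      exact_mod_cast this
  refine (EReal.tendsto_coe.2 h.neg).congr fun n => ?_
  rw [hW n, ← EReal.coe_div, EReal.toReal_coe, div_neg]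

/-- Linear bounds on the two edges determine the boundary slopes of an infinite cluster. -/
theorem Good.tendsto_upper_lower {O C : Set (ℤ × ℤ)} (hO : Good O) (hO' : Good (flip O))
    (hC : ∀ x : ℤ × ℤ, x ∈ C ↔ (-x.1, x.2) ∈ reachSet O (0, 0))
    (hinf : (reachSet O (0, 0)).Infinite) {a : ℝ} (ha : 1 < a)
    (hup : ∀ ε > 0, ∃ r, a < r ∧ r ≤ a + ε ∧ ∃ K : ℕ, ∀ n : ℕ,
      (top O 0 0 n : ℝ) ≤ r * n + K ∧ (top (flip O) 0 0 n : ℝ) ≤ r * n + K)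
    (hlo : ∀ ε > 0, ∃ t, 1 < t ∧ t < a ∧ a - ε ≤ t ∧ ∃ K : ℕ, ∀ n : ℕ,
      t * n - K ≤ top O 0 0 n ∧ t * n - K ≤ top (flip O) 0 0 n) :
    Tendsto (fun n : ℕ => upper C n / ((-(n : ℝ) : ℝ) : EReal)) atTop (𝓝 ((-a : ℝ) : EReal)) ∧
    Tendsto (fun n : ℕ => lower C n / ((-(n : ℝ) : ℝ) : EReal)) atTop
      (𝓝 ((-(1 / a) : ℝ) : EReal)) := by
  have hC' : ∀ (n : ℕ) (y : ℤ), (-(n : ℤ), y) ∈ C ↔ ((n : ℤ), y) ∈ reachSet O (0, 0) := by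
    intro n y; rw [hC]; simp
  constructor <;> refine tendsto_ereal_div_of_bounds (fun ε hε => ?_) fun ε hε => ?_
  · obtain ⟨r, hr, hr', K, hK⟩ := hup ε hε
    refine ⟨r + K, fun n => iSup₂_le fun y hy => ?_⟩
    have h1 := hO.reachSet_le (by linarith) (fun n => (hK n).1) ((hC' n y).1 hy)
    have : r * n ≤ (a + ε) * n := by gcongr
    simp only [Int.cast_natCast] at h1
    exact_mod_cast show (y : ℝ) ≤ (a + ε) * n + (r + K) by linarith
  · obtain ⟨t, ht, ht', hta, K, hK⟩ := hlo ε hε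
    refine ⟨K, fun n => ?_⟩
    obtain ⟨y, hy, hty⟩ := hO.exists_mem_reachSet_top_le hinf n
    refine le_trans ?_ (le_iSup₂ (f := fun (y : ℤ) (_ : y ∈ {y : ℤ | (-(n : ℤ), y) ∈ C}) =>
      ((y : ℝ) : EReal)) y ((hC' n y).2 hy))
    have : (a - ε) * n ≤ t * n := by gcongr
    have h2 : (top O 0 0 n : ℝ) ≤ y := by exact_mod_cast hty
    exact_mod_cast show (a - ε) * n - K ≤ (y : ℝ) by linarith [(hK n).1]
  · obtain ⟨t, ht, ht', hta, K, hK⟩ := hlo ε hε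
    refine ⟨K + 1, fun n => ?_⟩
    -- In row `m` the cluster reaches beyond column `n`, by the lower bound for the reflected edge;
    -- the path to that site passes column `n` at height at most `m`.
    obtain ⟨m, hm⟩ : ∃ m : ℕ, m = ⌈(n + K : ℝ) / t⌉₊ := ⟨_, rfl⟩
    have hm1 : (n + K : ℝ) / t ≤ m := hm ▸ Nat.le_ceil _
    have hm2 : (m : ℝ) < (n + K : ℝ) / t + 1 := hm ▸ Nat.ceil_lt_add_one (by positivity)
    obtain ⟨x, hx, htx⟩ := hO'.exists_mem_reachSet_top_le (infinite_reachSet_flip.2 hinf) m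
    have hx' : (x, (m : ℤ)) ∈ reachSet O (0, 0) := mem_reachSet_flip.1 hx
    have hnx : (n : ℤ) ≤ x := by
      rw [div_le_iff₀ (by linarith)] at hm1
      have h2 : (top (flip O) 0 0 m : ℝ) ≤ x := by exact_mod_cast htx
      have : (n : ℝ) ≤ x := by linarith [(hK m).2]
      exact_mod_cast this
    obtain ⟨⟨c, y⟩, hc, h1, h2⟩ := Reach.exists_column hx' (c := n) (by simp) (by simpa)
    simp only at hc
    subst hc
    refine (iInf₂_le (f := fun (y : ℤ) (_ : y ∈ {y : ℤ | (-(n : ℤ), y) ∈ C}) =>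
      ((y : ℝ) : EReal)) y ((hC' n y).2 h1)).trans ?_
    have h3 : y ≤ m := h2.le.2
    have h3' : (y : ℝ) ≤ m := by exact_mod_cast h3
    have h4 : 1 / t ≤ 1 / a + ε := by
      rw [div_add' _ _ _ (by linarith), div_le_div_iff₀ (by linarith) (by linarith)]
      have : 0 ≤ ε * (a * t - 1) := mul_nonneg hε.le (by nlinarith)
      linarith
    have h5 : (n + K : ℝ) / t ≤ (1 / a + ε) * n + K := by
      have e : (n + K : ℝ) / t = 1 / t * n + K / t := by ring
      have : (K : ℝ) / t ≤ K := div_le_self (by positivity) ht.le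
      have : 1 / t * n ≤ (1 / a + ε) * n := by gcongr
      linarith
    exact_mod_cast show (y : ℝ) ≤ (1 / a + ε) * n + (K + 1) by linarith
  · obtain ⟨r, hr, hr', K, hK⟩ := hup ε hε
    refine ⟨K + 1, fun n => le_iInf₂ fun y hy => ?_⟩
    have h1 := hO'.reachSet_le (by linarith) (fun n => (hK n).2)
      (mem_reachSet_flip.2 ((hC' n y).1 hy) : (y, (n : ℤ)) ∈ _)
    simp only [Int.cast_natCast] at h1
    have h4 : 1 / a - ε ≤ 1 / r := by
      rw [div_sub' (by linarith), div_le_div_iff₀ (by linarith) (by linarith)]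
      have : 0 ≤ ε * (a * r - 1) := mul_nonneg hε.le (by nlinarith)
      linarith
    have h5 : 1 / r * n ≤ y + 1 + K := by
      have h6 : (K : ℝ) ≤ K * r := le_mul_of_one_le_right (by positivity) (by linarith)
      rw [div_mul_eq_mul_div, one_mul, div_le_iff₀ (by linarith)]
      linarith
    have : (1 / a - ε) * n ≤ 1 / r * n := by gcongr
    exact_mod_cast show (1 / a - ε) * n - (K + 1) ≤ (y : ℝ) by linarith

/-- The edge bounds hold almost surely for each slope; rational slopes make the exceptional set
common to all of them. -/
theorem isBoundarySlope_neg_speed {p : ℝ} (h : pc < p) (h1 : p < 1) :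
    IsBoundarySlope p (-speed p) := by
  have h0 := pc_pos.trans h
  have hs := one_lt_speed h h1
  have hup : ∀ᵐ U ∂law, ∀ r : ℚ, speed p < r → ∃ K : ℕ, ∀ n : ℕ,
      (top (opn p U) 0 0 n : ℝ) ≤ r * n + K := by
    refine ae_all_iff.2 fun r => ?_
    by_cases hr : speed p < r
    · filter_upwards [ae_top_le_of_speed_lt h0 h1 (by linarith) hr] with U hU _ using hU
    · exact Eventually.of_forall fun _ h => absurd h hr
  have hlo : ∀ᵐ U ∂law, ∀ t : ℚ, (1 : ℝ) < t → t < speed p → ∃ K : ℕ, ∀ n : ℕ,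
      (t : ℝ) * n - K ≤ top (opn p U) 0 0 n := by
    refine ae_all_iff.2 fun t => ?_
    by_cases ht : (1 : ℝ) < t ∧ t < speed p
    · filter_upwards [ae_le_top_of_lt_speed h h1 ht.1 ht.2] with U hU _ _ using hU
    · exact Eventually.of_forall fun _ h h' => absurd ⟨h, h'⟩ ht
  have hg := ae_good h0 h1
  have hup' := ae_flip (P := fun O => ∀ r : ℚ, speed p < r → ∃ K : ℕ, ∀ n : ℕ,
      (top O 0 0 n : ℝ) ≤ r * n + K) hup
  have hlo' := ae_flip (P := fun O => ∀ t : ℚ, (1 : ℝ) < t → t < speed p → ∃ K : ℕ, ∀ n : ℕ,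
      (t : ℝ) * n - K ≤ top O 0 0 n) hlo
  filter_upwards [ae_reindex mirror hg, ae_reindex mirror (ae_flip hg), ae_reindex mirror hup,
    ae_reindex mirror hup', ae_reindex mirror hlo, ae_reindex mirror hlo']
    with U hg hg' hup hup' hlo hlo' hinf
  rw [one_div, inv_neg, ← one_div]
  refine hg.tendsto_upper_lower hg' (fun x => mem_originCluster) (infinite_originCluster.1 hinf) hs
    (fun ε hε => ?_) fun ε hε => ?_
  · obtain ⟨r, hr, hr'⟩ := exists_rat_btwn (show speed p < speed p + ε by linarith)
    obtain ⟨K, hK⟩ := hup r hr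
    obtain ⟨K', hK'⟩ := hup' r hr
    refine ⟨r, hr, hr'.le, K + K', fun n => ⟨?_, ?_⟩⟩
    · push_cast; linarith [hK n, Nat.cast_nonneg (α := ℝ) K']
    · push_cast; linarith [hK' n, Nat.cast_nonneg (α := ℝ) K]
  · obtain ⟨t, ht, ht'⟩ := exists_rat_btwn (max_lt hs (show speed p - ε < speed p by linarith))
    have ht1 := (le_max_left _ _).trans_lt ht
    obtain ⟨K, hK⟩ := hlo t ht1 ht'
    obtain ⟨K', hK'⟩ := hlo' t ht1 ht'
    refine ⟨t, ht1, ht', (le_max_right _ _).trans ht.le, K + K', fun n => ⟨?_, ?_⟩⟩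
    · push_cast; linarith [hK n, Nat.cast_nonneg (α := ℝ) K']
    · push_cast; linarith [hK' n, Nat.cast_nonneg (α := ℝ) K]

theorem IsBoundarySlope.unique {p r r' : ℝ} (hθ : 0 < theta p) (h : IsBoundarySlope p r)
    (h' : IsBoundarySlope p r') : r = r' := by
  by_contra hne
  have : ∀ᵐ U ∂law, ¬ (originCluster p U).Infinite := by
    filter_upwards [h, h'] with U hU hU' hinf
    exact hne (EReal.coe_injective (tendsto_nhds_unique (hU hinf).1 (hU' hinf).1))
  refine hθ.ne' ?_
  unfold theta
  simpa [ae_iff] using this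

end OTSP

/-! ### The main theorem -/

theorem lemma2 :
    OTSP.pc < 1 ∧
    ∃ ρ : ℝ → ℝ,
      (∀ p ∈ Ioo OTSP.pc 1, ∀ r : ℝ, OTSP.IsBoundarySlope p r ↔ r = ρ p) ∧
      ContinuousOn ρ (Ioo OTSP.pc 1) ∧
      StrictAntiOn ρ (Ioo OTSP.pc 1) ∧
      Tendsto ρ (𝓝[>] OTSP.pc) (𝓝 (-1)) := by
  refine ⟨OTSP.pc_lt_one, fun p => -OTSP.speed p, fun p hp r => ⟨fun h => ?_, ?_⟩,
    fun p hp => ?_, fun p hp q hq hpq => ?_, OTSP.tendsto_speed_pc.neg⟩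
  · exact h.unique (OTSP.theta_pos_of_pc_lt hp.1) (OTSP.isBoundarySlope_neg_speed hp.1 hp.2)
  · rintro rfl
    exact OTSP.isBoundarySlope_neg_speed hp.1 hp.2
  · exact (OTSP.continuousAt_speed hp.1 hp.2).neg.continuousWithinAt
  · have := OTSP.speed_add_le hp.1 hpq.le hq.2
    simp only [neg_lt_neg_iff]
    linarith
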